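/- **Setting.** Let $n>2$ be an integer and let $a_1,a_2\in\mathbb C\setminus\mathbb Z$ with $a_1-a_2\in\mathbb Z$. Put $a=(-1,\dots,-1,a_1,a_2,0,\dots,0)\in\mathbb C^{2n}$, with $n-1$ entries $-1$ and $n-1$ entries $0$. Let $N_{a_1,a_2}$ be the complex vector space with basis the symbols $x(c)$, where $c\in\mathbb C^{2n}$ runs over the tuples such that $c_i-a_i\in\mathbb Z$ for all $i$, $c_i$ is a negative integer if and only if $a_i$ is, and $\sum_i c_i=\sum_i a_i$. The Lie algebra $\mathfrak{sl}_{2n}(\mathbb C)$ acts on $N_{a_1,a_2}$ by letting the elementary matrix $E_{i,j}$ act as $q_ip_j$, where $$q_i x(c)=\begin{cases}(c_i+1)\,x(c+\epsilon_i)& c_i\in\mathbb Z_{<0}\\ x(c+\epsilon_i)&\text{otherwise,}\end{cases}\qquad p_j x(c)=\begin{cases}x(c-\epsilon_j)& c_j\in\mathbb Z_{<0}\\ c_j\,x(c-\epsilon_j)&\text{otherwise.}\end{cases}$$ Let $\mathfrak b\cong\mathfrak{sl}_n$ be the subalgebra of block matrices $\mathrm{diag}(A,A)$, $A\in\mathfrak{sl}_n$,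 and let $\mathfrak a\cong\mathfrak{sl}_2$ be its commutant, spanned by $X=\sum_{i=1}^nE_{n+i,i}$, $Y=\sum_{i=1}^nE_{i,n+i}$ and $H=\sum_{i=1}^n(E_{i,i}-E_{n+i,n+i})$. Let $L(\mu_1,\dots,\mu_{n-1})$ denote the simple highest weight $\mathfrak b$-module with respect to the upper triangular matrices, whose highest weight takes the value $\mu_i$ on $H_i=\mathrm{diag}(E_{i,i}-E_{i+1,i+1},E_{i,i}-E_{i+1,i+1})$. Let $V(z)$ and $L(z)$ denote the Verma module and the simple highest weight module of $\mathfrak a$, with raising operator $Y$ and highest weight $z$ on $H$. For $b\in\mathbb Z$ put $x(b,0)=x(-1,\dots,-1,a_1+b,a_2-b,0,\dots,0)$, and let $\mathcal U(\mathfrak b)x(b,0)$ and $\mathcal U(\mathfrak a)x(b,0)$ be the $\mathfrak b$-submodule and the $\mathfrak a$-submodule of $N_{a_1,a_2}$ that it generates. For a $\mathfrak b$-module $P$ and an $\mathfrak a$-module $Q$ write $P\leftrightarrow Q$ if there is an injective $\mathfrak b\oplus\mathfrak a$-equivariant linear map $\Phi:P\otimes Q\to N_{a_1,a_2}$ such that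 every $\mathfrak b$-homomorphism $P\to N_{a_1,a_2}$ has the form $p\mapsto\Phi(p\otimes q)$ for some $q\in Q$. **Theorem.** Let $b\in\mathbb Z$. 1. If $a_1-a_2+2b-(n-2)=0$, then $\mathcal U(\mathfrak b)x(b,0)$ is a simple $\mathfrak b$-module isomorphic to $L(a_2-b,0,\dots,0,-1-a_1-b)$, $\mathcal U(\mathfrak a)x(b,0)\cong L(-1)$, and $L(a_2-b,0,\dots,0,-1-a_1-b)\leftrightarrow L(-1)$. 2. If $a_1-a_2+2b-(n-2)>0$, then $\mathcal U(\mathfrak b)x(b,0)$ is a simple $\mathfrak b$-module isomorphic to $L(a_2-b,0,\dots,0,-1-a_1-b)$, $\mathcal U(\mathfrak a)x(b,0)\cong V(a_1-a_2+2b-(n-1))$, and $L(a_2-b,0,\dots,0,-1-a_1-b)\leftrightarrow V(a_1-a_2+2b-(n-1))$. 3. If $a_1-a_2+2b-(n-2)<0$, then $\mathcal U(\mathfrak b)x(b,0)$ is an indecomposable $\mathfrak b$-module of length $2$, $\mathcal U(\mathfrak a)x(b,0)\cong L(a_1-a_2+2b-(n-1))$, and $\mathcal U(\mathfrak b)x(b,0)\leftrightarrow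 L(a_1-a_2+2b-(n-1))$. -/

import Mathlib

attribute [local instance] LieRing.ofAssociativeRing

namespace HoweDual

noncomputable section

/-! ### General representation theory -/

section General

variable (𝔤 : Type*) [LieRing 𝔤] [LieAlgebra ℂ 𝔤]

/-- The left ideal of `U(𝔤)` generated by the `e i` and the `h i - μ i`. -/
def vermaIdeal {I : Type*} (e h : I → 𝔤) (μ : I → ℂ) :
    Ideal (UniversalEnvelopingAlgebra ℂ 𝔤) :=
  Ideal.span
    (Set.range (fun i => UniversalEnvelopingAlgebra.ι ℂ (e i)) ∪
      Set.range (fun i => UniversalEnvelopingAlgebra.ι ℂ (h i) -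
        algebraMap ℂ (UniversalEnvelopingAlgebra ℂ 𝔤) (μ i)))

/-- The Verma module of highest weight `μ` (the weight taking the value `μ i` on `h i`), for a
Lie algebra whose upper nilpotent part is generated by the raising elements `e i` and whose Cartan
subalgebra is spanned by the `h i`. -/
def VermaModule {I : Type*} (e h : I → 𝔤) (μ : I → ℂ) : Type _ :=
  UniversalEnvelopingAlgebra ℂ 𝔤 ⧸ vermaIdeal 𝔤 e h μ

variable {I : Type*} (e h : I → 𝔤) (μ : I → ℂ)

instance : AddCommGroup (VermaModule 𝔤 e h μ) :=
  inferInstanceAs (AddCommGroup (UniversalEnvelopingAlgebra ℂ 𝔤 ⧸ vermaIdeal 𝔤 e h μ))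

instance : Module (UniversalEnvelopingAlgebra ℂ 𝔤) (VermaModule 𝔤 e h μ) :=
  inferInstanceAs (Module (UniversalEnvelopingAlgebra ℂ 𝔤)
    (UniversalEnvelopingAlgebra ℂ 𝔤 ⧸ vermaIdeal 𝔤 e h μ))

instance : Module ℂ (VermaModule 𝔤 e h μ) :=
  inferInstanceAs (Module ℂ (UniversalEnvelopingAlgebra ℂ 𝔤 ⧸ vermaIdeal 𝔤 e h μ))

instance : IsScalarTower ℂ (UniversalEnvelopingAlgebra ℂ 𝔤) (VermaModule 𝔤 e h μ) :=
  inferInstanceAs (IsScalarTower ℂ (UniversalEnvelopingAlgebra ℂ 𝔤)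
    (UniversalEnvelopingAlgebra ℂ 𝔤 ⧸ vermaIdeal 𝔤 e h μ))

/-- `𝔤` acts through left multiplication in `U(𝔤)`. -/
instance : LieRingModule 𝔤 (VermaModule 𝔤 e h μ) where
  bracket x m := UniversalEnvelopingAlgebra.ι ℂ x • m
  add_lie x y m := by
    rw [map_add, add_smul]
  lie_add x m m' := smul_add _ m m'
  leibniz_lie x y m := by
    change UniversalEnvelopingAlgebra.ι ℂ x • UniversalEnvelopingAlgebra.ι ℂ y • m =
      UniversalEnvelopingAlgebra.ι ℂ ⁅x, y⁆ • m +
        UniversalEnvelopingAlgebra.ι ℂ y • UniversalEnvelopingAlgebra.ι ℂ x • m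
    rw [LieHom.map_lie, LieRing.of_associative_ring_bracket, sub_smul, mul_smul, mul_smul]
    abel

instance : LieModule ℂ 𝔤 (VermaModule 𝔤 e h μ) where
  smul_lie t x m := by
    change UniversalEnvelopingAlgebra.ι ℂ (t • x) • m = t • UniversalEnvelopingAlgebra.ι ℂ x • m
    rw [map_smul, smul_assoc]
  lie_smul t x m := by
    change UniversalEnvelopingAlgebra.ι ℂ x • t • m = t • UniversalEnvelopingAlgebra.ι ℂ x • m
    rw [← algebraMap_smul (UniversalEnvelopingAlgebra ℂ 𝔤) t m,
      ← algebraMap_smul (UniversalEnvelopingAlgebra ℂ 𝔤) t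
        (UniversalEnvelopingAlgebra.ι ℂ x • m), ← mul_smul, ← mul_smul,
      Algebra.commutes]

/-- The simple highest weight module `L(μ)`: the quotient of the Verma module by its largest
proper submodule, that is, by the sum of all its proper submodules. -/
abbrev SimpleHighestWeightModule : Type _ :=
  VermaModule 𝔤 e h μ ⧸ sSup {S : LieSubmodule ℂ 𝔤 (VermaModule 𝔤 e h μ) | S ≠ ⊤}

variable (M : Type*) [AddCommGroup M] [Module ℂ M] [LieRingModule 𝔤 M]
  [LieModule ℂ 𝔤 M]

/-- `M` has a composition series `0 ⊂ S ⊂ M` with exactly two simple factors. -/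
def HasLengthTwo : Prop :=
  ∃ S : LieSubmodule ℂ 𝔤 M, LieModule.IsIrreducible ℂ 𝔤 S ∧ LieModule.IsIrreducible ℂ 𝔤 (M ⧸ S)

/-- `M` is nonzero and is not the direct sum of two nonzero submodules. -/
def IsIndecomposable : Prop :=
  Nontrivial M ∧ ∀ S T : LieSubmodule ℂ 𝔤 M, IsCompl S T → S = ⊥ ∨ T = ⊥

end General

/-! ### The modules `N(a)` of `𝔰𝔩` through the Weyl algebra -/

section Weyl

/-- The space with basis the symbols `x(b)`, for all `b : ι → ℂ`. -/
def MonomialSpace (ι : Type*) : Type _ := (ι → ℂ) →₀ ℂ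

instance (ι : Type*) : AddCommGroup (MonomialSpace ι) :=
  inferInstanceAs (AddCommGroup ((ι → ℂ) →₀ ℂ))

instance (ι : Type*) : Module ℂ (MonomialSpace ι) :=
  inferInstanceAs (Module ℂ ((ι → ℂ) →₀ ℂ))

/-- The basis vector `x(b)`. -/
def mono {ι : Type*} (b : ι → ℂ) : MonomialSpace ι := Finsupp.single b (1 : ℂ)

/-- `z` is a negative integer. -/
def IsNegInt (z : ℂ) : Prop := ∃ k : ℤ, k < 0 ∧ z = k

open Classical in
/-- The coefficient in `q_i x(b) = qCoeff (b_i) x(b + ε_i)`. -/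
def qCoeff (z : ℂ) : ℂ := if IsNegInt z then z + 1 else 1

open Classical in
/-- The coefficient in `p_j x(b) = pCoeff (b_j) x(b - ε_j)`. -/
def pCoeff (z : ℂ) : ℂ := if IsNegInt z then 1 else z

/-- The operator `q_i`. -/
def qOp {ι : Type*} [DecidableEq ι] (i : ι) : MonomialSpace ι →ₗ[ℂ] MonomialSpace ι :=
  Finsupp.linearCombination ℂ fun b : ι → ℂ => qCoeff (b i) • mono (b + Pi.single i 1)

/-- The operator `p_j`. -/
def pOp {ι : Type*} [DecidableEq ι] (j : ι) : MonomialSpace ι →ₗ[ℂ] MonomialSpace ι :=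
  Finsupp.linearCombination ℂ fun b : ι → ℂ => pCoeff (b j) • mono (b - Pi.single j 1)

theorem qOp_mono {ι : Type*} [DecidableEq ι] (i : ι) (b : ι → ℂ) :
    qOp i (mono b) = qCoeff (b i) • mono (b + Pi.single i 1) := by
  exact (Finsupp.linearCombination_single ℂ (1 : ℂ) b).trans (one_smul ℂ _)

theorem pOp_mono {ι : Type*} [DecidableEq ι] (j : ι) (b : ι → ℂ) :
    pOp j (mono b) = pCoeff (b j) • mono (b - Pi.single j 1) := by
  exact (Finsupp.linearCombination_single ℂ (1 : ℂ) b).trans (one_smul ℂ _)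

theorem hom_ext_mono {ι : Type*} {f g : MonomialSpace ι →ₗ[ℂ] MonomialSpace ι}
    (hfg : ∀ b, f (mono b) = g (mono b)) : f = g := by
  refine Finsupp.lhom_ext' fun b => LinearMap.ext_ring ?_
  exact hfg b

theorem isNegInt_sub_one {z : ℂ} (hz : IsNegInt z) : IsNegInt (z - 1) := by
  obtain ⟨k, hk, rfl⟩ := hz
  exact ⟨k - 1, by omega, by push_cast; ring⟩

theorem isNegInt_of_add_one {z : ℂ} (hz : IsNegInt (z + 1)) : IsNegInt z := by
  simpa using isNegInt_sub_one hz

theorem isNegInt_add_one {z : ℂ} (hz : IsNegInt z) (h0 : z + 1 ≠ 0) : IsNegInt (z + 1) := by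
  obtain ⟨k, hk, rfl⟩ := hz
  have : k + 1 ≠ 0 := fun h => h0 (by exact_mod_cast h)
  exact ⟨k + 1, by omega, by push_cast; ring⟩

theorem qCoeff_mul_pCoeff (z : ℂ) : qCoeff z * pCoeff (z + 1) = z + 1 := by
  unfold qCoeff pCoeff
  by_cases hz : IsNegInt z
  · by_cases h0 : z + 1 = 0
    · simp [hz, h0]
    · simp [hz, isNegInt_add_one hz h0]
  · have h1 : ¬ IsNegInt (z + 1) := fun h => hz (isNegInt_of_add_one h)
    simp [hz, h1]

theorem qOp_comm {ι : Type*} [DecidableEq ι] (i j : ι) :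
    qOp i ∘ₗ qOp j = qOp j ∘ₗ qOp i := by
  rcases eq_or_ne i j with rfl | hij
  · rfl
  refine hom_ext_mono fun b => ?_
  simp only [LinearMap.comp_apply, qOp_mono, map_smul, smul_smul, Pi.add_apply,
    Pi.single_eq_of_ne hij, Pi.single_eq_of_ne hij.symm, add_zero]
  rw [mul_comm, add_right_comm]

theorem pOp_comm {ι : Type*} [DecidableEq ι] (i j : ι) :
    pOp i ∘ₗ pOp j = pOp j ∘ₗ pOp i := by
  rcases eq_or_ne i j with rfl | hij
  · rfl
  refine hom_ext_mono fun b => ?_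
  simp only [LinearMap.comp_apply, pOp_mono, map_smul, smul_smul, Pi.sub_apply,
    Pi.single_eq_of_ne hij, Pi.single_eq_of_ne hij.symm, sub_zero]
  rw [mul_comm, sub_right_comm]

theorem pOp_qOp {ι : Type*} [DecidableEq ι] (j i : ι) :
    pOp j ∘ₗ qOp i = qOp i ∘ₗ pOp j + (if j = i then 1 else 0 : ℂ) • LinearMap.id := by
  refine hom_ext_mono fun b => ?_
  rcases eq_or_ne j i with rfl | hij
  · have h1 := qCoeff_mul_pCoeff (b j)
    have h2 := qCoeff_mul_pCoeff (b j - 1)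
    rw [sub_add_cancel] at h2
    simp only [LinearMap.comp_apply, LinearMap.add_apply, qOp_mono, pOp_mono, map_smul, smul_smul,
      Pi.add_apply, Pi.sub_apply, Pi.single_eq_same, add_sub_cancel_right, sub_add_cancel,
      LinearMap.smul_apply, LinearMap.id_apply, if_true, h1]
    rw [mul_comm, h2, ← add_smul]
  · simp only [LinearMap.comp_apply, qOp_mono, pOp_mono, map_smul, smul_smul,
      Pi.add_apply, Pi.sub_apply, Pi.single_eq_of_ne hij, Pi.single_eq_of_ne hij.symm,
      add_zero, sub_zero, if_neg hij, zero_smul]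
    rw [mul_comm, add_sub_right_comm]

/-- `E_{i,j}` acts as `q_i p_j`; hence a matrix `A` acts as `∑ A i j q_i p_j`. -/
def glAction (ι : Type*) [Fintype ι] [DecidableEq ι] :
    Matrix ι ι ℂ →ₗ[ℂ] MonomialSpace ι →ₗ[ℂ] MonomialSpace ι where
  toFun A := ∑ i, ∑ j, A i j • (qOp i ∘ₗ pOp j)
  map_add' A B := by simp [add_smul, Finset.sum_add_distrib]
  map_smul' t A := by simp [mul_smul, Finset.smul_sum]

theorem glAction_single {ι : Type*} [Fintype ι] [DecidableEq ι] (i j : ι) (t : ℂ)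
    (v : MonomialSpace ι) :
    glAction ι (Matrix.single i j t) v = t • qOp i (pOp j v) := by
  have h : glAction ι (Matrix.single i j t) =
      ∑ i', ∑ j', Matrix.single i j t i' j' • (qOp i' ∘ₗ pOp j') := rfl
  rw [h, Finset.sum_eq_single i, Finset.sum_eq_single j]
  · simp
  · intro j' _ hj
    simp [hj.symm]
  · simp
  · intro i' _ hi
    simp [hi.symm]
  · simp

theorem glAction_lie_single {ι : Type*} [Fintype ι] [DecidableEq ι] (i j k l : ι) (s t : ℂ)
    (v : MonomialSpace ι) :
    glAction ι (Matrix.single i j s) (glAction ι (Matrix.single k l t) v) =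
      glAction ι (Matrix.single i j s * Matrix.single k l t -
        Matrix.single k l t * Matrix.single i j s) v +
      glAction ι (Matrix.single k l t) (glAction ι (Matrix.single i j s) v) := by
  have hq : qOp i (qOp k (pOp j (pOp l v))) = qOp k (qOp i (pOp l (pOp j v))) := by
    have e1 := LinearMap.congr_fun (pOp_comm j l) v
    have e2 := LinearMap.congr_fun (qOp_comm i k) (pOp l (pOp j v))
    simp only [LinearMap.comp_apply] at e1 e2
    rw [e1, e2]
  have h1 := LinearMap.congr_fun (pOp_qOp j k) (pOp l v)
  have h2 := LinearMap.congr_fun (pOp_qOp l i) (pOp j v)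
  simp only [LinearMap.comp_apply, LinearMap.add_apply, LinearMap.smul_apply,
    LinearMap.id_apply] at h1 h2
  have m1 : glAction ι (Matrix.single i j s * Matrix.single k l t) v =
      (s * t * if j = k then 1 else 0) • qOp i (pOp l v) := by
    split_ifs with h
    · subst h
      rw [Matrix.single_mul_single_same, glAction_single, mul_one]
    · rw [Matrix.single_mul_single_of_ne _ _ _ _ h]
      simp
  have m2 : glAction ι (Matrix.single k l t * Matrix.single i j s) v =
      (t * s * if l = i then 1 else 0) • qOp k (pOp j v) := by
    split_ifs with h
    · subst h
      rw [Matrix.single_mul_single_same, glAction_single, mul_one]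
    · rw [Matrix.single_mul_single_of_ne _ _ _ _ h]
      simp
  rw [map_sub, LinearMap.sub_apply, m1, m2]
  simp only [glAction_single, map_smul, h1, h2, map_add, smul_add, hq, smul_smul]
  rw [mul_comm t s]
  module

theorem glAction_lie {ι : Type*} [Fintype ι] [DecidableEq ι] (A B : Matrix ι ι ℂ)
    (v : MonomialSpace ι) :
    glAction ι A (glAction ι B v) =
      glAction ι (A * B - B * A) v + glAction ι B (glAction ι A v) := by
  induction A using Matrix.induction_on' with
  | h_zero => simp
  | h_add A A' hA hA' =>
    rw [add_mul, mul_add, add_sub_add_comm]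
    simp only [map_add, LinearMap.add_apply, hA, hA']
    abel
  | h_std_basis i j s =>
    induction B using Matrix.induction_on' with
    | h_zero => simp
    | h_add B B' hB hB' =>
      rw [add_mul, mul_add, add_sub_add_comm]
      simp only [map_add, LinearMap.add_apply, hB, hB']
      abel
    | h_std_basis k l t => exact glAction_lie_single i j k l s t v

instance (ι : Type*) [Fintype ι] [DecidableEq ι] :
    LieRingModule (Matrix ι ι ℂ) (MonomialSpace ι) where
  bracket A v := glAction ι A v
  add_lie A B v := by simp
  lie_add A v w := by simp
  leibniz_lie A B v := by
    rw [LieRing.of_associative_ring_bracket]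
    exact glAction_lie A B v

instance (ι : Type*) [Fintype ι] [DecidableEq ι] :
    LieModule ℂ (Matrix ι ι ℂ) (MonomialSpace ι) where
  smul_lie t A v := by
    change glAction ι (t • A) v = t • glAction ι A v
    simp
  lie_smul t A v := (glAction ι A).map_smul t v

/-- The set `𝒫_a` of admissible exponents: `b_i - a_i ∈ ℤ` for all `i`, `b_i` is a negative
integer if and only if `a_i` is, and `∑ b_i = ∑ a_i`. -/
def admissible {ι : Type*} [Fintype ι] (a : ι → ℂ) : Set (ι → ℂ) :=
  {b | (∀ i, ∃ k : ℤ, b i - a i = k) ∧ (∀ i, IsNegInt (b i) ↔ IsNegInt (a i)) ∧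
    ∑ i, b i = ∑ i, a i}

theorem qOp_pOp_mem {ι : Type*} [Fintype ι] [DecidableEq ι] (a b : ι → ℂ)
    (hb : b ∈ admissible a) (i j : ι) :
    qOp i (pOp j (mono b)) ∈ Submodule.span ℂ (mono '' admissible a) := by
  rw [pOp_mono, map_smul, qOp_mono, smul_smul]
  set b' := b - Pi.single j 1 with hb'
  set b'' := b' + Pi.single i 1 with hb''
  by_cases h0 : pCoeff (b j) * qCoeff (b' i) = 0
  · rw [h0, zero_smul]
    exact Submodule.zero_mem _
  have hp := left_ne_zero_of_mul h0
  have hq := right_ne_zero_of_mul h0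
  refine Submodule.smul_mem _ _ (Submodule.subset_span ⟨b'', ⟨fun k => ?_, fun k => ?_, ?_⟩, rfl⟩)
  · obtain ⟨m, hm⟩ := hb.1 k
    refine ⟨m - (if k = j then 1 else 0) + (if k = i then 1 else 0), ?_⟩
    simp only [hb'', hb', Pi.add_apply, Pi.sub_apply, Pi.single_apply]
    push_cast
    rw [← hm]
    ring
  · rw [← hb.2.1 k]
    have h1 : IsNegInt (b' k) ↔ IsNegInt (b k) := by
      rcases eq_or_ne k j with rfl | hk
      · simp only [hb', Pi.sub_apply, Pi.single_eq_same]
        refine ⟨fun h => ?_, isNegInt_sub_one⟩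
        by_contra hn
        have h2 : b k ≠ 0 := by simpa [pCoeff, hn] using hp
        exact hn (by simpa using isNegInt_add_one h (by simpa using h2))
      · simp [hb', Pi.single_eq_of_ne hk]
    rw [← h1]
    rcases eq_or_ne k i with rfl | hk
    · simp only [hb'', Pi.add_apply, Pi.single_eq_same]
      refine ⟨isNegInt_of_add_one, fun h => isNegInt_add_one h ?_⟩
      simpa [qCoeff, h] using hq
    · simp [hb'', Pi.single_eq_of_ne hk]
  · rw [← hb.2.2]
    simp [hb'', hb', Finset.sum_add_distrib, Finset.sum_sub_distrib]

/-- The `𝔰𝔩`-module `N(a)`, with basis the admissible vectors `x(b)`, `b ∈ 𝒫_a`. -/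
def moduleN {ι : Type*} [Fintype ι] [DecidableEq ι] (a : ι → ℂ) :
    LieSubmodule ℂ (LieAlgebra.SpecialLinear.sl ι ℂ) (MonomialSpace ι) where
  toSubmodule := Submodule.span ℂ (mono '' admissible a)
  lie_mem := by
    intro A v hv
    change glAction ι A.1 v ∈ Submodule.span ℂ (mono '' admissible a)
    have hv' : v ∈ Submodule.span ℂ (mono '' admissible a) := hv
    induction hv' using Submodule.span_induction with
    | mem x hx =>
      obtain ⟨b, hb, rfl⟩ := hx
      have h : glAction ι A.1 (mono b) = ∑ i, ∑ j, A.1 i j • qOp i (pOp j (mono b)) := by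
        simp [glAction]
      rw [h]
      exact Submodule.sum_mem _ fun i _ => Submodule.sum_mem _ fun j _ =>
        Submodule.smul_mem _ _ (qOp_pOp_mem a b hb i j)
    | zero => simp
    | add x y hx hy ihx ihy =>
      rw [map_add]
      exact Submodule.add_mem _ (ihx hx) (ihy hy)
    | smul t x hx ihx =>
      rw [map_smul]
      exact Submodule.smul_mem _ _ (ihx hx)

end Weyl

/-! ### The dual pair `(𝔰𝔩₂, 𝔰𝔩ₙ)` in `𝔰𝔩₂ₙ`

The index set of the `2n × 2n` matrices is `Fin n ⊕ Fin n`: the `i`-th index of the first block is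
the `i`-th one, and the `i`-th index of the second block is the `(n+i)`-th one. -/

section DualPair

open LieAlgebra.SpecialLinear

/-- The Lie algebra `𝔤 = 𝔰𝔩₂ₙ`. -/
abbrev sl2n (n : ℕ) : LieSubalgebra ℂ (Matrix (Fin n ⊕ Fin n) (Fin n ⊕ Fin n) ℂ) :=
  sl (Fin n ⊕ Fin n) ℂ

/-- The embedding of `𝔰𝔩ₙ` into `𝔰𝔩₂ₙ` that sends `A` to `diag(A, A)`. -/
def diagEmbedding (n : ℕ) : sl (Fin n) ℂ →ₗ⁅ℂ⁆ sl2n n where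
  toFun A := ⟨Matrix.fromBlocks A.1 0 0 A.1, by
    have hA : Matrix.trace A.1 = 0 := A.2
    change Matrix.trace (Matrix.fromBlocks A.1 0 0 A.1) = 0
    rw [Matrix.trace, Fintype.sum_sum_type]
    simpa [Matrix.trace] using hA⟩
  map_add' A B := by
    ext1
    simp [Matrix.fromBlocks_add]
  map_smul' t A := by
    ext1
    simp [Matrix.fromBlocks_smul]
  map_lie' {A B} := by
    ext1
    change Matrix.fromBlocks (A.1 * B.1 - B.1 * A.1) 0 0 (A.1 * B.1 - B.1 * A.1) =
      Matrix.fromBlocks A.1 0 0 A.1 * Matrix.fromBlocks B.1 0 0 B.1 -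
        Matrix.fromBlocks B.1 0 0 B.1 * Matrix.fromBlocks A.1 0 0 A.1
    simp [Matrix.fromBlocks_multiply, sub_eq_add_neg, Matrix.fromBlocks_add,
      Matrix.fromBlocks_neg]

/-- The subalgebra `𝔟 ≅ 𝔰𝔩ₙ` of the matrices `diag(A, A)`. -/
def bAlg (n : ℕ) : LieSubalgebra ℂ (sl2n n) := (diagEmbedding n).range

/-- `X = ∑ E_{n+i,i}`. -/
def elemX (n : ℕ) : sl2n n :=
  ⟨Matrix.fromBlocks 0 0 1 0, by
    change Matrix.trace (Matrix.fromBlocks 0 0 1 0 : Matrix (Fin n ⊕ Fin n) (Fin n ⊕ Fin n) ℂ) = 0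
    rw [Matrix.trace, Fintype.sum_sum_type]
    simp⟩

/-- `Y = ∑ E_{i,n+i}`. -/
def elemY (n : ℕ) : sl2n n :=
  ⟨Matrix.fromBlocks 0 1 0 0, by
    change Matrix.trace (Matrix.fromBlocks 0 1 0 0 : Matrix (Fin n ⊕ Fin n) (Fin n ⊕ Fin n) ℂ) = 0
    rw [Matrix.trace, Fintype.sum_sum_type]
    simp⟩

/-- `H = ∑ (E_{i,i} - E_{n+i,n+i})`. -/
def elemH (n : ℕ) : sl2n n :=
  ⟨Matrix.fromBlocks 1 0 0 (-1), by
    change Matrix.trace (Matrix.fromBlocks 1 0 0 (-1) : Matrix (Fin n ⊕ Fin n) (Fin n ⊕ Fin n) ℂ) = 0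
    rw [Matrix.trace, Fintype.sum_sum_type]
    simp⟩

/-- The subalgebra `𝔞 ≅ 𝔰𝔩₂` generated by `X`, `H`, `Y`. -/
def aAlg (n : ℕ) : LieSubalgebra ℂ (sl2n n) :=
  LieSubalgebra.lieSpan ℂ (sl2n n) {elemX n, elemH n, elemY n}

/-- The raising element `X_i = diag(E_{i,i+1}, E_{i,i+1})` of `𝔟`. -/
def bRaise (n : ℕ) (i : Fin (n - 1)) : bAlg n :=
  ⟨diagEmbedding n (single (⟨i, by omega⟩ : Fin n) ⟨i + 1, by omega⟩ (by simp) 1), ⟨_, rfl⟩⟩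

/-- The coroot `H_i = diag(E_{i,i} - E_{i+1,i+1}, E_{i,i} - E_{i+1,i+1})` of `𝔟`. -/
def bCoroot (n : ℕ) (i : Fin (n - 1)) : bAlg n :=
  ⟨diagEmbedding n (singleSubSingle (⟨i, by omega⟩ : Fin n) ⟨i + 1, by omega⟩ 1), ⟨_, rfl⟩⟩

/-- The simple highest weight `𝔟`-module whose highest weight takes the value `μ i` on `H_i`. -/
abbrev bSimple (n : ℕ) (μ : Fin (n - 1) → ℂ) : Type :=
  SimpleHighestWeightModule (bAlg n) (bRaise n) (bCoroot n) μ

/-- The raising element of `𝔞`, which is `Y`. -/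
def aRaise (n : ℕ) : aAlg n := ⟨elemY n, LieSubalgebra.subset_lieSpan (by simp)⟩

/-- The coroot of `𝔞`, which is `H`. -/
def aCoroot (n : ℕ) : aAlg n := ⟨elemH n, LieSubalgebra.subset_lieSpan (by simp)⟩

/-- The Verma module `V(z)` of `𝔞`: its highest weight takes the value `z` on `H`. -/
abbrev aVerma (n : ℕ) (z : ℂ) : Type :=
  VermaModule (aAlg n) (fun _ : Unit => aRaise n) (fun _ => aCoroot n) (fun _ => z)

/-- The simple highest weight `𝔞`-module `L(z)`. -/
abbrev aSimple (n : ℕ) (z : ℂ) : Type :=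
  SimpleHighestWeightModule (aAlg n) (fun _ : Unit => aRaise n) (fun _ => aCoroot n) (fun _ => z)

/-- The weight `(p, 0, …, 0, q)` of `𝔰𝔩ₙ`, for `n > 2`. -/
def bWeight (n : ℕ) (p q : ℂ) (i : Fin (n - 1)) : ℂ :=
  if (i : ℕ) = 0 then p else if (i : ℕ) = n - 2 then q else 0

/-- The tuple `(-1, …, -1, u, v, 0, …, 0)` in which `u` stands at place `n` and `v` at place
`n + 1`. -/
def tuple (n : ℕ) (u v : ℂ) : Fin n ⊕ Fin n → ℂ :=
  Sum.elim (fun i => if (i : ℕ) + 1 = n then u else -1) (fun i => if (i : ℕ) = 0 then v else 0)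

/-- The module `N_{a₁,a₂} = N(-1, …, -1, a₁, a₂, 0, …, 0)`. -/
abbrev modN (n : ℕ) (a₁ a₂ : ℂ) : LieSubmodule ℂ (sl2n n) (MonomialSpace (Fin n ⊕ Fin n)) :=
  moduleN (tuple n a₁ a₂)

theorem not_isNegInt_of_ne {z : ℂ} (hz : ∀ k : ℤ, z ≠ k) (m : ℤ) : ¬ IsNegInt (z + m) := by
  rintro ⟨k, -, hk⟩
  refine hz (k - m) ?_
  push_cast
  rw [← hk]
  ring

theorem tuple_mem (n : ℕ) (hn : 0 < n) (a₁ a₂ : ℂ) (h₁ : ∀ k : ℤ, a₁ ≠ k) (h₂ : ∀ k : ℤ, a₂ ≠ k)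
    (b : ℤ) : tuple n (a₁ + b) (a₂ - b) ∈ admissible (tuple n a₁ a₂) := by
  have e₁ := not_isNegInt_of_ne h₁ b
  have e₁' := not_isNegInt_of_ne h₁ 0
  have e₂ := not_isNegInt_of_ne h₂ (-b)
  have e₂' := not_isNegInt_of_ne h₂ 0
  simp only [Int.cast_zero, add_zero] at e₁' e₂'
  rw [Int.cast_neg, ← sub_eq_add_neg] at e₂
  refine ⟨?_, ?_, ?_⟩
  · rintro (i | i)
    · by_cases h : (i : ℕ) + 1 = n
      · exact ⟨b, by simp [tuple, h]⟩
      · exact ⟨0, by simp [tuple, h]⟩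
    · by_cases h : (i : ℕ) = 0
      · exact ⟨-b, by simp [tuple, h]⟩
      · exact ⟨0, by simp [tuple, h]⟩
  · rintro (i | i)
    · by_cases h : (i : ℕ) + 1 = n
      · simp [tuple, h, e₁, e₁']
      · simp [tuple, h]
    · by_cases h : (i : ℕ) = 0
      · simp [tuple, h, e₂, e₂']
      · simp [tuple, h]
  · obtain ⟨m, rfl⟩ : ∃ m, n = m + 1 := ⟨n - 1, by omega⟩
    have s₁ : ∀ u : ℂ, ∑ i : Fin (m + 1), (if (i : ℕ) + 1 = m + 1 then u else -1) =
        -(m : ℂ) + u := by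
      intro u
      rw [Fin.sum_univ_castSucc]
      have : ∀ i : Fin m, ¬ ((i : ℕ) = m) := fun i => by omega
      simp [this]
    have s₂ : ∀ v : ℂ, ∑ i : Fin (m + 1), (if (i : ℕ) = 0 then v else 0) = v := by
      intro v
      rw [Fin.sum_univ_succ]
      simp
    simp only [tuple, Fintype.sum_sum_type, Sum.elim_inl, Sum.elim_inr, s₁, s₂]
    ring

/-- The vector `x(b,0) = x(-1, …, -1, a₁ + b, a₂ - b, 0, …, 0)` of `N_{a₁,a₂}`. -/
def xVec (n : ℕ) (hn : 0 < n) (a₁ a₂ : ℂ) (h₁ : ∀ k : ℤ, a₁ ≠ k) (h₂ : ∀ k : ℤ, a₂ ≠ k)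
    (b : ℤ) : modN n a₁ a₂ :=
  ⟨mono (tuple n (a₁ + b) (a₂ - b)),
    Submodule.subset_span ⟨_, tuple_mem n hn a₁ a₂ h₁ h₂ b, rfl⟩⟩

/-- `U(𝔟) v`, the `𝔟`-submodule of `N_{a₁,a₂}` generated by `v`. -/
abbrev bGen (n : ℕ) {a₁ a₂ : ℂ} (v : modN n a₁ a₂) : LieSubmodule ℂ (bAlg n) (modN n a₁ a₂) :=
  LieSubmodule.lieSpan ℂ (bAlg n) {v}

/-- `U(𝔞) v`, the `𝔞`-submodule of `N_{a₁,a₂}` generated by `v`. -/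
abbrev aGen (n : ℕ) {a₁ a₂ : ℂ} (v : modN n a₁ a₂) : LieSubmodule ℂ (aAlg n) (modN n a₁ a₂) :=
  LieSubmodule.lieSpan ℂ (aAlg n) {v}

/-- The correspondence `P ↔ Q` in `N_{a₁,a₂}` between a `𝔟`-module `P` and an `𝔞`-module `Q`:
there is an embedding of the outer tensor product `P ⊗ Q` into `N_{a₁,a₂}`, equivariant for `𝔟`
and for `𝔞`, and every `𝔟`-homomorphism `P → N_{a₁,a₂}` is obtained from it by fixing a vector
of `Q`. So `Q` is the multiplicity space `Hom_𝔟(P, N_{a₁,a₂})` of `P`, with its action of `𝔞`. -/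
def Corresponds (n : ℕ) (a₁ a₂ : ℂ)
    (P : Type*) [AddCommGroup P] [Module ℂ P] [LieRingModule (bAlg n) P] [LieModule ℂ (bAlg n) P]
    (Q : Type*) [AddCommGroup Q] [Module ℂ Q] [LieRingModule (aAlg n) Q]
    [LieModule ℂ (aAlg n) Q] : Prop :=
  ∃ Φ : P →ₗ[ℂ] Q →ₗ[ℂ] modN n a₁ a₂,
    (∀ (u : bAlg n) (p : P) (q : Q), Φ ⁅u, p⁆ q = ⁅u, Φ p q⁆) ∧
    (∀ (u : aAlg n) (p : P) (q : Q), Φ p ⁅u, q⁆ = ⁅u, Φ p q⁆) ∧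
    Function.Injective (TensorProduct.lift Φ) ∧
    ∀ f : P →ₗ⁅ℂ, bAlg n⁆ modN n a₁ a₂, ∃ q : Q, ∀ p : P, f p = Φ p q

end DualPair

end

end HoweDual

/-!
Write a basis vector `x(c)` as a monomial: an entry `-1 - m` at one of the first `n - 1` places is
an exponent `m`, as is an entry `m` at one of the last `n - 1` places, and the entries at places
`n` and `n + 1` are non-integral exponents. The *first variable* is the one belonging to the first
place. Let `k(b) = a₁ - a₂ + 2 b - (n - 1)` be the weight of `x(b, 0)` for `H`, let
`N = N_{a₁,a₂}` and let `M ⊆ N` be the span of the monomials without the first variable.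

The proof rests on the filtration of `N` by the degree in the first variable. Since `a₂` is not an
integer, the term `q_{n+1} p_1` of `X` raises this degree by exactly one without loss
(`mem_degLT_of_opX`). So `X` is injective and `N = M ⊕ X N` (`supportedOn_degLT_le`,
`eq_zero_of_actX_mem`). On the other hand, the term `q_1 p_{n+1}` of `Y` shows that a vector
killed by `Y` is determined by its component in `M` (`eq_zero_of_opY`).

The raising operators of `𝔟` preserve `M`, and those in the first row or the last column reduce
the degree in the remaining variables (`exists_raising`), so the only vectors of `M` which
they kill are the combinations of the `x(b, 0)`
(`mem_tuples_of_raising`), and every nonzero subspace of `M` stable under them contains such a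
combination (`exists_mem_tuples`). The lowering operators applied to `x(b, 0)` produce, up to
terms with the first variable, all the monomials of `M` of the same weight for `H`
(`mono_mem_of_lowering`). Hence `U(𝔟) x(b, 0)` is the space `K b` of all vectors of weight `k(b)`
killed by `Y` (`bGen_eq`).

A submodule of `K b` that is not contained in `X N` contains `x(b, 0)` modulo `X N`
(`exists_xVec_add_actX`), so the structure of `K b` is governed by `K b ∩ X N`. That is a
computation in representations of `𝔰𝔩₂` on which `X` is injective (`exists_eq_pow_X`): the
intersection is zero unless `k(b) = -(m + 2)` for a natural number `m`, and then it is
`X ^ (m + 1) K (b + m + 1)`, which is simple by the first case. This gives simplicity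
(`isIrreducible_bGen`) and length two (`hasLengthTwo_bGen`). A highest weight module is
indecomposable, because the sum of its proper submodules does not contain the highest weight vector
(`notMem_sSup_proper`); the same fact identifies a simple highest weight module with the simple
quotient of the Verma module
(`nonempty_equiv_simpleHighestWeightModule`).

As `X` is injective, `U(𝔞) x(b, 0)` has the basis `X ^ i x(b, 0)` and is the Verma module of
highest weight `k(b)` (`nonempty_equiv_aVerma`), which is simple unless `k(b)` is a natural number
(`isIrreducible_of_lieSpan`). A vector of `N` that is killed by the raising operators and has the
weight of `x(b, 0)` for `𝔟` lies in `U(𝔞) x(b, 0)`: split off its component in `M`, divide by `X`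
and iterate (`mem_aGen_of_raising`). Therefore `p ⊗ X ^ i x(b, 0) ↦ X ^ i p` realizes
`U(𝔟) x(b, 0) ↔ U(𝔞) x(b, 0)` for every `b` (`corresponds_bGen_aGen`); it is injective since the
subspaces `X ^ i K b` lie in different eigenspaces of `H`.
-/

namespace HoweDual

/-! ### Verma modules and their simple quotients -/

section VermaTheory

variable {𝔤 : Type*} [LieRing 𝔤] [LieAlgebra ℂ 𝔤]

theorem adjoin_range_ι :
    Algebra.adjoin ℂ (Set.range (UniversalEnvelopingAlgebra.ι ℂ (L := 𝔤))) = ⊤ := by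
  set A := Algebra.adjoin ℂ (Set.range (UniversalEnvelopingAlgebra.ι ℂ (L := 𝔤))) with hA
  let g : 𝔤 →ₗ⁅ℂ⁆ A :=
    { toFun x := ⟨UniversalEnvelopingAlgebra.ι ℂ x, Algebra.subset_adjoin ⟨x, rfl⟩⟩
      map_add' x y := by ext1; simp
      map_smul' t x := by ext1; simp
      map_lie' {x y} := by
        ext1
        simp [LieRing.of_associative_ring_bracket] }
  have h : (A.val).comp (UniversalEnvelopingAlgebra.lift ℂ g) = AlgHom.id ℂ _ := by
    ext x
    simp [g]
  refine eq_top_iff.2 fun u _ => ?_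
  rw [show u = A.val (UniversalEnvelopingAlgebra.lift ℂ g u) from (DFunLike.congr_fun h u).symm]
  exact Subtype.property _

variable {I : Type*} (e h : I → 𝔤) (μ : I → ℂ)

/-- The canonical highest weight vector of the Verma module. -/
noncomputable def vermaVec : VermaModule 𝔤 e h μ :=
  Submodule.Quotient.mk (p := vermaIdeal 𝔤 e h μ) 1

variable {e h μ}

theorem lie_vermaVec (x : 𝔤) : ⁅x, vermaVec e h μ⁆ =
    (Submodule.Quotient.mk (p := vermaIdeal 𝔤 e h μ) (UniversalEnvelopingAlgebra.ι ℂ x) :) := by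
  change UniversalEnvelopingAlgebra.ι ℂ x • Submodule.Quotient.mk (p := vermaIdeal 𝔤 e h μ) 1 = _
  rw [← Submodule.Quotient.mk_smul, smul_eq_mul, mul_one]

theorem raise_vermaVec (i : I) : ⁅e i, vermaVec e h μ⁆ = 0 := by
  rw [lie_vermaVec]
  exact (Submodule.Quotient.mk_eq_zero _).2 (Ideal.subset_span (Or.inl ⟨i, rfl⟩))

theorem coroot_vermaVec (i : I) : ⁅h i, vermaVec e h μ⁆ = μ i • vermaVec e h μ := by
  rw [lie_vermaVec]
  refine ((Submodule.Quotient.eq (vermaIdeal 𝔤 e h μ)).2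
    (Ideal.subset_span (Or.inr ⟨i, rfl⟩))).trans ?_
  change _ = μ i • (Submodule.Quotient.mk (p := vermaIdeal 𝔤 e h μ) 1)
  rw [← Submodule.Quotient.mk_smul, Algebra.algebraMap_eq_smul_one]

theorem lieSpan_vermaVec :
    LieSubmodule.lieSpan ℂ 𝔤 {vermaVec e h μ} = ⊤ := by
  set S := LieSubmodule.lieSpan ℂ 𝔤 {vermaVec e h μ}
  have key : ∀ u : UniversalEnvelopingAlgebra ℂ 𝔤, ∀ w ∈ S, u • w ∈ S := by
    intro u
    have hu : u ∈ Algebra.adjoin ℂ (Set.range (UniversalEnvelopingAlgebra.ι ℂ (L := 𝔤))) := by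
      rw [adjoin_range_ι]; trivial
    induction hu using Algebra.adjoin_induction with
    | mem x hx =>
      obtain ⟨y, rfl⟩ := hx
      exact fun w hw => S.lie_mem (x := y) hw
    | algebraMap r =>
      intro w hw
      rw [algebraMap_smul]
      exact S.smul_mem r hw
    | add x y _ _ hx hy =>
      intro w hw
      rw [add_smul]
      exact add_mem (hx w hw) (hy w hw)
    | mul x y _ _ hx hy =>
      intro w hw
      rw [mul_smul]
      exact hx _ (hy w hw)
  refine eq_top_iff.2 fun w _ => ?_
  obtain ⟨u, rfl⟩ := Submodule.Quotient.mk_surjective (vermaIdeal 𝔤 e h μ) w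
  have := key u _ (LieSubmodule.subset_lieSpan (Set.mem_singleton _))
  change u • Submodule.Quotient.mk (p := vermaIdeal 𝔤 e h μ) 1 ∈ S at this
  rwa [← Submodule.Quotient.mk_smul, smul_eq_mul, mul_one] at this

variable {M : Type*} [AddCommGroup M] [Module ℂ M] [LieRingModule 𝔤 M] [LieModule ℂ 𝔤 M]

/-- The universal property of Verma modules: a vector of weight `μ` killed by the raising elements
is the image of the canonical vector. -/
theorem exists_vermaLift {m : M} (he : ∀ i, ⁅e i, m⁆ = 0) (hh : ∀ i, ⁅h i, m⁆ = μ i • m) :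
    ∃ f : VermaModule 𝔤 e h μ →ₗ⁅ℂ, 𝔤⁆ M, f (vermaVec e h μ) = m := by
  let ρ := UniversalEnvelopingAlgebra.lift ℂ (LieModule.toEnd ℂ 𝔤 M)
  let f₀ : UniversalEnvelopingAlgebra ℂ 𝔤 →ₗ[ℂ] M := (LinearMap.applyₗ m) ∘ₗ ρ.toLinearMap
  have hf₀ : (vermaIdeal 𝔤 e h μ).restrictScalars ℂ ≤ LinearMap.ker f₀ := by
    intro u hu
    have hu' : u ∈ vermaIdeal 𝔤 e h μ := hu
    change ρ u m = 0
    unfold vermaIdeal Ideal.span at hu'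
    clear hu
    induction hu' using Submodule.span_induction with
    | mem x hx =>
      rcases hx with ⟨i, rfl⟩ | ⟨i, rfl⟩
      · simp [ρ, he]
      · simp [ρ, hh]
    | zero => simp
    | add x y _ _ hx hy => rw [map_add, LinearMap.add_apply, hx, hy, add_zero]
    | smul a x _ hx => rw [smul_eq_mul, map_mul, Module.End.mul_apply, hx, map_zero]
  let f₁ : VermaModule 𝔤 e h μ →ₗ[ℂ] M :=
    (((vermaIdeal 𝔤 e h μ).restrictScalars ℂ).liftQ f₀ hf₀) ∘ₗ
      (Submodule.Quotient.restrictScalarsEquiv ℂ (vermaIdeal 𝔤 e h μ)).symm.toLinearMap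
  have hf₁ : ∀ u, f₁ (Submodule.Quotient.mk (p := vermaIdeal 𝔤 e h μ) u) = ρ u m := fun u => rfl
  refine ⟨{ f₁ with map_lie' := ?_ }, ?_⟩
  · intro x w
    obtain ⟨u, rfl⟩ := Submodule.Quotient.mk_surjective (vermaIdeal 𝔤 e h μ) w
    change f₁ (Submodule.Quotient.mk (p := vermaIdeal 𝔤 e h μ)
      (UniversalEnvelopingAlgebra.ι ℂ x * u)) = ⁅x, f₁ (Submodule.Quotient.mk _)⁆
    rw [hf₁, hf₁, map_mul]
    simp [ρ]
  · change f₁ (Submodule.Quotient.mk (p := vermaIdeal 𝔤 e h μ) 1) = m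
    rw [hf₁]
    simp

omit [LieModule ℂ 𝔤 M] in
theorem range_eq_top_of_lieSpan {V : Type*} [AddCommGroup V] [Module ℂ V] [LieRingModule 𝔤 V]
    [LieModule ℂ 𝔤 V] (f : V →ₗ⁅ℂ, 𝔤⁆ M) {m : M}
    (hm : LieSubmodule.lieSpan ℂ 𝔤 {m} = ⊤) (hf : ∃ v, f v = m) : Function.Surjective f := by
  rw [← LieModuleHom.range_eq_top, eq_top_iff, ← hm, LieSubmodule.lieSpan_le]
  rintro _ rfl
  exact hf

/-- A bijective homomorphism of Lie modules is an isomorphism. -/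
noncomputable def LieModuleEquiv.ofBijective' {V : Type*} [AddCommGroup V] [Module ℂ V]
    [LieRingModule 𝔤 V] [LieModule ℂ 𝔤 V] (f : V →ₗ⁅ℂ, 𝔤⁆ M) (hf : Function.Bijective f) :
    V ≃ₗ⁅ℂ, 𝔤⁆ M :=
  { f, LinearEquiv.ofBijective (f : V →ₗ[ℂ] M) hf with }

/-- `IsWord F v r w`: the vector `w` is `⁅x₁, ⁅x₂, …, ⁅xₖ, v⁆⁆⁆` for elements `xᵢ` of degrees `sᵢ`,
which `F xᵢ sᵢ` records, and `r` is the sum of these degrees. -/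
inductive IsWord (F : 𝔤 → ℕ → Prop) (v : M) : ℕ → M → Prop
  | nil : IsWord F v 0 v
  | cons {x : 𝔤} {s r : ℕ} {w : M} : F x s → IsWord F v r w → IsWord F v (s + r) ⁅x, w⁆

/-- If `𝔤` is spanned by the elements to which `F` gives a degree and by a subalgebra that preserves
the line of `v`, then a module generated by `v` is spanned by the words applied to `v`. -/
theorem span_isWord_eq_top {F : 𝔤 → ℕ → Prop} {v : M}
    (hv : LieSubmodule.lieSpan ℂ 𝔤 {v} = ⊤) {B : LieSubalgebra ℂ 𝔤}
    (hB : ∀ x ∈ B, ∃ t : ℂ, ⁅x, v⁆ = t • v)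
    (hF : Submodule.span ℂ {x | ∃ s, F x s} ⊔ B.toSubmodule = ⊤) :
    Submodule.span ℂ {w | ∃ r, IsWord F v r w} = ⊤ := by
  set W := Submodule.span ℂ {w | ∃ r, IsWord F v r w} with hW
  have hword : ∀ r w, IsWord F v r w → w ∈ W := fun r w h => Submodule.subset_span ⟨r, h⟩
  have hlow : ∀ x s, F x s → ∀ w ∈ W, ⁅x, w⁆ ∈ W := by
    intro x s hx w hw
    induction hw using Submodule.span_induction with
    | mem w hw =>
      obtain ⟨r, hr⟩ := hw
      exact hword _ _ (hr.cons hx)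
    | zero => simp
    | add y z _ _ hy hz => rw [lie_add]; exact add_mem hy hz
    | smul t y _ hy => rw [lie_smul]; exact W.smul_mem t hy
  have hlow' : ∀ x ∈ Submodule.span ℂ {x | ∃ s, F x s}, ∀ w ∈ W, ⁅x, w⁆ ∈ W := by
    intro x hx w hw
    induction hx using Submodule.span_induction with
    | mem x hx => exact hlow x _ hx.choose_spec w hw
    | zero => simp
    | add y z _ _ hy hz => rw [add_lie]; exact add_mem hy hz
    | smul t y _ hy => rw [smul_lie]; exact W.smul_mem t hy
  have hall : ∀ r w, IsWord F v r w → ∀ x : 𝔤, ⁅x, w⁆ ∈ W := by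
    intro r w hw
    induction hw with
    | nil =>
      intro x
      have hx : x ∈ Submodule.span ℂ {x | ∃ s, F x s} ⊔ B.toSubmodule := hF ▸ Submodule.mem_top
      obtain ⟨y, hy, z, hz, rfl⟩ := Submodule.mem_sup.1 hx
      obtain ⟨t, ht⟩ := hB z hz
      rw [add_lie, ht]
      exact add_mem (hlow' y hy v (hword _ _ .nil)) (W.smul_mem t (hword _ _ .nil))
    | cons hf hw ih =>
      intro x
      rw [leibniz_lie]
      exact add_mem (ih _) (hlow _ _ hf _ (ih x))
  let S : LieSubmodule ℂ 𝔤 M :=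
    { W with
      lie_mem := by
        intro x w hw
        have hw' : w ∈ W := hw
        change ⁅x, w⁆ ∈ W
        clear hw
        induction hw' using Submodule.span_induction with
        | mem w hw => exact hall _ _ hw.choose_spec x
        | zero => simp
        | add y z _ _ hy hz => rw [lie_add]; exact add_mem hy hz
        | smul t y _ hy => rw [lie_smul]; exact W.smul_mem t hy }
  have : (⊤ : LieSubmodule ℂ 𝔤 M) ≤ S := by
    rw [← hv, LieSubmodule.lieSpan_le]
    rintro _ rfl
    exact hword _ _ .nil
  exact eq_top_iff.2 fun w _ => this (LieSubmodule.mem_top w)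

theorem IsWord.lie_grading {F : 𝔤 → ℕ → Prop} {v : M} {h₀ : 𝔤} {c : ℂ}
    (hc : ⁅h₀, v⁆ = c • v) (hF : ∀ x s, F x s → ⁅h₀, x⁆ = (-(s : ℂ)) • x) {r : ℕ} {w : M}
    (hw : IsWord F v r w) : ⁅h₀, w⁆ = (c - r) • w := by
  induction hw with
  | nil => simp [hc]
  | cons hx _ ih =>
    rw [leibniz_lie, hF _ _ hx, ih, smul_lie, lie_smul, ← add_smul]
    congr 1
    push_cast
    ring

omit [LieAlgebra ℂ 𝔤] [Module ℂ M] [LieModule ℂ 𝔤 M] in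
theorem IsWord.eq_of_zero {F : 𝔤 → ℕ → Prop} {v : M} (hF : ∀ x s, F x s → 0 < s) {r : ℕ} {w : M}
    (hw : IsWord F v r w) (hr : r = 0) : w = v := by
  cases hw with
  | nil => rfl
  | cons hx _ => have := hF _ _ hx; omega

/-- In a highest weight module, the vectors of a proper submodule have no component along the
highest weight vector `v`, which spans its own eigenspace for `h₀`; so the sum of all proper
submodules does not contain `v`. -/
theorem notMem_sSup_proper {F : 𝔤 → ℕ → Prop} {v : M} (hv0 : v ≠ 0)
    (hv : LieSubmodule.lieSpan ℂ 𝔤 {v} = ⊤) {B : LieSubalgebra ℂ 𝔤}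
    (hB : ∀ x ∈ B, ∃ t : ℂ, ⁅x, v⁆ = t • v)
    (hF : Submodule.span ℂ {x | ∃ s, F x s} ⊔ B.toSubmodule = ⊤)
    {h₀ : 𝔤} (hh₀ : h₀ ∈ B) (hF₀ : ∀ x s, F x s → 0 < s ∧ ⁅h₀, x⁆ = (-(s : ℂ)) • x) :
    v ∉ sSup {S : LieSubmodule ℂ 𝔤 M | S ≠ ⊤} := by
  obtain ⟨c, hc⟩ := hB h₀ hh₀
  set T := LieModule.toEnd ℂ 𝔤 M h₀ with hT
  have hspan := span_isWord_eq_top hv hB hF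
  have hE : ∀ r w, IsWord F v r w → w ∈ T.eigenspace (c - r) := fun r w hw =>
    Module.End.mem_eigenspace_iff.2 (hw.lie_grading hc fun x s hx => (hF₀ x s hx).2)
  have hind := Module.End.eigenspaces_iSupIndep T
  have hvc : v ∈ T.eigenspace c := by simpa using hE 0 v .nil
  -- the sum of the eigenspaces other than the one of `v`
  set Z : Submodule ℂ M := ⨆ j, ⨆ (_ : j ≠ c), T.eigenspace j with hZ
  have hvZ : v ∉ Z := fun hvZ =>
    hv0 ((Submodule.disjoint_def.1 (hind c)) v hvc hvZ)
  have hdec : ∀ u : M, ∃ t : ℂ, u - t • v ∈ Z := by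
    intro u
    have hu : u ∈ Submodule.span ℂ {w | ∃ r, IsWord F v r w} := hspan ▸ Submodule.mem_top
    induction hu using Submodule.span_induction with
    | mem w hw =>
      obtain ⟨r, hr⟩ := hw
      rcases Nat.eq_zero_or_pos r with h0 | h0
      · refine ⟨1, ?_⟩
        rw [hr.eq_of_zero (fun x s hx => (hF₀ x s hx).1) h0]
        simp
      · refine ⟨0, ?_⟩
        have hne : c - (r : ℂ) ≠ c := by
          intro h'
          have h0' : (r : ℂ) ≠ 0 := Nat.cast_ne_zero.2 h0.ne'
          exact h0' (by linear_combination -h')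
        rw [zero_smul, sub_zero]
        exact (le_iSup₂_of_le (c - (r : ℂ)) hne le_rfl : T.eigenspace (c - r) ≤ Z) (hE r w hr)
    | zero => exact ⟨0, by simp⟩
    | add y z _ _ hy hz =>
      obtain ⟨s, hs⟩ := hy
      obtain ⟨t, ht⟩ := hz
      exact ⟨s + t, by convert add_mem hs ht using 1; module⟩
    | smul a y _ hy =>
      obtain ⟨s, hs⟩ := hy
      exact ⟨a * s, by convert Z.smul_mem a hs using 1; module⟩
  -- a vector of `S` with a nonzero component along `v` is sent to a nonzero multiple of `v` by a
  -- polynomial in `T` that kills the other components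
  have hproper : ∀ S : LieSubmodule ℂ 𝔤 M, S ≠ ⊤ → S.toSubmodule ≤ Z := by
    intro S hS u hu
    obtain ⟨t, ht⟩ := hdec u
    rcases eq_or_ne t 0 with rfl | ht0
    · simpa using ht
    exfalso
    have hST : ∀ p : Polynomial ℂ, ∀ w ∈ S, Polynomial.aeval T p w ∈ S := by
      intro p w hw
      induction p using Polynomial.induction_on' with
      | add p q hp hq => rw [map_add, LinearMap.add_apply]; exact add_mem hp hq
      | monomial k a =>
        rw [Polynomial.aeval_monomial, Module.algebraMap_end_eq_smul_id]
        refine S.smul_mem a ?_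
        change (T ^ k) w ∈ S
        clear hu
        induction k generalizing w with
        | zero => simpa using hw
        | succ k ih => exact ih _ (S.lie_mem (x := h₀) hw)
    have hpoly : ∀ z ∈ Z, ∃ p : Polynomial ℂ, Polynomial.aeval T p z = 0 ∧ p.eval c ≠ 0 := by
      intro z hz
      rw [hZ] at hz
      induction hz using Submodule.iSup_induction' with
      | mem j z hz =>
        by_cases hj : j = c
        · simp [hj] at hz
          exact ⟨1, by simp [hz], by simp⟩
        · simp only [ne_eq, hj, not_false_eq_true, iSup_pos] at hz
          refine ⟨Polynomial.X - Polynomial.C j, ?_, ?_⟩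
          · have := Module.End.mem_eigenspace_iff.1 hz
            simp [this, Module.algebraMap_end_eq_smul_id]
          · simpa [sub_eq_zero] using Ne.symm hj
      | zero => exact ⟨1, by simp, by simp⟩
      | add y z _ _ hy hz =>
        obtain ⟨p, hp, hp'⟩ := hy
        obtain ⟨q, hq, hq'⟩ := hz
        refine ⟨p * q, ?_, ?_⟩
        · rw [map_add, map_mul, Module.End.mul_apply, Module.End.mul_apply, hq, map_zero,
            add_zero, ← Module.End.mul_apply, ← map_mul, mul_comm, map_mul, Module.End.mul_apply,
            hp, map_zero]
        · simp [hp', hq']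
    obtain ⟨p, hp, hpc⟩ := hpoly _ ht
    have hpv := Module.End.aeval_apply_of_hasEigenvector (f := T) (p := p) ⟨hvc, hv0⟩
    have hvS : v ∈ S := by
      have h1 := hST p u hu
      rw [map_sub, map_smul, hpv, sub_eq_zero] at hp
      rw [hp, smul_smul] at h1
      have h2 := S.smul_mem (t * p.eval c)⁻¹ h1
      rwa [smul_smul, inv_mul_cancel₀ (mul_ne_zero ht0 hpc), one_smul] at h2
    refine hS (eq_top_iff.2 ?_)
    rw [← hv, LieSubmodule.lieSpan_le]
    rintro _ rfl
    exact hvS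
  intro hmem
  refine hvZ ?_
  have : (sSup {S : LieSubmodule ℂ 𝔤 M | S ≠ ⊤}).toSubmodule ≤ Z := by
    rw [LieSubmodule.sSup_toSubmodule]
    refine sSup_le ?_
    rintro _ ⟨S, hS, rfl⟩
    exact hproper S hS
  exact this hmem

/-- The elements of `𝔤` for which `v` is an eigenvector. -/
def eigenSubalgebra (v : M) : LieSubalgebra ℂ 𝔤 where
  carrier := {x | ∃ t : ℂ, ⁅x, v⁆ = t • v}
  add_mem' := by
    rintro x y ⟨s, hs⟩ ⟨t, ht⟩
    exact ⟨s + t, by rw [add_lie, hs, ht, add_smul]⟩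
  zero_mem' := ⟨0, by simp⟩
  smul_mem' := by
    rintro a x ⟨s, hs⟩
    exact ⟨a * s, by rw [smul_lie, hs, smul_smul]⟩
  lie_mem' := by
    rintro x y ⟨s, hs⟩ ⟨t, ht⟩
    exact ⟨0, by rw [lie_lie, hs, ht, lie_smul, lie_smul, hs, ht, smul_smul, smul_smul, mul_comm,
      sub_self, zero_smul]⟩

/-- A Lie algebra with raising elements `e` and coroots `h` is graded by `h₀` if it is spanned by
the subalgebra which `e` and `h` generate and by lowering elements, on which `h₀` acts by negative
integers. -/
def IsGradedBy (e h : I → 𝔤) (h₀ : 𝔤) : Prop :=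
  h₀ ∈ LieSubalgebra.lieSpan ℂ 𝔤 (Set.range e ∪ Set.range h) ∧
  Submodule.span ℂ {x : 𝔤 | ∃ s : ℕ, 0 < s ∧ ⁅h₀, x⁆ = (-(s : ℂ)) • x} ⊔
    (LieSubalgebra.lieSpan ℂ 𝔤 (Set.range e ∪ Set.range h)).toSubmodule = ⊤

/-- In a highest weight module the sum of all proper submodules does not contain the highest weight
vector. -/
theorem notMem_sSup_of_isGradedBy {h₀ : 𝔤} (hg : IsGradedBy e h h₀) {m : M} (hm : m ≠ 0)
    (hspan : LieSubmodule.lieSpan ℂ 𝔤 {m} = ⊤)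
    (he : ∀ i, ⁅e i, m⁆ = 0) (hh : ∀ i, ⁅h i, m⁆ = μ i • m) :
    m ∉ sSup {S : LieSubmodule ℂ 𝔤 M | S ≠ ⊤} := by
  have hle : LieSubalgebra.lieSpan ℂ 𝔤 (Set.range e ∪ Set.range h) ≤ eigenSubalgebra m := by
    rw [LieSubalgebra.lieSpan_le]
    rintro _ (⟨i, rfl⟩ | ⟨i, rfl⟩)
    · exact ⟨0, by rw [he, zero_smul]⟩
    · exact ⟨μ i, hh i⟩
  exact notMem_sSup_proper (F := fun x s => 0 < s ∧ ⁅h₀, x⁆ = (-(s : ℂ)) • x) hm hspan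
    (fun x hx => hle hx) hg.2 hg.1 (fun x s hx => hx)

/-- Highest weight modules are indecomposable. -/
theorem isIndecomposable_of_isGradedBy {h₀ : 𝔤} (hg : IsGradedBy e h h₀) {m : M} (hm : m ≠ 0)
    (hspan : LieSubmodule.lieSpan ℂ 𝔤 {m} = ⊤)
    (he : ∀ i, ⁅e i, m⁆ = 0) (hh : ∀ i, ⁅h i, m⁆ = μ i • m) : IsIndecomposable 𝔤 M := by
  refine ⟨⟨m, 0, hm⟩, fun S T hST => ?_⟩
  by_cases hS : S = ⊤
  · right
    simpa [hS] using hST.inf_eq_bot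
  by_cases hT : T = ⊤
  · left
    simpa [hT] using hST.inf_eq_bot
  refine absurd ?_ (notMem_sSup_of_isGradedBy hg hm hspan he hh)
  have hle : S ⊔ T ≤ sSup {S : LieSubmodule ℂ 𝔤 M | S ≠ ⊤} := sup_le (le_sSup hS) (le_sSup hT)
  rw [hST.sup_eq_top] at hle
  exact hle (LieSubmodule.mem_top m)

/-- A simple module generated by a vector of weight `μ` killed by the raising elements is the
simple quotient of the Verma module. -/
theorem nonempty_equiv_simpleHighestWeightModule {h₀ : 𝔤} (hg : IsGradedBy e h h₀)
    (hM : LieModule.IsIrreducible ℂ 𝔤 M) {m : M} (hm : m ≠ 0)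
    (he : ∀ i, ⁅e i, m⁆ = 0) (hh : ∀ i, ⁅h i, m⁆ = μ i • m) :
    Nonempty (M ≃ₗ⁅ℂ, 𝔤⁆ SimpleHighestWeightModule 𝔤 e h μ) := by
  obtain ⟨f, hf⟩ := exists_vermaLift he hh
  set J := sSup {S : LieSubmodule ℂ 𝔤 (VermaModule 𝔤 e h μ) | S ≠ ⊤} with hJ
  have hv0 : vermaVec e h μ ≠ 0 := fun h0 => hm (by rw [← hf, h0, map_zero])
  have hvJ : vermaVec e h μ ∉ J :=
    notMem_sSup_of_isGradedBy hg hv0 lieSpan_vermaVec raise_vermaVec coroot_vermaVec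
  have hspan : LieSubmodule.lieSpan ℂ 𝔤 {m} = ⊤ := by
    refine (hM.eq_bot_or_eq_top _).resolve_left fun h0 => hm ?_
    have := LieSubmodule.subset_lieSpan (R := ℂ) (L := 𝔤) (Set.mem_singleton m)
    rw [h0] at this
    simpa using this
  have hsurj := range_eq_top_of_lieSpan f hspan ⟨_, hf⟩
  have hker : f.ker = J := by
    refine le_antisymm (le_sSup fun h0 => hm ?_) ?_
    · have : vermaVec e h μ ∈ f.ker := h0 ▸ LieSubmodule.mem_top _
      rw [← hf]
      exact this
    · -- the image of `J` is a submodule of `M` and not all of `M`, for otherwise `J` and the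
      -- kernel, hence `J` alone, would be everything
      have hkerJ : f.ker ≤ J := le_sSup fun h0 => hm (by
        have : vermaVec e h μ ∈ f.ker := h0 ▸ LieSubmodule.mem_top _
        rw [← hf]
        exact this)
      rcases hM.eq_bot_or_eq_top (J.map f) with h0 | h0
      · intro x hx
        have : f x ∈ J.map f := LieSubmodule.mem_map_of_mem hx
        rw [h0] at this
        simpa using this
      · exfalso
        have : m ∈ J.map f := h0 ▸ LieSubmodule.mem_top _
        obtain ⟨x, hx, hxm⟩ := LieSubmodule.mem_map _ |>.1 this
        have hd : vermaVec e h μ - x ∈ f.ker := by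
          rw [LieModuleHom.mem_ker, map_sub, hf, hxm, sub_self]
        exact hvJ (by simpa using add_mem (hkerJ hd) hx)
  let g : SimpleHighestWeightModule 𝔤 e h μ →ₗ⁅ℂ, 𝔤⁆ M :=
    { J.toSubmodule.liftQ (f : VermaModule 𝔤 e h μ →ₗ[ℂ] M)
        (fun x hx => by rw [← hker] at hx; exact hx) with
      map_lie' := by
        intro x w
        obtain ⟨w, rfl⟩ := LieSubmodule.Quotient.surjective_mk' J w
        exact f.map_lie x w }
  have hgm : ∀ w, g (LieSubmodule.Quotient.mk' J w) = f w := fun w => rfl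
  refine ⟨(LieModuleEquiv.ofBijective' g ⟨?_, ?_⟩).symm⟩
  · rw [injective_iff_map_eq_zero]
    intro w hw
    obtain ⟨w, rfl⟩ := LieSubmodule.Quotient.surjective_mk' J w
    rw [hgm] at hw
    rw [LieSubmodule.Quotient.mk_eq_zero, ← hker]
    exact hw
  · intro y
    obtain ⟨w, hw⟩ := hsurj y
    exact ⟨LieSubmodule.Quotient.mk' J w, hw⟩

end VermaTheory

/-! ### Coefficients of vectors and of the operators `q_i p_j` -/

section Coefficients

variable {ι : Type*}

/-- The coefficient of the basis vector `x(c)`. -/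
noncomputable def coeff (c : ι → ℂ) : MonomialSpace ι →ₗ[ℂ] ℂ := Finsupp.lapply c

/-- The span of the basis vectors whose exponents lie in `S`. -/
noncomputable def supportedOn (S : Set (ι → ℂ)) : Submodule ℂ (MonomialSpace ι) :=
  Submodule.span ℂ (mono '' S)

theorem mono_mem_supportedOn {S : Set (ι → ℂ)} {c : ι → ℂ} (hc : c ∈ S) :
    mono c ∈ supportedOn S :=
  Submodule.subset_span ⟨c, hc, rfl⟩

theorem mem_supportedOn {S : Set (ι → ℂ)} {f : MonomialSpace ι} :
    f ∈ supportedOn S ↔ ∀ c, coeff c f ≠ 0 → c ∈ S := by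
  have h : supportedOn S = Finsupp.supported ℂ ℂ S := (Finsupp.supported_eq_span_single ℂ S).symm
  rw [h]
  exact (Finsupp.mem_supported ℂ f).trans
    ⟨fun h c hc => h (Finset.mem_coe.2 (Finsupp.mem_support_iff.2 hc)),
      fun h c hc => h c (Finsupp.mem_support_iff.1 (Finset.mem_coe.1 hc))⟩

theorem ext_coeff {f g : MonomialSpace ι} (h : ∀ c, coeff c f = coeff c g) : f = g :=
  Finsupp.ext h

open Classical in
theorem coeff_mono (c b : ι → ℂ) : coeff c (mono b) = if b = c then 1 else 0 :=
  Finsupp.single_apply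

theorem mono_ne_zero (c : ι → ℂ) : mono c ≠ 0 := fun h => by
  have := coeff_mono c c
  simp [h] at this

theorem supportedOn_mono {S T : Set (ι → ℂ)} (h : S ⊆ T) : supportedOn S ≤ supportedOn T :=
  Submodule.span_mono (Set.image_mono h)

theorem exists_coeff_ne_zero {f : MonomialSpace ι} (hf : f ≠ 0) : ∃ c, coeff c f ≠ 0 := by
  by_contra! h
  exact hf (ext_coeff fun c => by rw [h c, map_zero])

theorem mem_supportedOn_univ (f : MonomialSpace ι) : f ∈ supportedOn Set.univ :=
  mem_supportedOn.2 fun _ _ => trivial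

/-- A linear map sends vectors supported on `S` to `Q` if it does so for the basis vectors. -/
theorem map_mem_of_mono {W : Type*} [AddCommGroup W] [Module ℂ W] {S : Set (ι → ℂ)}
    {op : MonomialSpace ι →ₗ[ℂ] W} {Q : Submodule ℂ W} (h : ∀ c ∈ S, op (mono c) ∈ Q)
    {f : MonomialSpace ι} (hf : f ∈ supportedOn S) : op f ∈ Q := by
  have : supportedOn S ≤ Q.comap op := by
    refine Submodule.span_le.2 ?_
    rintro _ ⟨c, hc, rfl⟩
    exact h c hc
  exact this hf

theorem eq_of_eq_on_mono {W : Type*} [AddCommGroup W] [Module ℂ W] {S : Set (ι → ℂ)}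
    {f g : MonomialSpace ι →ₗ[ℂ] W} (h : ∀ c ∈ S, f (mono c) = g (mono c))
    {v : MonomialSpace ι} (hv : v ∈ supportedOn S) : f v = g v := by
  have := map_mem_of_mono (op := f - g) (Q := ⊥) (S := S) (by simpa [sub_eq_zero] using h) hv
  simpa [sub_eq_zero] using this

/-- The projection that keeps the basis vectors with exponents in `S` and sends the others to
zero. -/
noncomputable def restrictTo (S : Set (ι → ℂ)) : MonomialSpace ι →ₗ[ℂ] MonomialSpace ι :=
  open Classical in Finsupp.linearCombination ℂ fun c : ι → ℂ => if c ∈ S then mono c else 0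

theorem restrictTo_mono_of_mem {S : Set (ι → ℂ)} {c : ι → ℂ} (hc : c ∈ S) :
    restrictTo S (mono c) = mono c := by
  classical
  refine (Finsupp.linearCombination_single ℂ (1 : ℂ) c).trans ?_
  rw [one_smul, if_pos hc]

theorem restrictTo_mono_of_notMem {S : Set (ι → ℂ)} {c : ι → ℂ} (hc : c ∉ S) :
    restrictTo S (mono c) = 0 := by
  classical
  refine (Finsupp.linearCombination_single ℂ (1 : ℂ) c).trans ?_
  rw [one_smul, if_neg hc]

theorem coeff_restrictTo {S : Set (ι → ℂ)} {c : ι → ℂ} (hc : c ∈ S) (f : MonomialSpace ι) :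
    coeff c (restrictTo S f) = coeff c f := by
  refine eq_of_eq_on_mono (f := coeff c ∘ₗ restrictTo S) (g := coeff c) (fun b _ => ?_)
    (mem_supportedOn_univ f)
  by_cases hb : b ∈ S
  · rw [LinearMap.comp_apply, restrictTo_mono_of_mem hb]
  · have hbc : b ≠ c := fun h => hb (h ▸ hc)
    rw [LinearMap.comp_apply, restrictTo_mono_of_notMem hb, coeff_mono, if_neg hbc, map_zero]

theorem restrictTo_mem {S T : Set (ι → ℂ)} {f : MonomialSpace ι} (hf : f ∈ supportedOn T) :
    restrictTo S f ∈ supportedOn (S ∩ T) := by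
  refine map_mem_of_mono (fun c hc => ?_) hf
  by_cases hS : c ∈ S
  · rw [restrictTo_mono_of_mem hS]
    exact mono_mem_supportedOn ⟨hS, hc⟩
  · rw [restrictTo_mono_of_notMem hS]
    exact zero_mem _

variable [DecidableEq ι]

theorem qp_mono (i j : ι) (c : ι → ℂ) : qOp i (pOp j (mono c)) =
    (pCoeff (c j) * qCoeff ((c - Pi.single j 1 : ι → ℂ) i)) •
      mono (c - Pi.single j 1 + Pi.single i 1) := by
  rw [pOp_mono, map_smul, qOp_mono, smul_smul]

theorem coeff_qp {i j : ι} (hij : i ≠ j) (c : ι → ℂ) (f : MonomialSpace ι) :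
    coeff (c - Pi.single j 1 + Pi.single i 1) (qOp i (pOp j f)) =
      pCoeff (c j) * qCoeff (c i) * coeff c f := by
  refine eq_of_eq_on_mono
    (f := coeff (c - Pi.single j 1 + Pi.single i 1) ∘ₗ qOp i ∘ₗ pOp j)
    (g := (pCoeff (c j) * qCoeff (c i)) • coeff c) (fun b _ => ?_) (mem_supportedOn_univ f)
  rw [LinearMap.comp_apply, LinearMap.comp_apply, qp_mono, map_smul, LinearMap.smul_apply,
    coeff_mono, coeff_mono]
  by_cases hb : b = c
  · subst hb
    simp [hij]
  · rw [if_neg hb, if_neg (by simpa using hb)]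
    simp

/-- `q_i p_j` preserves a condition on the exponents that is preserved by moving one unit from
place `j` to place `i` whenever the coefficient does not vanish. -/
theorem qp_mem {S T : Set (ι → ℂ)} {i j : ι}
    (h : ∀ c ∈ S, pCoeff (c j) ≠ 0 → qCoeff ((c - Pi.single j 1 : ι → ℂ) i) ≠ 0 →
      c - Pi.single j 1 + Pi.single i 1 ∈ T)
    {f : MonomialSpace ι} (hf : f ∈ supportedOn S) : qOp i (pOp j f) ∈ supportedOn T := by
  refine map_mem_of_mono (op := qOp i ∘ₗ pOp j) (fun c hc => ?_) hf
  rw [LinearMap.comp_apply, qp_mono]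
  by_cases h0 : pCoeff (c j) * qCoeff ((c - Pi.single j 1 : ι → ℂ) i) = 0
  · rw [h0, zero_smul]
    exact zero_mem _
  · exact Submodule.smul_mem _ _ (mono_mem_supportedOn
      (h c hc (left_ne_zero_of_mul h0) (right_ne_zero_of_mul h0)))

theorem admissible_move [Fintype ι] {a c : ι → ℂ} (hc : c ∈ admissible a) {i j : ι}
    (hj : pCoeff (c j) ≠ 0) (hi : qCoeff ((c - Pi.single j 1 : ι → ℂ) i) ≠ 0) :
    c - Pi.single j 1 + Pi.single i 1 ∈ admissible a := by
  have h := qOp_pOp_mem a c hc i j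
  rw [qp_mono] at h
  refine (mem_supportedOn (S := admissible a)).1 h _ ?_
  rw [map_smul, coeff_mono, if_pos rfl]
  exact smul_ne_zero (mul_ne_zero hj hi) one_ne_zero

theorem pCoeff_nat (m : ℕ) : pCoeff (m : ℂ) = m := by
  have : ¬ IsNegInt (m : ℂ) := by
    rintro ⟨k, hk, h⟩
    have : (m : ℤ) = k := by exact_mod_cast h
    omega
  simp [pCoeff, this]

theorem qCoeff_nat (m : ℕ) : qCoeff (m : ℂ) = 1 := by
  have : ¬ IsNegInt (m : ℂ) := by
    rintro ⟨k, hk, h⟩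
    have : (m : ℤ) = k := by exact_mod_cast h
    omega
  simp [qCoeff, this]

theorem isNegInt_neg (m : ℕ) : IsNegInt (-1 - (m : ℂ)) :=
  ⟨-1 - m, by omega, by push_cast; ring⟩

theorem pCoeff_neg (m : ℕ) : pCoeff (-1 - (m : ℂ)) = 1 := by
  simp [pCoeff, isNegInt_neg m]

theorem qCoeff_neg (m : ℕ) : qCoeff (-1 - (m : ℂ)) = -m := by
  simp only [qCoeff, isNegInt_neg m, if_true]
  ring

theorem pCoeff_of_ne {z : ℂ} (hz : ∀ k : ℤ, z ≠ k) : pCoeff z = z := by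
  have : ¬ IsNegInt z := fun ⟨k, _, h⟩ => hz k h
  simp [pCoeff, this]

theorem qCoeff_of_ne {z : ℂ} (hz : ∀ k : ℤ, z ≠ k) : qCoeff z = 1 := by
  have : ¬ IsNegInt z := fun ⟨k, _, h⟩ => hz k h
  simp [qCoeff, this]

end Coefficients

/-! ### Exponents in `N_{a₁,a₂}` -/

section Exponents

variable {n : ℕ} {o l : Fin n} {a₁ a₂ : ℂ} {c : Fin n ⊕ Fin n → ℂ}

theorem exists_eq_neg (hc : c ∈ admissible (tuple n a₁ a₂)) (hl : (l : ℕ) + 1 = n) {i : Fin n}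
    (hi : i ≠ l) : ∃ m : ℕ, c (.inl i) = -1 - m := by
  have hi' : (i : ℕ) + 1 ≠ n := fun h => hi (Fin.ext (by omega))
  obtain ⟨k, hk, h⟩ := (hc.2.1 (.inl i)).2 ⟨-1, by omega, by simp [tuple, hi']⟩
  refine ⟨(-1 - k).toNat, ?_⟩
  have h1 : (((-1 - k).toNat : ℤ) : ℂ) = ((-1 - k : ℤ) : ℂ) := by
    rw [Int.toNat_of_nonneg (by omega)]
  rw [Int.cast_natCast] at h1
  rw [h, h1]
  push_cast
  ring

theorem exists_eq_nat (hc : c ∈ admissible (tuple n a₁ a₂)) (ho : (o : ℕ) = 0) {j : Fin n}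
    (hj : j ≠ o) : ∃ m : ℕ, c (.inr j) = m := by
  have hj' : (j : ℕ) ≠ 0 := fun h => hj (Fin.ext (by omega))
  obtain ⟨k, hk⟩ := hc.1 (.inr j)
  have h0 : tuple n a₁ a₂ (.inr j) = 0 := by simp [tuple, hj']
  rw [h0, sub_zero] at hk
  have hneg : ¬ IsNegInt (c (.inr j)) := by
    rw [hc.2.1, h0]
    rintro ⟨k, hk, h⟩
    have : (0 : ℤ) = k := by exact_mod_cast h
    omega
  refine ⟨k.toNat, ?_⟩
  have hk0 : 0 ≤ k := by
    by_contra h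
    exact hneg ⟨k, by omega, hk⟩
  have h1 : ((k.toNat : ℤ) : ℂ) = (k : ℂ) := by rw [Int.toNat_of_nonneg hk0]
  rw [hk, ← h1, Int.cast_natCast]

theorem inl_last_ne (hc : c ∈ admissible (tuple n a₁ a₂)) (hl : (l : ℕ) + 1 = n)
    (h₁ : ∀ k : ℤ, a₁ ≠ k) (k : ℤ) : c (.inl l) ≠ k := by
  obtain ⟨k', hk'⟩ := hc.1 (.inl l)
  intro h
  refine h₁ (k - k') ?_
  have h0 : tuple n a₁ a₂ (.inl l) = a₁ := by simp [tuple, hl]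
  rw [h0] at hk'
  push_cast
  rw [← hk', ← h]
  ring

theorem inr_first_ne (hc : c ∈ admissible (tuple n a₁ a₂)) (ho : (o : ℕ) = 0)
    (h₂ : ∀ k : ℤ, a₂ ≠ k) (k : ℤ) : c (.inr o) ≠ k := by
  obtain ⟨k', hk'⟩ := hc.1 (.inr o)
  intro h
  refine h₂ (k - k') ?_
  have h0 : tuple n a₁ a₂ (.inr o) = a₂ := by simp [tuple, ho]
  rw [h0] at hk'
  push_cast
  rw [← hk', ← h]
  ring

theorem sum_inl_tuple (hl : (l : ℕ) + 1 = n) (u v : ℂ) :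
    ∑ i, tuple n u v (.inl i) = -((n : ℂ) - 1) + u := by
  have : ∀ i : Fin n, tuple n u v (.inl i) = -1 + if i = l then u + 1 else 0 := by
    intro i
    by_cases hi : i = l
    · subst hi; simp [tuple, hl]
    · have hi' : (i : ℕ) + 1 ≠ n := fun h => hi (Fin.ext (by omega))
      simp [tuple, hi, hi']
  rw [Finset.sum_congr rfl fun i _ => this i, Finset.sum_add_distrib]
  simp
  ring

theorem sum_inr_tuple (ho : (o : ℕ) = 0) (u v : ℂ) : ∑ i, tuple n u v (.inr i) = v := by
  have : ∀ i : Fin n, tuple n u v (.inr i) = if i = o then v else 0 := by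
    intro i
    by_cases hi : i = o
    · subst hi; simp [tuple, ho]
    · have hi' : (i : ℕ) ≠ 0 := fun h => hi (Fin.ext (by omega))
      simp [tuple, hi, hi']
  rw [Finset.sum_congr rfl fun i _ => this i]
  simp

/-- An admissible tuple with minimal entries off the two places of `a₁` and `a₂` is one of the
tuples `(-1, …, -1, a₁ + b, a₂ - b, 0, …, 0)`. -/
theorem exists_eq_tuple (hc : c ∈ admissible (tuple n a₁ a₂)) (ho : (o : ℕ) = 0)
    (hl : (l : ℕ) + 1 = n) (hy : ∀ i, i ≠ l → c (.inl i) = -1) (hz : ∀ j, j ≠ o → c (.inr j) = 0) :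
    ∃ b : ℤ, c = tuple n (a₁ + b) (a₂ - b) := by
  obtain ⟨k, hk⟩ := hc.1 (.inl l)
  have h0 : tuple n a₁ a₂ (.inl l) = a₁ := by simp [tuple, hl]
  rw [h0] at hk
  have hcl : c = tuple n (c (.inl l)) (c (.inr o)) := by
    funext i
    rcases i with i | i
    · by_cases hi : i = l
      · subst hi; simp [tuple, hl]
      · have hi' : (i : ℕ) + 1 ≠ n := fun h => hi (Fin.ext (by omega))
        simp [tuple, hi', hy i hi]
    · by_cases hi : i = o
      · subst hi; simp [tuple, ho]
      · have hi' : (i : ℕ) ≠ 0 := fun h => hi (Fin.ext (by omega))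
        simp [tuple, hi', hz i hi]
  have hs := hc.2.2
  rw [hcl, Fintype.sum_sum_type, Fintype.sum_sum_type, sum_inl_tuple hl, sum_inl_tuple hl,
    sum_inr_tuple ho, sum_inr_tuple ho] at hs
  refine ⟨k, ?_⟩
  rw [hcl, show c (.inl l) = a₁ + k by rw [← hk]; ring,
    show c (.inr o) = a₂ - k by rw [← hk]; linear_combination hs]

end Exponents

/-! ### The operators of the dual pair -/

section Operators

variable {n : ℕ}

/-- The operator by which `diag(E_{i,j}, E_{i,j})` acts. -/
noncomputable def opE (i j : Fin n) :
    MonomialSpace (Fin n ⊕ Fin n) →ₗ[ℂ] MonomialSpace (Fin n ⊕ Fin n) :=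
  qOp (.inl i) ∘ₗ pOp (.inl j) + qOp (.inr i) ∘ₗ pOp (.inr j)

variable (n) in
/-- The operator by which `X` acts. -/
noncomputable def opX : MonomialSpace (Fin n ⊕ Fin n) →ₗ[ℂ] MonomialSpace (Fin n ⊕ Fin n) :=
  ∑ i, qOp (.inr i) ∘ₗ pOp (.inl i)

variable (n) in
/-- The operator by which `Y` acts. -/
noncomputable def opY : MonomialSpace (Fin n ⊕ Fin n) →ₗ[ℂ] MonomialSpace (Fin n ⊕ Fin n) :=
  ∑ i, qOp (.inl i) ∘ₗ pOp (.inr i)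

theorem opE_apply (i j : Fin n) (f : MonomialSpace (Fin n ⊕ Fin n)) :
    opE i j f = qOp (.inl i) (pOp (.inl j) f) + qOp (.inr i) (pOp (.inr j) f) := rfl

theorem opX_apply (f : MonomialSpace (Fin n ⊕ Fin n)) :
    opX n f = ∑ i, qOp (.inr i) (pOp (.inl i) f) := by
  simp [opX]

theorem opY_apply (f : MonomialSpace (Fin n ⊕ Fin n)) :
    opY n f = ∑ i, qOp (.inl i) (pOp (.inr i) f) := by
  simp [opY]

end Operators

/-! ### The filtration by the degree in the first variable -/

section Filtration

variable {n : ℕ} {o l : Fin n} {a₁ a₂ : ℂ}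

/-- The admissible exponents with first entry among `-1, …, -r`, where `o` is the first index. As
`x(c)` with `c_o = -1 - m` is regarded as a monomial of degree `m` in the first variable, these are
the monomials of degree less than `r` in this variable. -/
def degLT (o : Fin n) (a₁ a₂ : ℂ) (r : ℕ) : Set (Fin n ⊕ Fin n → ℂ) :=
  {c | c ∈ admissible (tuple n a₁ a₂) ∧ ∃ m : ℕ, m < r ∧ c (.inl o) = -1 - m}

theorem degLT_mono {r s : ℕ} (h : r ≤ s) : degLT o a₁ a₂ r ⊆ degLT o a₁ a₂ s :=
  fun _ ⟨hc, m, hm, hm'⟩ => ⟨hc, m, hm.trans_le h, hm'⟩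

theorem mem_degLT_one {c : Fin n ⊕ Fin n → ℂ} : c ∈ degLT o a₁ a₂ 1 ↔
    c ∈ admissible (tuple n a₁ a₂) ∧ c (.inl o) = -1 := by
  constructor
  · rintro ⟨hc, m, hm, h⟩
    obtain rfl : m = 0 := by omega
    exact ⟨hc, by simpa using h⟩
  · rintro ⟨hc, h⟩
    exact ⟨hc, 0, one_pos, by simpa using h⟩

theorem supportedOn_degLT_zero {f : MonomialSpace (Fin n ⊕ Fin n)}
    (hf : f ∈ supportedOn (degLT o a₁ a₂ 0)) : f = 0 := by
  refine ext_coeff fun c => ?_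
  by_contra h
  rw [map_zero] at h
  obtain ⟨-, m, hm, -⟩ := mem_supportedOn.1 hf c h
  omega

theorem exists_mem_degLT (hl : (l : ℕ) + 1 = n) (hol : o ≠ l)
    {f : MonomialSpace (Fin n ⊕ Fin n)} (hf : f ∈ supportedOn (admissible (tuple n a₁ a₂))) :
    ∃ r, f ∈ supportedOn (degLT o a₁ a₂ r) := by
  unfold supportedOn at hf
  induction hf using Submodule.span_induction with
  | mem x hx =>
    obtain ⟨c, hc, rfl⟩ := hx
    obtain ⟨m, hm⟩ := exists_eq_neg hc hl hol
    exact ⟨m + 1, mono_mem_supportedOn ⟨hc, m, by omega, hm⟩⟩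
  | zero => exact ⟨0, zero_mem _⟩
  | add x y _ _ hx hy =>
    obtain ⟨r, hr⟩ := hx
    obtain ⟨s, hs⟩ := hy
    exact ⟨max r s, add_mem (supportedOn_mono (degLT_mono (le_max_left r s)) hr)
      (supportedOn_mono (degLT_mono (le_max_right r s)) hs)⟩
  | smul t x _ hx =>
    obtain ⟨r, hr⟩ := hx
    exact ⟨r, Submodule.smul_mem _ t hr⟩

theorem qp_mem_degLT {i j : Fin n ⊕ Fin n} (hi : i ≠ .inl o) (hj : j ≠ .inl o) {r : ℕ}
    {f : MonomialSpace (Fin n ⊕ Fin n)} (hf : f ∈ supportedOn (degLT o a₁ a₂ r)) :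
    qOp i (pOp j f) ∈ supportedOn (degLT o a₁ a₂ r) := by
  refine qp_mem (S := degLT o a₁ a₂ r) (T := degLT o a₁ a₂ r)
    (fun c hc h h' => ⟨admissible_move hc.1 h h', ?_⟩) hf
  obtain ⟨m, hm, hm'⟩ := hc.2
  exact ⟨m, hm, by simp [hi.symm, hj.symm, hm']⟩

/-- The leading term of `X` in the first variable is injective, so `X` raises the degree in this
variable by exactly one. -/
theorem mem_degLT_of_opX (ho : (o : ℕ) = 0) (hl : (l : ℕ) + 1 = n) (hol : o ≠ l)
    (h₂ : ∀ k : ℤ, a₂ ≠ k) {f : MonomialSpace (Fin n ⊕ Fin n)} {r : ℕ}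
    (hf : f ∈ supportedOn (admissible (tuple n a₁ a₂)))
    (hX : opX n f ∈ supportedOn (degLT o a₁ a₂ (r + 1))) : f ∈ supportedOn (degLT o a₁ a₂ r) := by
  have step : ∀ s, r ≤ s → f ∈ supportedOn (degLT o a₁ a₂ (s + 1)) →
      f ∈ supportedOn (degLT o a₁ a₂ s) := by
    intro s hrs hs
    refine mem_supportedOn.2 fun c hc => ?_
    obtain ⟨hcA, m, hm, hcm⟩ := mem_supportedOn.1 hs c hc
    refine ⟨hcA, m, ?_, hcm⟩
    by_contra hms
    obtain rfl : m = s := by omega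
    set c' : Fin n ⊕ Fin n → ℂ := c - Pi.single (.inl o) 1 + Pi.single (.inr o) 1 with hc'
    have hc'o : c' (.inl o) = -1 - ((m + 1 : ℕ) : ℂ) := by
      simp [hc', hcm]
      ring
    have h0 : coeff c' (opX n f) = coeff c f := by
      rw [opX_apply, map_sum, Finset.sum_eq_single o]
      · rw [hc', coeff_qp (by simp), hcm, pCoeff_neg,
          qCoeff_of_ne (inr_first_ne hcA ho h₂), one_mul, one_mul]
      · intro i _ hi
        by_contra hne
        obtain ⟨-, m', hm', h'⟩ := mem_supportedOn.1
          (qp_mem_degLT (i := .inr i) (j := .inl i) (by simp) (by simpa using hi) hs) c' hne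
        rw [hc'o, sub_right_inj, Nat.cast_inj] at h'
        omega
      · simp
    obtain ⟨-, m', hm', h'⟩ := mem_supportedOn.1 hX c' (h0 ▸ hc)
    rw [hc'o, sub_right_inj, Nat.cast_inj] at h'
    omega
  obtain ⟨s, hs⟩ := exists_mem_degLT hl hol hf
  have : ∀ t, f ∈ supportedOn (degLT o a₁ a₂ (r + t)) → f ∈ supportedOn (degLT o a₁ a₂ r) := by
    intro t
    induction t with
    | zero => exact id
    | succ t ih => exact fun h => ih (step _ (by omega) h)
  exact this s (supportedOn_mono (degLT_mono (by omega)) hs)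

/-- Modulo the image of `X`, every vector is equivalent to one that does not involve the first
variable. -/
theorem supportedOn_degLT_le (ho : (o : ℕ) = 0) (h₂ : ∀ k : ℤ, a₂ ≠ k) (r : ℕ) :
    supportedOn (degLT o a₁ a₂ (r + 1)) ≤
      supportedOn (degLT o a₁ a₂ 1) ⊔ (supportedOn (degLT o a₁ a₂ r)).map (opX n) := by
  induction r with
  | zero => exact le_sup_left
  | succ r ih =>
    have ih' : supportedOn (degLT o a₁ a₂ (r + 1)) ≤ supportedOn (degLT o a₁ a₂ 1) ⊔
        (supportedOn (degLT o a₁ a₂ (r + 1))).map (opX n) :=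
      ih.trans (sup_le_sup_left (Submodule.map_mono (supportedOn_mono (degLT_mono r.le_succ))) _)
    refine Submodule.span_le.2 ?_
    rintro _ ⟨c, ⟨hc, m, hm, hcm⟩, rfl⟩
    by_cases hmr : m < r + 1
    · exact ih' (mono_mem_supportedOn ⟨hc, m, hmr, hcm⟩)
    obtain rfl : m = r + 1 := by omega
    have hco := inr_first_ne hc ho h₂
    set c' : Fin n ⊕ Fin n → ℂ := c - Pi.single (.inr o) 1 + Pi.single (.inl o) 1 with hc'
    have hc'o : c' (.inl o) = -1 - (r : ℂ) := by
      simp [hc', hcm]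
      ring
    have hc'A : c' ∈ degLT o a₁ a₂ (r + 1) := by
      refine ⟨admissible_move hc ?_ ?_, r, by omega, hc'o⟩
      · rw [pCoeff_of_ne hco]
        simpa using hco 0
      · simp only [Pi.sub_apply, ne_eq, reduceCtorEq, not_false_eq_true, Pi.single_eq_of_ne,
          sub_zero]
        rw [hcm, qCoeff_neg]
        exact neg_ne_zero.2 (Nat.cast_ne_zero.2 r.succ_ne_zero)
    have hterm : qOp (.inr o) (pOp (.inl o) (mono c')) = mono c := by
      have h1 : c' - Pi.single (.inl o) 1 + Pi.single (.inr o) 1 = c := by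
        rw [hc']
        abel
      have h2 : (c' - Pi.single (.inl o) 1 : Fin n ⊕ Fin n → ℂ) (.inr o) = c (.inr o) - 1 := by
        simp [hc']
      rw [qp_mono, h1, h2, hc'o, pCoeff_neg, qCoeff_of_ne, one_mul, one_smul]
      intro k hk
      exact hco (k + 1) (by push_cast; rw [← hk]; ring)
    have hrest : mono c - opX n (mono c') ∈ supportedOn (degLT o a₁ a₂ (r + 1)) := by
      rw [opX_apply, ← Finset.add_sum_erase _ _ (Finset.mem_univ o), hterm, sub_add_cancel_left]
      refine neg_mem (sum_mem fun i hi => ?_)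
      exact qp_mem_degLT (by simp) (by simpa using Finset.ne_of_mem_erase hi)
        (mono_mem_supportedOn hc'A)
    have h3 : opX n (mono c') ∈ supportedOn (degLT o a₁ a₂ 1) ⊔
        (supportedOn (degLT o a₁ a₂ (r + 1))).map (opX n) :=
      Submodule.mem_sup_right (Submodule.mem_map_of_mem (mono_mem_supportedOn hc'A))
    have := add_mem (ih' hrest) h3
    rwa [sub_add_cancel] at this

/-- A vector killed by `Y` is determined by its part that does not involve the first variable. -/
theorem eq_zero_of_opY (ho : (o : ℕ) = 0) (hl : (l : ℕ) + 1 = n) (hol : o ≠ l)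
    (h₂ : ∀ k : ℤ, a₂ ≠ k) {f : MonomialSpace (Fin n ⊕ Fin n)}
    (hf : f ∈ supportedOn (admissible (tuple n a₁ a₂))) (hY : opY n f = 0)
    (h0 : ∀ c, c (.inl o) = -1 → coeff c f = 0) : f = 0 := by
  have key : ∀ m : ℕ, ∀ c, c (.inl o) = -1 - (m : ℂ) → coeff c f = 0 := by
    intro m
    induction m with
    | zero => exact fun c hc => h0 c (by simpa using hc)
    | succ m ih =>
      intro c hc
      by_contra hne
      have hcA := mem_supportedOn.1 hf c hne
      have hco := inr_first_ne hcA ho h₂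
      set c' : Fin n ⊕ Fin n → ℂ := c - Pi.single (.inr o) 1 + Pi.single (.inl o) 1 with hc'
      have hc'o : c' (.inl o) = -1 - (m : ℂ) := by
        simp [hc', hc]
        ring
      have hfS : f ∈ supportedOn {c | c (.inl o) ≠ -1 - (m : ℂ)} :=
        mem_supportedOn.2 fun c hc h => hc (ih c h)
      have h1 : coeff c' (opY n f) = pCoeff (c (.inr o)) * qCoeff (c (.inl o)) * coeff c f := by
        rw [opY_apply, map_sum, Finset.sum_eq_single o, hc', coeff_qp (by simp)]
        · intro i _ hi
          by_contra hne
          refine mem_supportedOn.1 (qp_mem (T := {c | c (.inl o) ≠ -1 - (m : ℂ)})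
            (fun b hb _ _ => ?_) hfS) c' hne hc'o
          simpa [hi.symm] using hb
        · simp
      rw [hY, map_zero, hc, qCoeff_neg, pCoeff_of_ne hco] at h1
      have h2 : c (.inr o) ≠ 0 := by simpa using hco 0
      have h3 : (-((m + 1 : ℕ) : ℂ)) ≠ 0 := neg_ne_zero.2 (Nat.cast_ne_zero.2 m.succ_ne_zero)
      exact mul_ne_zero (mul_ne_zero h2 h3) hne h1.symm
  refine ext_coeff fun c => ?_
  by_contra hne
  rw [map_zero] at hne
  obtain ⟨m, hm⟩ := exists_eq_neg (mem_supportedOn.1 hf c hne) hl hol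
  exact hne (key m c hm)

end Filtration

/-! ### Raising operators on the vectors that do not involve the first variable -/

section Raising

variable {n : ℕ} {o l : Fin n} {a₁ a₂ : ℂ}

/-- The degree of a monomial in the variables of the first block other than the last one: an entry
`-1 - m` counts as `m`. -/
noncomputable def degY (l : Fin n) (c : Fin n ⊕ Fin n → ℂ) : ℂ :=
  ∑ i, if i = l then 0 else -1 - c (.inl i)

/-- The degree of a monomial in the variables of the second block other than the first one. -/
noncomputable def degZ (o : Fin n) (c : Fin n ⊕ Fin n → ℂ) : ℂ :=
  ∑ j, if j = o then 0 else c (.inr j)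

theorem degY_add (c e : Fin n ⊕ Fin n → ℂ) :
    degY l (c + e) = degY l c - ∑ i, if i = l then 0 else e (.inl i) := by
  rw [degY, degY, ← Finset.sum_sub_distrib]
  refine Finset.sum_congr rfl fun i _ => ?_
  split_ifs
  · simp
  · simp only [Pi.add_apply]
    ring

theorem degZ_add (c e : Fin n ⊕ Fin n → ℂ) : degZ o (c + e) = degZ o c + degZ o e := by
  rw [degZ, degZ, degZ, ← Finset.sum_add_distrib]
  refine Finset.sum_congr rfl fun i _ => ?_
  split_ifs <;> simp

theorem degY_inr (c : Fin n ⊕ Fin n → ℂ) (i j : Fin n) :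
    degY l (c - Pi.single (.inr j) 1 + Pi.single (.inr i) 1) = degY l c := by
  refine Finset.sum_congr rfl fun k _ => ?_
  simp

theorem degZ_inl (c : Fin n ⊕ Fin n → ℂ) (i j : Fin n) :
    degZ o (c - Pi.single (.inl j) 1 + Pi.single (.inl i) 1) = degZ o c := by
  refine Finset.sum_congr rfl fun k _ => ?_
  simp

theorem degY_move (c : Fin n ⊕ Fin n → ℂ) {i : Fin n} (hi : i ≠ l) :
    degY l (c - Pi.single (.inl l) 1 + Pi.single (.inl i) 1) = degY l c - 1 := by
  rw [sub_add_eq_add_sub, add_sub_assoc, degY_add, Finset.sum_eq_single i]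
  · simp [hi]
  · intro k _ hk
    by_cases hkl : k = l <;> simp [hk, hkl]
  · simp

theorem degZ_move (c : Fin n ⊕ Fin n → ℂ) {j : Fin n} (hj : j ≠ o) :
    degZ o (c - Pi.single (.inr j) 1 + Pi.single (.inr o) 1) = degZ o c - 1 := by
  have h : degZ o (Pi.single (.inr o) 1 - Pi.single (.inr j) 1) = -1 := by
    rw [degZ, Finset.sum_eq_single j]
    · simp [hj]
    · intro k _ hk
      by_cases hkl : k = o <;> simp [hk, hkl]
    · simp
  rw [sub_add_eq_add_sub, add_sub_assoc, degZ_add, h, sub_eq_add_neg]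

theorem exists_degY {c : Fin n ⊕ Fin n → ℂ} (hc : c ∈ admissible (tuple n a₁ a₂))
    (hl : (l : ℕ) + 1 = n) : ∃ m : ℕ, degY l c = m := by
  have h : ∀ i, ∃ m : ℕ, (if i = l then 0 else -1 - c (.inl i)) = (m : ℂ) := by
    intro i
    split_ifs with hi
    · exact ⟨0, by simp⟩
    · obtain ⟨m, hm⟩ := exists_eq_neg hc hl hi
      exact ⟨m, by rw [hm]; ring⟩
  choose m hm using h
  exact ⟨∑ i, m i, by rw [degY, Finset.sum_congr rfl fun i _ => hm i, Nat.cast_sum]⟩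

theorem exists_degZ {c : Fin n ⊕ Fin n → ℂ} (hc : c ∈ admissible (tuple n a₁ a₂))
    (ho : (o : ℕ) = 0) : ∃ m : ℕ, degZ o c = m := by
  have h : ∀ i, ∃ m : ℕ, (if i = o then 0 else c (.inr i)) = (m : ℂ) := by
    intro i
    split_ifs with hi
    · exact ⟨0, by simp⟩
    · exact exists_eq_nat hc ho hi
  choose m hm using h
  exact ⟨∑ i, m i, by rw [degZ, Finset.sum_congr rfl fun i _ => hm i, Nat.cast_sum]⟩

/-- Exponents without the first variable, of total degree less than `r`. -/
def sizeLT (o l : Fin n) (a₁ a₂ : ℂ) (r : ℕ) : Set (Fin n ⊕ Fin n → ℂ) :=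
  {c | c ∈ degLT o a₁ a₂ 1 ∧ ∃ m : ℕ, m < r ∧ degY l c + degZ o c = m}

variable (n a₁ a₂) in
/-- The exponents of the vectors `x(b, 0)`. -/
def tuples : Set (Fin n ⊕ Fin n → ℂ) := {c | ∃ b : ℤ, c = tuple n (a₁ + b) (a₂ - b)}

theorem sizeLT_mono {r s : ℕ} (h : r ≤ s) : sizeLT o l a₁ a₂ r ⊆ sizeLT o l a₁ a₂ s :=
  fun _ ⟨hc, m, hm, hm'⟩ => ⟨hc, m, hm.trans_le h, hm'⟩

theorem exists_mem_sizeLT (ho : (o : ℕ) = 0) (hl : (l : ℕ) + 1 = n)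
    {f : MonomialSpace (Fin n ⊕ Fin n)} (hf : f ∈ supportedOn (degLT o a₁ a₂ 1)) :
    ∃ r, f ∈ supportedOn (sizeLT o l a₁ a₂ r) := by
  unfold supportedOn at hf
  induction hf using Submodule.span_induction with
  | mem x hx =>
    obtain ⟨c, hc, rfl⟩ := hx
    obtain ⟨m, hm⟩ := exists_degY hc.1 hl
    obtain ⟨m', hm'⟩ := exists_degZ hc.1 ho
    exact ⟨m + m' + 1,
      mono_mem_supportedOn ⟨hc, m + m', by omega, by rw [hm, hm']; push_cast; ring⟩⟩
  | zero => exact ⟨0, zero_mem _⟩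
  | add x y _ _ hx hy =>
    obtain ⟨r, hr⟩ := hx
    obtain ⟨s, hs⟩ := hy
    exact ⟨max r s, add_mem (supportedOn_mono (sizeLT_mono (le_max_left r s)) hr)
      (supportedOn_mono (sizeLT_mono (le_max_right r s)) hs)⟩
  | smul t x _ hx =>
    obtain ⟨r, hr⟩ := hx
    exact ⟨r, Submodule.smul_mem _ t hr⟩

theorem pOp_eq_zero {i : Fin n ⊕ Fin n} {f : MonomialSpace (Fin n ⊕ Fin n)}
    (hf : f ∈ supportedOn {c | c i = 0}) : pOp i f = 0 := by
  refine (Submodule.mem_bot ℂ).1 (map_mem_of_mono (op := pOp i) (Q := ⊥) (fun c hc => ?_) hf)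
  have hc' : c i = ((0 : ℕ) : ℂ) := by simpa using hc
  rw [Submodule.mem_bot, pOp_mono, hc', pCoeff_nat, Nat.cast_zero, zero_smul]

theorem opE_first {j : Fin n} (hj : j ≠ o) {f : MonomialSpace (Fin n ⊕ Fin n)}
    (hf : f ∈ supportedOn (degLT o a₁ a₂ 1)) : opE o j f = qOp (.inr o) (pOp (.inr j) f) := by
  rw [opE_apply, add_eq_right]
  suffices h0 : ∀ c ∈ degLT o a₁ a₂ 1, (qOp (.inl o) ∘ₗ pOp (.inl j)) (mono c) ∈
      (⊥ : Submodule ℂ (MonomialSpace (Fin n ⊕ Fin n))) from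
    (Submodule.mem_bot ℂ).1 (map_mem_of_mono h0 hf)
  intro c hc
  have hc' := (mem_degLT_one.1 hc).2
  have h : (c - Pi.single (.inl j) 1 : Fin n ⊕ Fin n → ℂ) (.inl o) = -1 - ((0 : ℕ) : ℂ) := by
    simp [hj.symm, hc']
  rw [Submodule.mem_bot, LinearMap.comp_apply, qp_mono, h, qCoeff_neg]
  simp

theorem opE_mem_degLT_one (ho : (o : ℕ) = 0) {i j : Fin n} (hij : i < j)
    {f : MonomialSpace (Fin n ⊕ Fin n)} (hf : f ∈ supportedOn (degLT o a₁ a₂ 1)) :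
    opE i j f ∈ supportedOn (degLT o a₁ a₂ 1) := by
  have hj : j ≠ o := by rintro rfl; exact absurd (Fin.lt_def.1 hij) (by omega)
  by_cases hi : i = o
  · subst hi
    rw [opE_first hj hf]
    exact qp_mem_degLT (by simp) (by simp) hf
  · rw [opE_apply]
    exact add_mem (qp_mem_degLT (by simpa) (by simpa) hf) (qp_mem_degLT (by simp) (by simp) hf)

/-- A vector that does not involve the first variable and is not a combination of the `x(b, 0)` is
moved by a raising operator to a nonzero vector of smaller degree: by `E_{1,j}` if it involves the
`j`-th variable of the second block for some `j > 1`, and otherwise by `E_{i,n}` if it involves the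
`i`-th variable of the first block for some `i < n`. -/
theorem exists_raising (ho : (o : ℕ) = 0) (hl : (l : ℕ) + 1 = n) (hol : o ≠ l)
    (h₁ : ∀ k : ℤ, a₁ ≠ k) (h₂ : ∀ k : ℤ, a₂ ≠ k) {r : ℕ} {f : MonomialSpace (Fin n ⊕ Fin n)}
    (hf : f ∈ supportedOn (sizeLT o l a₁ a₂ (r + 1))) (hfG : f ∉ supportedOn (tuples n a₁ a₂)) :
    ∃ i j, i < j ∧ opE i j f ≠ 0 ∧ opE i j f ∈ supportedOn (sizeLT o l a₁ a₂ r) := by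
  have hM : f ∈ supportedOn (degLT o a₁ a₂ 1) := supportedOn_mono (fun _ h => h.1) hf
  -- a move that lowers the degree by one
  have hsize : ∀ c ∈ sizeLT o l a₁ a₂ (r + 1), ∀ c', c' ∈ degLT o a₁ a₂ 1 →
      degY l c' + degZ o c' = degY l c + degZ o c - 1 → c' ∈ sizeLT o l a₁ a₂ r := by
    rintro c ⟨hc, m, hm, hcm⟩ c' hc' h
    refine ⟨hc', ?_⟩
    obtain ⟨p, hp⟩ := exists_degY hc'.1 hl
    obtain ⟨q, hq⟩ := exists_degZ hc'.1 ho
    rw [hp, hq, hcm] at h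
    have h' : p + q + 1 = m := by
      have : ((p + q + 1 : ℕ) : ℂ) = m := by push_cast; rw [h]; ring
      exact_mod_cast this
    exact ⟨p + q, by omega, by rw [hp, hq]; push_cast; ring⟩
  -- on vectors without the first variable, `E_{1,j}` acts as `q_{n+1} p_{n+j}`
  by_cases hA : ∃ c j, coeff c f ≠ 0 ∧ j ≠ o ∧ c (.inr j) ≠ 0
  · obtain ⟨c, j, hc, hj, hcj⟩ := hA
    have hcA := (mem_supportedOn.1 hM c hc).1
    refine ⟨o, j, Fin.lt_def.2 ?_, ?_, ?_⟩
    · have : (j : ℕ) ≠ 0 := fun h => hj (Fin.ext (by omega))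
      omega
    · intro h
      have h' := coeff_qp (i := .inr o) (j := .inr j) (by simpa using hj.symm) c f
      rw [← opE_first hj hM, h, map_zero, qCoeff_of_ne (inr_first_ne hcA ho h₂)] at h'
      obtain ⟨m, hm⟩ := exists_eq_nat hcA ho hj
      rw [hm, pCoeff_nat, ← hm, mul_one] at h'
      exact mul_ne_zero hcj hc h'.symm
    · rw [opE_first hj hM]
      refine qp_mem (S := sizeLT o l a₁ a₂ (r + 1)) (fun b hb hp hq => ?_) hf
      refine hsize b hb _ (mem_degLT_one.2 ⟨admissible_move hb.1.1 hp hq, ?_⟩) ?_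
      · simpa using (mem_degLT_one.1 hb.1).2
      · rw [degY_inr, degZ_move b hj]
        ring
  push Not at hA
  -- if no `j`-th variable of the second block occurs for `j > 1`, then `E_{i,n}` acts as `q_i p_n`
  by_cases hB : ∃ c i, coeff c f ≠ 0 ∧ i ≠ l ∧ c (.inl i) ≠ -1
  · obtain ⟨c, i, hc, hi, hci⟩ := hB
    have hcM := mem_degLT_one.1 (mem_supportedOn.1 hM c hc)
    have hio : i ≠ o := by rintro rfl; exact hci hcM.2
    have hE : opE i l f = qOp (.inl i) (pOp (.inl l) f) := by
      rw [opE_apply, pOp_eq_zero (i := .inr l) (mem_supportedOn.2 fun b hb => hA b l hb hol.symm),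
        map_zero, add_zero]
    refine ⟨i, l, Fin.lt_def.2 ?_, ?_, ?_⟩
    · have : (i : ℕ) ≠ l := fun h => hi (Fin.ext h)
      omega
    · intro h
      have h' := coeff_qp (i := .inl i) (j := .inl l) (by simpa using hi) c f
      have hcl := inl_last_ne hcM.1 hl h₁
      obtain ⟨m, hm⟩ := exists_eq_neg hcM.1 hl hi
      rw [← hE, h, map_zero, pCoeff_of_ne hcl, hm, qCoeff_neg] at h'
      have hm0 : (m : ℂ) ≠ 0 := fun h => hci (by rw [hm, h, sub_zero])
      exact mul_ne_zero (mul_ne_zero (by simpa using hcl 0) (neg_ne_zero.2 hm0)) hc h'.symm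
    · rw [hE]
      refine qp_mem (S := sizeLT o l a₁ a₂ (r + 1)) (fun b hb hp hq => ?_) hf
      refine hsize b hb _ (mem_degLT_one.2 ⟨admissible_move hb.1.1 hp hq, ?_⟩) ?_
      · simpa [hol, hio.symm] using (mem_degLT_one.1 hb.1).2
      · rw [degZ_inl, degY_move b hi]
        ring
  push Not at hB
  exact absurd (mem_supportedOn.2 fun c hc => exists_eq_tuple (mem_supportedOn.1 hM c hc).1 ho hl
    (fun i hi => hB c i hc hi) (fun j hj => hA c j hc hj)) hfG

/-- A nonzero space of vectors not involving the first variable that is stable under the raising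
operators contains a nonzero combination of the `x(b, 0)`. -/
theorem exists_mem_tuples (ho : (o : ℕ) = 0) (hl : (l : ℕ) + 1 = n) (hol : o ≠ l)
    (h₁ : ∀ k : ℤ, a₁ ≠ k) (h₂ : ∀ k : ℤ, a₂ ≠ k)
    {T : Submodule ℂ (MonomialSpace (Fin n ⊕ Fin n))} (hT : T ≤ supportedOn (degLT o a₁ a₂ 1))
    (hE : ∀ i j, i < j → ∀ f ∈ T, opE i j f ∈ T) {f : MonomialSpace (Fin n ⊕ Fin n)}
    (hf : f ∈ T) (hf0 : f ≠ 0) : ∃ g ∈ T, g ≠ 0 ∧ g ∈ supportedOn (tuples n a₁ a₂) := by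
  obtain ⟨r, hr⟩ := exists_mem_sizeLT ho hl (hT hf)
  induction r generalizing f with
  | zero =>
    obtain ⟨c, hc⟩ := exists_coeff_ne_zero hf0
    obtain ⟨-, m, hm, -⟩ := mem_supportedOn.1 hr c hc
    omega
  | succ r ih =>
    by_cases hG : f ∈ supportedOn (tuples n a₁ a₂)
    · exact ⟨f, hf, hf0, hG⟩
    · obtain ⟨i, j, hij, h0, hs⟩ := exists_raising ho hl hol h₁ h₂ hr hG
      exact ih (hE i j hij f hf) h0 hs

theorem mem_tuples_of_raising (ho : (o : ℕ) = 0) (hl : (l : ℕ) + 1 = n) (hol : o ≠ l)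
    (h₁ : ∀ k : ℤ, a₁ ≠ k) (h₂ : ∀ k : ℤ, a₂ ≠ k) {f : MonomialSpace (Fin n ⊕ Fin n)}
    (hf : f ∈ supportedOn (degLT o a₁ a₂ 1)) (hE : ∀ i j, i < j → opE i j f = 0) :
    f ∈ supportedOn (tuples n a₁ a₂) := by
  by_contra hG
  obtain ⟨r, hr⟩ := exists_mem_sizeLT ho hl hf
  obtain ⟨i, j, hij, h0, -⟩ :=
    exists_raising ho hl hol h₁ h₂ (supportedOn_mono (sizeLT_mono r.le_succ) hr) hG
  exact h0 (hE i j hij)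

end Raising

/-! ### Lowering operators and generation -/

section Lowering

variable {n : ℕ} {o l : Fin n} {a₁ a₂ : ℂ}

/-- A space that contains `x(b, 0)` and is stable under the operators which the lowering elements
of the first column and of the last row induce on vectors not involving the first variable contains
all the monomials, not involving this variable, on which `H` acts as on `x(b, 0)`. -/
theorem mono_mem_of_lowering (ho : (o : ℕ) = 0) (hl : (l : ℕ) + 1 = n)
    (h₁ : ∀ k : ℤ, a₁ ≠ k) (h₂ : ∀ k : ℤ, a₂ ≠ k) (b : ℤ)
    {R : Submodule ℂ (MonomialSpace (Fin n ⊕ Fin n))}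
    (h0 : mono (tuple n (a₁ + b) (a₂ - b)) ∈ R)
    (hz : ∀ f ∈ R, ∀ j, j ≠ o → qOp (.inr j) (pOp (.inr o) f) ∈ R)
    (hy : ∀ f ∈ R, ∀ i, i ≠ o → i ≠ l →
      qOp (.inl l) (pOp (.inl i) f) + qOp (.inr l) (pOp (.inr i) f) ∈ R)
    {c : Fin n ⊕ Fin n → ℂ} (hc : c ∈ admissible (tuple n a₁ a₂)) (hco : c (.inl o) = -1)
    (hsum : ∑ i, c (.inl i) = -((n : ℂ) - 1) + (a₁ + b)) : mono c ∈ R := by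
  obtain ⟨p, hp⟩ := exists_degY hc hl
  induction p using Nat.strong_induction_on generalizing c with
  | _ p ihp =>
  obtain ⟨q, hq⟩ := exists_degZ hc ho
  induction q using Nat.strong_induction_on generalizing c with
  | _ q ihq =>
  have hcl := inl_last_ne hc hl h₁
  have hcr := inr_first_ne hc ho h₂
  by_cases hB : ∃ i, i ≠ l ∧ c (.inl i) ≠ -1
  -- lower the degree in the first block; of the two terms of the operator, the second one again has
  -- this smaller degree, so only the first one is new
  · obtain ⟨i, hi, hci⟩ := hB
    have hio : i ≠ o := by rintro rfl; exact hci hco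
    have hlo : l ≠ o := by
      rintro rfl
      exact hcl (-1) (by simpa using hco)
    obtain ⟨m, hm⟩ := exists_eq_neg hc hl hi
    obtain ⟨m, rfl⟩ : ∃ k, m = k + 1 := Nat.exists_eq_succ_of_ne_zero (by
      rintro rfl; exact hci (by simpa using hm))
    set c' : Fin n ⊕ Fin n → ℂ := c - Pi.single (.inl l) 1 + Pi.single (.inl i) 1 with hc'
    have hc'A : c' ∈ admissible (tuple n a₁ a₂) := by
      refine admissible_move hc ?_ ?_
      · rw [pCoeff_of_ne hcl]
        simpa using hcl 0
      · have : (c - Pi.single (.inl l) 1 : Fin n ⊕ Fin n → ℂ) (.inl i) =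
            -1 - ((m + 1 : ℕ) : ℂ) := by simp [hi, hm]
        rw [this, qCoeff_neg]
        exact neg_ne_zero.2 (Nat.cast_ne_zero.2 m.succ_ne_zero)
    have hdeg : ∀ c'', c'' ∈ admissible (tuple n a₁ a₂) → degY l c'' = degY l c - 1 →
        c'' (.inl o) = -1 → ∑ i, c'' (.inl i) = -((n : ℂ) - 1) + (a₁ + b) → mono c'' ∈ R := by
      intro c'' hA hd ho' hs
      obtain ⟨p', hp'⟩ := exists_degY hA hl
      have h' : p' + 1 = p := by
        have : ((p' + 1 : ℕ) : ℂ) = p := by push_cast; rw [← hp', hd, hp]; ring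
        exact_mod_cast this
      exact ihp p' (by omega) hA ho' hs hp'
    have hc'o : c' (.inl o) = -1 := by simp [hc', hco, hlo.symm, hio.symm]
    have hc's : ∑ i, c' (.inl i) = -((n : ℂ) - 1) + (a₁ + b) := by
      rw [← hsum]
      simp [hc', Finset.sum_add_distrib, Pi.single_apply]
    have hc'R := hdeg c' hc'A (degY_move c hi) hc'o hc's
    have h3 := hy _ hc'R i hio hi
    have h4 : qOp (.inl l) (pOp (.inl i) (mono c')) = mono c := by
      have e1 : c' - Pi.single (.inl i) 1 + Pi.single (.inl l) 1 = c := by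
        rw [hc']
        abel
      have e2 : c' (.inl i) = -1 - (m : ℂ) := by
        simp [hc', hm, hi]
        ring
      have e3 : (c' - Pi.single (.inl i) 1 : Fin n ⊕ Fin n → ℂ) (.inl l) = c (.inl l) - 1 := by
        simp [hc', hi.symm]
      rw [qp_mono, e1, e2, e3, pCoeff_neg, qCoeff_of_ne, one_mul, one_smul]
      intro k hk
      exact hcl (k + 1) (by push_cast; rw [← hk]; ring)
    have h5 : qOp (.inr l) (pOp (.inr i) (mono c')) ∈ R := by
      rw [qp_mono]
      by_cases h0 : pCoeff (c' (.inr i)) *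
          qCoeff ((c' - Pi.single (.inr i) 1 : Fin n ⊕ Fin n → ℂ) (.inr l)) = 0
      · rw [h0, zero_smul]
        exact zero_mem _
      · refine R.smul_mem _ (hdeg _ (admissible_move hc'A (left_ne_zero_of_mul h0)
          (right_ne_zero_of_mul h0)) ?_ ?_ ?_)
        · rw [degY_inr, degY_move c hi]
        · simpa using hc'o
        · simpa using hc's
    rw [h4] at h3
    simpa using sub_mem h3 h5
  push Not at hB
  by_cases hA : ∃ j, j ≠ o ∧ c (.inr j) ≠ 0
  · obtain ⟨j, hj, hcj⟩ := hA
    obtain ⟨m, hm⟩ := exists_eq_nat hc ho hj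
    obtain ⟨m, rfl⟩ : ∃ k, m = k + 1 := Nat.exists_eq_succ_of_ne_zero (by
      rintro rfl; exact hcj (by simpa using hm))
    set c' : Fin n ⊕ Fin n → ℂ := c - Pi.single (.inr j) 1 + Pi.single (.inr o) 1 with hc'
    have hc'A : c' ∈ admissible (tuple n a₁ a₂) := by
      refine admissible_move hc ?_ ?_
      · rw [hm, pCoeff_nat]
        exact Nat.cast_ne_zero.2 m.succ_ne_zero
      · have : (c - Pi.single (.inr j) 1 : Fin n ⊕ Fin n → ℂ) (.inr o) = c (.inr o) := by
          simp [hj.symm]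
        rw [this, qCoeff_of_ne hcr]
        exact one_ne_zero
    have hc'R : mono c' ∈ R := by
      obtain ⟨q', hq'⟩ := exists_degZ hc'A ho
      have h' : q' + 1 = q := by
        have : ((q' + 1 : ℕ) : ℂ) = q := by
          push_cast; rw [← hq', hc', degZ_move c hj, hq]; ring
        exact_mod_cast this
      refine ihq q' (by omega) hc'A ?_ ?_ ?_ hq'
      · simpa [hc'] using hco
      · simpa [hc'] using hsum
      · rw [hc', degY_inr, hp]
    have h3 := hz _ hc'R j hj
    have e1 : c' - Pi.single (.inr o) 1 + Pi.single (.inr j) 1 = c := by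
      rw [hc']
      abel
    have e2 : c' (.inr o) = c (.inr o) + 1 := by
      simp [hc', hj.symm]
    have e3 : (c' - Pi.single (.inr o) 1 : Fin n ⊕ Fin n → ℂ) (.inr j) = (m : ℂ) := by
      simp [hc', hj, hm]
    have e4 : ∀ k : ℤ, c (.inr o) + 1 ≠ k := fun k hk =>
      hcr (k - 1) (by push_cast; rw [← hk]; ring)
    rw [qp_mono, e1, e2, e3, pCoeff_of_ne e4, qCoeff_nat, mul_one] at h3
    have h4 : c (.inr o) + 1 ≠ 0 := by simpa using e4 0
    simpa [smul_smul, inv_mul_cancel₀ h4] using R.smul_mem (c (.inr o) + 1)⁻¹ h3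
  push Not at hA
  obtain ⟨b', rfl⟩ := exists_eq_tuple hc ho hl hB hA
  rw [sum_inl_tuple hl, add_right_inj, add_right_inj] at hsum
  rwa [hsum]

end Lowering

/-! ### Representations of `𝔰𝔩₂` on which the lowering operator is injective -/

section SlTwo

variable {V : Type*} [AddCommGroup V] [Module ℂ V] {X Y H : Module.End ℂ V}

theorem H_pow_X (hHX : ∀ v, H (X v) = X (H v) - (2 : ℂ) • X v) {k : ℂ} {v : V}
    (hv : H v = k • v) (m : ℕ) : H ((X ^ m) v) = (k - 2 * m) • (X ^ m) v := by
  induction m with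
  | zero => simp [hv]
  | succ m ih =>
    rw [pow_succ', Module.End.mul_apply, hHX, ih, map_smul]
    push_cast
    module

theorem Y_pow_X (hHX : ∀ v, H (X v) = X (H v) - (2 : ℂ) • X v)
    (hYX : ∀ v, Y (X v) = X (Y v) + H v) {k : ℂ} {v : V} (hv : H v = k • v) (hY : Y v = 0)
    (m : ℕ) : Y ((X ^ (m + 1)) v) = ((m + 1) * (k - m)) • (X ^ m) v := by
  induction m with
  | zero => simp [hYX, hY, hv]
  | succ m ih =>
    rw [pow_succ', Module.End.mul_apply, hYX, ih, map_smul, H_pow_X hHX hv,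
      ← Module.End.mul_apply, ← pow_succ']
    push_cast
    module

/-- If `X v` has weight `k` and is killed by `Y`, then it is divisible by a power of `X` as high as
the factors `i (k + i + 1)` allow: if it is `X ^ i w`, then `X (Y w)` is the multiple of `w` by
`-i (k + i + 1)`, so `w` is divisible by `X`. -/
theorem exists_eq_pow_X (hHX : ∀ v, H (X v) = X (H v) - (2 : ℂ) • X v)
    (hHY : ∀ v, H (Y v) = Y (H v) + (2 : ℂ) • Y v)
    (hYX : ∀ v, Y (X v) = X (Y v) + H v) (hX : ∀ v, X v = 0 → v = 0) {k : ℂ} {v : V}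
    (hH : H (X v) = k • X v) (hY : Y (X v) = 0) (j : ℕ)
    (hj : ∀ i : ℕ, 0 < i → i ≤ j → k + i + 1 ≠ 0) :
    ∃ w, X v = (X ^ (j + 1)) w ∧ H w = (k + 2 * (j + 1)) • w ∧
      Y (X w) = (-(j : ℂ) * (k + j + 1)) • w := by
  induction j with
  | zero =>
    refine ⟨v, by simp, ?_, by simp [hY]⟩
    rw [← sub_eq_zero]
    refine hX _ ?_
    rw [map_sub, map_smul]
    have h2 : X (H v) = k • X v + (2 : ℂ) • X v := by
      rw [← hH, hHX]
      abel
    rw [h2]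
    push_cast
    module
  | succ j ih =>
    obtain ⟨w, hw, hwH, hwY⟩ := ih fun i h0 h => hj i h0 (h.trans j.le_succ)
    have hXY : X (Y w) = (-((j : ℂ) + 1) * (k + (j + 1 : ℕ) + 1)) • w := by
      have := hYX w
      rw [hwY, hwH] at this
      rw [eq_sub_of_add_eq this.symm]
      push_cast
      module
    set c : ℂ := -((j : ℂ) + 1) * (k + (j + 1 : ℕ) + 1) with hc
    have hc0 : c ≠ 0 := mul_ne_zero (neg_ne_zero.2 (Nat.cast_add_one_ne_zero j))
      (hj (j + 1) j.succ_pos le_rfl)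
    have hwc : X (c⁻¹ • Y w) = w := by
      rw [map_smul, hXY, smul_smul, inv_mul_cancel₀ hc0, one_smul]
    refine ⟨c⁻¹ • Y w, ?_, ?_, ?_⟩
    · rw [pow_succ, Module.End.mul_apply, hwc, hw]
    · rw [map_smul, hHY, hwH, map_smul]
      push_cast
      module
    · rw [hwc]
      rw [smul_smul, show -((j + 1 : ℕ) : ℂ) * (k + (j + 1 : ℕ) + 1) * c⁻¹ = c * c⁻¹ by
        rw [hc]; push_cast; ring, mul_inv_cancel₀ hc0, one_smul]

end SlTwo

/-! ### The Lie algebra actions on `N_{a₁,a₂}` -/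

section Actions

open LieAlgebra.SpecialLinear

variable {n : ℕ}

theorem lie_Y_X : ⁅elemY n, elemX n⁆ = elemH n := by
  ext1
  change Matrix.fromBlocks 0 1 0 0 * Matrix.fromBlocks 0 0 1 0 -
    Matrix.fromBlocks 0 0 1 0 * Matrix.fromBlocks 0 1 0 0 = Matrix.fromBlocks 1 0 0 (-1)
  simp [Matrix.fromBlocks_multiply, sub_eq_add_neg, Matrix.fromBlocks_add, Matrix.fromBlocks_neg]

theorem lie_H_X : ⁅elemH n, elemX n⁆ = (-2 : ℂ) • elemX n := by
  ext1
  change Matrix.fromBlocks 1 0 0 (-1) * Matrix.fromBlocks 0 0 1 0 -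
    Matrix.fromBlocks 0 0 1 0 * Matrix.fromBlocks 1 0 0 (-1) =
      (-2 : ℂ) • (Matrix.fromBlocks 0 0 1 0 : Matrix (Fin n ⊕ Fin n) (Fin n ⊕ Fin n) ℂ)
  simp only [Matrix.fromBlocks_multiply, sub_eq_add_neg, Matrix.fromBlocks_add,
    Matrix.fromBlocks_neg, Matrix.fromBlocks_smul]
  congr 1 <;> simp
  module

theorem lie_H_Y : ⁅elemH n, elemY n⁆ = (2 : ℂ) • elemY n := by
  ext1
  change Matrix.fromBlocks 1 0 0 (-1) * Matrix.fromBlocks 0 1 0 0 -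
    Matrix.fromBlocks 0 1 0 0 * Matrix.fromBlocks 1 0 0 (-1) =
      (2 : ℂ) • (Matrix.fromBlocks 0 1 0 0 : Matrix (Fin n ⊕ Fin n) (Fin n ⊕ Fin n) ℂ)
  simp only [Matrix.fromBlocks_multiply, sub_eq_add_neg, Matrix.fromBlocks_add,
    Matrix.fromBlocks_neg, Matrix.fromBlocks_smul]
  congr 1 <;> simp
  module

theorem exists_eq_of_mem_aAlg {u : sl2n n} (hu : u ∈ aAlg n) :
    ∃ α β γ : ℂ, u = α • elemX n + β • elemH n + γ • elemY n := by
  have hXY : ⁅elemX n, elemY n⁆ = -elemH n := by rw [← lie_skew, lie_Y_X]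
  have hXH : ⁅elemX n, elemH n⁆ = (2 : ℂ) • elemX n := by
    rw [← lie_skew, lie_H_X, neg_smul, neg_neg]
  have hYH : ⁅elemY n, elemH n⁆ = -((2 : ℂ) • elemY n) := by rw [← lie_skew, lie_H_Y]
  unfold aAlg at hu
  induction hu using LieSubalgebra.lieSpan_induction with
  | mem x hx =>
    rcases hx with rfl | rfl | rfl
    · exact ⟨1, 0, 0, by simp⟩
    · exact ⟨0, 1, 0, by simp⟩
    · exact ⟨0, 0, 1, by simp⟩
  | zero => exact ⟨0, 0, 0, by simp⟩
  | add x y _ _ hx hy =>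
    obtain ⟨α, β, γ, rfl⟩ := hx
    obtain ⟨α', β', γ', rfl⟩ := hy
    exact ⟨α + α', β + β', γ + γ', by module⟩
  | smul a x _ hx =>
    obtain ⟨α, β, γ, rfl⟩ := hx
    exact ⟨a * α, a * β, a * γ, by module⟩
  | lie x y _ _ hx hy =>
    obtain ⟨α, β, γ, rfl⟩ := hx
    obtain ⟨α', β', γ', rfl⟩ := hy
    refine ⟨2 * (α * β' - β * α'), γ * α' - α * γ', 2 * (β * γ' - γ * β'), ?_⟩
    simp only [add_lie, lie_add, smul_lie, lie_smul, lie_self, hXY, hXH, hYH, lie_Y_X, lie_H_X,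
      lie_H_Y]
    module

theorem lie_bAlg_gen {u : sl2n n} (hu : u ∈ bAlg n) :
    ⁅u, elemX n⁆ = 0 ∧ ⁅u, elemY n⁆ = 0 ∧ ⁅u, elemH n⁆ = 0 := by
  obtain ⟨A, rfl⟩ := hu
  refine ⟨?_, ?_, ?_⟩
  · ext1
    change Matrix.fromBlocks A.1 0 0 A.1 * Matrix.fromBlocks 0 0 1 0 -
      Matrix.fromBlocks 0 0 1 0 * Matrix.fromBlocks A.1 0 0 A.1 = 0
    simp [Matrix.fromBlocks_multiply]
  · ext1
    change Matrix.fromBlocks A.1 0 0 A.1 * Matrix.fromBlocks 0 1 0 0 -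
      Matrix.fromBlocks 0 1 0 0 * Matrix.fromBlocks A.1 0 0 A.1 = 0
    simp [Matrix.fromBlocks_multiply]
  · ext1
    change Matrix.fromBlocks A.1 0 0 A.1 * Matrix.fromBlocks 1 0 0 (-1) -
      Matrix.fromBlocks 1 0 0 (-1) * Matrix.fromBlocks A.1 0 0 A.1 = 0
    simp [Matrix.fromBlocks_multiply]

theorem lie_bAlg_aAlg (u : bAlg n) (w : aAlg n) : ⁅(u : sl2n n), (w : sl2n n)⁆ = 0 := by
  obtain ⟨α, β, γ, h⟩ := exists_eq_of_mem_aAlg w.2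
  obtain ⟨hX, hY, hH⟩ := lie_bAlg_gen u.2
  rw [h, lie_add, lie_add, lie_smul, lie_smul, lie_smul, hX, hY, hH]
  simp

variable {a₁ a₂ : ℂ}

theorem lie_bAlg_lie_aAlg (u : bAlg n) (w : aAlg n) (v : modN n a₁ a₂) :
    ⁅u, ⁅w, v⁆⁆ = ⁅w, ⁅u, v⁆⁆ := by
  have := leibniz_lie (u : sl2n n) (w : sl2n n) v
  rwa [lie_bAlg_aAlg, zero_lie, zero_add] at this

variable (n a₁ a₂) in
/-- The action of `X` on `N_{a₁,a₂}`. -/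
noncomputable def actX : Module.End ℂ (modN n a₁ a₂) := LieModule.toEnd ℂ (sl2n n) _ (elemX n)

variable (n a₁ a₂) in
/-- The action of `Y` on `N_{a₁,a₂}`. -/
noncomputable def actY : Module.End ℂ (modN n a₁ a₂) := LieModule.toEnd ℂ (sl2n n) _ (elemY n)

variable (n a₁ a₂) in
/-- The action of `H` on `N_{a₁,a₂}`. -/
noncomputable def actH : Module.End ℂ (modN n a₁ a₂) := LieModule.toEnd ℂ (sl2n n) _ (elemH n)

theorem actY_actX (v : modN n a₁ a₂) :
    actY n a₁ a₂ (actX n a₁ a₂ v) = actX n a₁ a₂ (actY n a₁ a₂ v) + actH n a₁ a₂ v := by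
  have := leibniz_lie (elemY n) (elemX n) v
  rw [lie_Y_X, add_comm] at this
  exact this

theorem actH_actX (v : modN n a₁ a₂) :
    actH n a₁ a₂ (actX n a₁ a₂ v) = actX n a₁ a₂ (actH n a₁ a₂ v) - (2 : ℂ) • actX n a₁ a₂ v := by
  have := leibniz_lie (elemH n) (elemX n) v
  rw [lie_H_X, add_comm, smul_lie, neg_smul, ← sub_eq_add_neg] at this
  exact this

theorem actH_actY (v : modN n a₁ a₂) :
    actH n a₁ a₂ (actY n a₁ a₂ v) = actY n a₁ a₂ (actH n a₁ a₂ v) + (2 : ℂ) • actY n a₁ a₂ v := by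
  have := leibniz_lie (elemH n) (elemY n) v
  rw [lie_H_Y, add_comm, smul_lie] at this
  exact this

theorem lie_actX (u : bAlg n) (v : modN n a₁ a₂) :
    ⁅u, actX n a₁ a₂ v⁆ = actX n a₁ a₂ ⁅u, v⁆ := by
  have := leibniz_lie (u : sl2n n) (elemX n) v
  rwa [(lie_bAlg_gen u.2).1, zero_lie, zero_add] at this

theorem lie_actY (u : bAlg n) (v : modN n a₁ a₂) :
    ⁅u, actY n a₁ a₂ v⁆ = actY n a₁ a₂ ⁅u, v⁆ := by
  have := leibniz_lie (u : sl2n n) (elemY n) v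
  rwa [(lie_bAlg_gen u.2).2.1, zero_lie, zero_add] at this

theorem lie_actH (u : bAlg n) (v : modN n a₁ a₂) :
    ⁅u, actH n a₁ a₂ v⁆ = actH n a₁ a₂ ⁅u, v⁆ := by
  have := leibniz_lie (u : sl2n n) (elemH n) v
  rwa [(lie_bAlg_gen u.2).2.2, zero_lie, zero_add] at this

theorem lie_actX_pow (u : bAlg n) (m : ℕ) (v : modN n a₁ a₂) :
    ⁅u, (actX n a₁ a₂ ^ m) v⁆ = (actX n a₁ a₂ ^ m) ⁅u, v⁆ := by
  induction m with
  | zero => simp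
  | succ m ih =>
    rw [pow_succ', Module.End.mul_apply, Module.End.mul_apply, lie_actX, ih]

theorem glAction_apply {ι : Type*} [Fintype ι] [DecidableEq ι] (A : Matrix ι ι ℂ)
    (v : MonomialSpace ι) : glAction ι A v = ∑ i, ∑ j, A i j • qOp i (pOp j v) := by
  simp [glAction]

theorem coe_actX (v : modN n a₁ a₂) : (actX n a₁ a₂ v : MonomialSpace (Fin n ⊕ Fin n)) =
    opX n v := by
  change glAction _ (Matrix.fromBlocks 0 0 1 0) v.1 = _
  rw [glAction_apply, opX_apply]
  simp [Fintype.sum_sum_type, Matrix.one_apply]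

theorem coe_actY (v : modN n a₁ a₂) : (actY n a₁ a₂ v : MonomialSpace (Fin n ⊕ Fin n)) =
    opY n v := by
  change glAction _ (Matrix.fromBlocks 0 1 0 0) v.1 = _
  rw [glAction_apply, opY_apply]
  simp [Fintype.sum_sum_type, Matrix.one_apply]

theorem coeff_qp_self {ι : Type*} [DecidableEq ι] (i : ι) (c : ι → ℂ) (f : MonomialSpace ι) :
    coeff c (qOp i (pOp i f)) = c i * coeff c f := by
  refine eq_of_eq_on_mono (f := coeff c ∘ₗ qOp i ∘ₗ pOp i) (g := c i • coeff c) (fun b _ => ?_)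
    (mem_supportedOn_univ f)
  have h := qCoeff_mul_pCoeff (b i - 1)
  rw [sub_add_cancel, mul_comm] at h
  have h' : (b - Pi.single i 1 : ι → ℂ) i = b i - 1 := by simp
  rw [LinearMap.comp_apply, LinearMap.comp_apply, qp_mono, h', h, sub_add_cancel, map_smul,
    LinearMap.smul_apply, coeff_mono]
  split_ifs with hbc
  · rw [hbc]
  · simp

theorem coeff_actH (c : Fin n ⊕ Fin n → ℂ) (v : modN n a₁ a₂) :
    coeff c (actH n a₁ a₂ v : MonomialSpace (Fin n ⊕ Fin n)) =
      (∑ i, c (.inl i) - ∑ i, c (.inr i)) * coeff c (v : MonomialSpace (Fin n ⊕ Fin n)) := by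
  change coeff c (glAction _ (Matrix.fromBlocks 1 0 0 (-1)) v.1) = _
  rw [glAction_apply]
  simp [Fintype.sum_sum_type, Matrix.one_apply, coeff_qp_self, ← sub_eq_add_neg, sub_mul,
    Finset.sum_mul]

/-- The element `diag(E_{i,j}, E_{i,j})` of `𝔟`. -/
def bE {i j : Fin n} (h : i ≠ j) : bAlg n := ⟨diagEmbedding n (single i j h 1), ⟨_, rfl⟩⟩

theorem coe_bE {i j : Fin n} (h : i ≠ j) (v : modN n a₁ a₂) :
    ((⁅bE h, v⁆ : modN n a₁ a₂) : MonomialSpace (Fin n ⊕ Fin n)) = opE i j v := by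
  change glAction _ (Matrix.fromBlocks (Matrix.single i j 1) 0 0 (Matrix.single i j 1)) v.1 = _
  rw [glAction_apply, opE_apply]
  simp [Fintype.sum_sum_type, Matrix.single_apply, ite_and]

/-- The element `diag(E_{i,i} - E_{j,j}, E_{i,i} - E_{j,j})` of `𝔟`. -/
noncomputable def bD (i j : Fin n) : bAlg n :=
  ⟨diagEmbedding n (singleSubSingle i j 1), ⟨_, rfl⟩⟩

theorem coeff_bD (i j : Fin n) (c : Fin n ⊕ Fin n → ℂ) (v : modN n a₁ a₂) :
    coeff c ((⁅bD i j, v⁆ : modN n a₁ a₂) : MonomialSpace (Fin n ⊕ Fin n)) =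
      (c (.inl i) + c (.inr i) - c (.inl j) - c (.inr j)) *
        coeff c (v : MonomialSpace (Fin n ⊕ Fin n)) := by
  have h : ((⁅bD i j, v⁆ : modN n a₁ a₂) : MonomialSpace (Fin n ⊕ Fin n)) =
      glAction _ (Matrix.fromBlocks (singleSubSingle i j (1 : ℂ)).1 0 0
        (singleSubSingle i j (1 : ℂ)).1) v.1 := rfl
  rw [h, val_singleSubSingle, glAction_apply]
  simp [Fintype.sum_sum_type, Matrix.single_apply, ite_and, coeff_qp_self, sub_smul,
    Finset.sum_sub_distrib]
  ring

end Actions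

/-! ### The triangular decompositions of `𝔟` and `𝔞` -/

section Triangular

open LieAlgebra.SpecialLinear

variable {n : ℕ}

theorem lie_bE_bE {i j k : Fin n} (hij : i ≠ j) (hjk : j ≠ k) (hik : i ≠ k) :
    ⁅bE hij, bE hjk⁆ = bE hik := by
  have h : ⁅single i j hij (1 : ℂ), single j k hjk (1 : ℂ)⁆ = single i k hik (1 : ℂ) := by
    ext1
    change Matrix.single i j (1 : ℂ) * Matrix.single j k 1 -
      Matrix.single j k 1 * Matrix.single i j 1 = Matrix.single i k 1
    rw [Matrix.single_mul_single_same, Matrix.single_mul_single_of_ne _ _ _ _ hik.symm, mul_one,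
      sub_zero]
  refine Subtype.ext ?_
  change ⁅diagEmbedding n _, diagEmbedding n _⁆ = diagEmbedding n _
  rw [← LieHom.map_lie, h]

theorem bE_mem_of_lt (i k : ℕ) (h : i + k + 1 < n)
    (hne : (⟨i, by omega⟩ : Fin n) ≠ ⟨i + k + 1, h⟩) : bE hne ∈
      LieSubalgebra.lieSpan ℂ (bAlg n) (Set.range (bRaise n) ∪ Set.range (bCoroot n)) := by
  induction k with
  | zero => exact LieSubalgebra.subset_lieSpan (Or.inl ⟨⟨i, by omega⟩, rfl⟩)
  | succ k ih =>
    have h1 : (⟨i, by omega⟩ : Fin n) ≠ ⟨i + k + 1, by omega⟩ := by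
      rw [Ne, Fin.mk.injEq]
      omega
    have h2 : (⟨i + k + 1, by omega⟩ : Fin n) ≠ ⟨i + (k + 1) + 1, h⟩ := by
      rw [Ne, Fin.mk.injEq]
      omega
    rw [← lie_bE_bE h1 h2 hne]
    exact LieSubalgebra.lie_mem _ (ih (by omega) h1)
      (LieSubalgebra.subset_lieSpan (Or.inl ⟨⟨i + k + 1, by omega⟩, rfl⟩))

theorem bE_mem_of_lt' {i j : Fin n} (hij : i < j) : bE hij.ne ∈
    LieSubalgebra.lieSpan ℂ (bAlg n) (Set.range (bRaise n) ∪ Set.range (bCoroot n)) := by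
  obtain ⟨i, hi⟩ := i
  obtain ⟨j, hj⟩ := j
  have hlt : i < j := hij
  obtain ⟨k, rfl⟩ : ∃ k, j = i + k + 1 := ⟨j - i - 1, by omega⟩
  exact bE_mem_of_lt i k hj _

theorem bD_mem (i : ℕ) (hi : i < n) : bD ⟨i, hi⟩ ⟨0, by omega⟩ ∈
    LieSubalgebra.lieSpan ℂ (bAlg n) (Set.range (bRaise n) ∪ Set.range (bCoroot n)) := by
  have hself : ∀ j : Fin n, bD j j = 0 := fun j => by
    refine Subtype.ext ?_
    change diagEmbedding n _ = 0
    have : singleSubSingle j j (1 : ℂ) = 0 := by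
      ext1
      simp
    rw [this, map_zero]
  induction i with
  | zero => rw [hself]; exact zero_mem _
  | succ i ih =>
    have h : bD ⟨i + 1, hi⟩ ⟨0, by omega⟩ =
        bD ⟨i, by omega⟩ ⟨0, by omega⟩ - bCoroot n ⟨i, by omega⟩ := by
      refine Subtype.ext ?_
      change diagEmbedding n _ = diagEmbedding n _ - diagEmbedding n _
      rw [← map_sub]
      congr 1
      ext1
      simp
    rw [h]
    exact sub_mem (ih _) (LieSubalgebra.subset_lieSpan (Or.inr ⟨⟨i, by omega⟩, rfl⟩))

open Classical in
theorem sl_eq_sum (o : Fin n) (A : sl (Fin n) ℂ) : A =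
    ∑ i, ∑ j, if h : i ≠ j then A.1 i j • single i j h (1 : ℂ)
      else A.1 i i • singleSubSingle i o (1 : ℂ) := by
  ext1
  have h0 : ∑ i, A.1 i i = 0 := A.2
  have h1 : ∀ i j, ((if h : i ≠ j then A.1 i j • single i j h (1 : ℂ)
      else A.1 i i • singleSubSingle i o (1 : ℂ) : sl (Fin n) ℂ) : Matrix (Fin n) (Fin n) ℂ) =
      Matrix.single i j (A.1 i j) - if i = j then Matrix.single o o (A.1 i i) else 0 := by
    intro i j
    by_cases h : i = j
    · subst h
      simp [smul_sub]
    · simp [h]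
  have h2 : ∑ i, Matrix.single o o (A.1 i i) = 0 := by
    have := map_sum (Matrix.singleLinearMap ℂ o o : ℂ →ₗ[ℂ] Matrix (Fin n) (Fin n) ℂ)
      (fun i => A.1 i i) Finset.univ
    rw [h0, map_zero] at this
    exact this.symm
  have h3 : ((∑ i, ∑ j, if h : i ≠ j then A.1 i j • single i j h (1 : ℂ)
      else A.1 i i • singleSubSingle i o (1 : ℂ) : sl (Fin n) ℂ) : Matrix (Fin n) (Fin n) ℂ) =
      ∑ i, ∑ j, (Matrix.single i j (A.1 i j) -
        if i = j then Matrix.single o o (A.1 i i) else 0) := by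
    rw [AddSubmonoidClass.coe_finsetSum]
    refine Finset.sum_congr rfl fun i _ => ?_
    rw [AddSubmonoidClass.coe_finsetSum]
    exact Finset.sum_congr rfl fun j _ => h1 i j
  rw [h3]
  simp only [Finset.sum_sub_distrib]
  rw [← Matrix.matrix_eq_sum_single]
  simp [h2]

/-- The diagonal matrix whose adjoint action grades `𝔰𝔩ₙ`: its entries are negative integers
which strictly decrease, except for the first one, which makes the trace vanish. -/
noncomputable def gradingMatrix (o : Fin n) : sl (Fin n) ℂ :=
  ⟨Matrix.diagonal fun i => (if i = o then ((∑ k : Fin n, (k : ℕ) : ℕ) : ℂ) else 0) - (i : ℕ), by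
    change Matrix.trace (Matrix.diagonal fun i : Fin n =>
      (if i = o then ((∑ k : Fin n, (k : ℕ) : ℕ) : ℂ) else 0) - ((i : ℕ) : ℂ)) = 0
    rw [Matrix.trace_diagonal]
    simp [Finset.sum_sub_distrib]⟩

theorem isGradedBy_bAlg (hn : 0 < n) :
    ∃ h₀, IsGradedBy (bRaise n) (bCoroot n) h₀ := by
  classical
  set L := LieSubalgebra.lieSpan ℂ (bAlg n) (Set.range (bRaise n) ∪ Set.range (bCoroot n)) with hL
  set o : Fin n := ⟨0, hn⟩ with ho
  let toB : sl (Fin n) ℂ →ₗ⁅ℂ⁆ bAlg n := (diagEmbedding n).rangeRestrict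
  have hsum : ∀ A : sl (Fin n) ℂ, toB A =
      ∑ i, ∑ j, if h : i ≠ j then A.1 i j • bE h else A.1 i i • bD i o := by
    intro A
    conv_lhs => rw [sl_eq_sum o A]
    rw [map_sum]
    refine Finset.sum_congr rfl fun i _ => ?_
    rw [map_sum]
    refine Finset.sum_congr rfl fun j _ => ?_
    split_ifs <;> rw [map_smul] <;> rfl
  refine ⟨toB (gradingMatrix o), ?_, ?_⟩
  · rw [hsum]
    refine sum_mem fun i _ => sum_mem fun j _ => ?_
    split_ifs with h
    · have : (gradingMatrix o).1 i j = 0 := Matrix.diagonal_apply_ne _ h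
      rw [this, zero_smul]
      exact zero_mem _
    · exact L.smul_mem _ (bD_mem i i.2)
  · refine eq_top_iff.2 fun u _ => ?_
    obtain ⟨A, rfl⟩ : ∃ A, toB A = u := (diagEmbedding n).surjective_rangeRestrict u
    rw [hsum A]
    refine sum_mem fun i _ => sum_mem fun j _ => ?_
    split_ifs with h
    · rcases lt_or_gt_of_ne h with hij | hij
      · exact Submodule.mem_sup_right (L.smul_mem _ (bE_mem_of_lt' hij))
      · refine Submodule.mem_sup_left (Submodule.smul_mem _ _ (Submodule.subset_span ?_))
        have hio : i ≠ o := by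
          rintro rfl
          exact absurd (Fin.lt_def.1 hij) (Nat.not_lt_zero _)
        have hlt : (j : ℕ) < i := hij
        -- the degree of the matrix unit `E_{i,j}`
        refine ⟨(i - j) + if j = o then ∑ k : Fin n, (k : ℕ) else 0, by omega, ?_⟩
        refine Subtype.ext ?_
        change ⁅diagEmbedding n (gradingMatrix o), diagEmbedding n (single i j h 1)⁆ =
          _ • diagEmbedding n (single i j h 1)
        rw [← LieHom.map_lie, ← map_smul]
        congr 1
        ext1
        change Matrix.diagonal _ * Matrix.single i j (1 : ℂ) -
          Matrix.single i j (1 : ℂ) * Matrix.diagonal _ = _ • Matrix.single i j (1 : ℂ)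
        ext a b
        rw [Matrix.sub_apply, Matrix.diagonal_mul, Matrix.mul_diagonal, Matrix.smul_apply,
          Matrix.single_apply]
        by_cases hab : i = a ∧ j = b
        · obtain ⟨rfl, rfl⟩ := hab
          rw [Nat.cast_add, Nat.cast_sub hlt.le]
          by_cases hjo : j = o
          · simp [hio, hjo]
            ring
          · simp [hio, hjo]
            ring
        · simp [hab]
    · exact Submodule.mem_sup_right (L.smul_mem _ (bD_mem i i.2))

theorem isGradedBy_aAlg :
    IsGradedBy (fun _ : Unit => aRaise n) (fun _ : Unit => aCoroot n) (aCoroot n) := by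
  set L := LieSubalgebra.lieSpan ℂ (aAlg n)
    (Set.range (fun _ : Unit => aRaise n) ∪ Set.range (fun _ : Unit => aCoroot n)) with hL
  have hY : aRaise n ∈ L := LieSubalgebra.subset_lieSpan (Or.inl ⟨(), rfl⟩)
  have hH : aCoroot n ∈ L := LieSubalgebra.subset_lieSpan (Or.inr ⟨(), rfl⟩)
  refine ⟨hH, eq_top_iff.2 fun u _ => ?_⟩
  obtain ⟨α, β, γ, hu⟩ := exists_eq_of_mem_aAlg u.2
  have hu' : u = α • (⟨elemX n, LieSubalgebra.subset_lieSpan (by simp)⟩ : aAlg n) +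
      (β • aCoroot n + γ • aRaise n) := by
    refine Subtype.ext ?_
    rw [hu, add_assoc]
    rfl
  rw [hu']
  refine add_mem (Submodule.mem_sup_left (Submodule.smul_mem _ _ (Submodule.subset_span
    ⟨2, two_pos, Subtype.ext ?_⟩))) (Submodule.mem_sup_right (add_mem (L.smul_mem _ hH)
      (L.smul_mem _ hY)))
  change ⁅elemH n, elemX n⁆ = (-((2 : ℕ) : ℂ)) • elemX n
  rw [lie_H_X, Nat.cast_ofNat]

end Triangular

/-! ### Highest weight vectors of `𝔞` and submodules generated by the `x(b, 0)` -/

section HighestWeight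

variable {n : ℕ}

theorem first_ne_last (hn : 2 < n) :
    (⟨0, Nat.zero_lt_of_lt hn⟩ : Fin n) ≠ ⟨n - 1, by omega⟩ := by
  rw [Ne, Fin.mk.injEq]
  omega

theorem last_succ (hn : 2 < n) : ((⟨n - 1, by omega⟩ : Fin n) : ℕ) + 1 = n := by
  change n - 1 + 1 = n
  omega

variable {a₁ a₂ : ℂ}

section DegreeFiltration

variable (hn : 2 < n)

/-- The vectors whose degree in the first variable is less than `r`. -/
noncomputable def degFil (a₁ a₂ : ℂ) (r : ℕ) : Submodule ℂ (modN n a₁ a₂) :=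
  (supportedOn (degLT (⟨0, Nat.zero_lt_of_lt hn⟩ : Fin n) a₁ a₂ r)).comap
    (modN n a₁ a₂).toSubmodule.subtype

variable {hn}

theorem mem_degFil {r : ℕ} {v : modN n a₁ a₂} : v ∈ degFil hn a₁ a₂ r ↔
    (v : MonomialSpace (Fin n ⊕ Fin n)) ∈
      supportedOn (degLT (⟨0, Nat.zero_lt_of_lt hn⟩ : Fin n) a₁ a₂ r) := Iff.rfl

theorem coe_mem (v : modN n a₁ a₂) :
    (v : MonomialSpace (Fin n ⊕ Fin n)) ∈ supportedOn (admissible (tuple n a₁ a₂)) := v.2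

theorem eq_zero_of_mem_degFil_zero {v : modN n a₁ a₂} (hv : v ∈ degFil hn a₁ a₂ 0) : v = 0 :=
  Subtype.ext (supportedOn_degLT_zero hv)

theorem exists_mem_degFil (v : modN n a₁ a₂) : ∃ r, v ∈ degFil hn a₁ a₂ r :=
  exists_mem_degLT (last_succ hn) (first_ne_last hn) (coe_mem v)

theorem degFil_mono {r s : ℕ} (h : r ≤ s) : degFil hn a₁ a₂ r ≤ degFil hn a₁ a₂ s :=
  fun _ hv => supportedOn_mono (degLT_mono h) hv

theorem mem_degFil_of_actX (h₂ : ∀ k : ℤ, a₂ ≠ k) {v : modN n a₁ a₂} {r : ℕ}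
    (hv : actX n a₁ a₂ v ∈ degFil hn a₁ a₂ (r + 1)) : v ∈ degFil hn a₁ a₂ r := by
  rw [mem_degFil, coe_actX] at hv
  exact mem_degLT_of_opX rfl (last_succ hn) (first_ne_last hn) h₂ (coe_mem v) hv

include hn in
theorem actX_injective (h₂ : ∀ k : ℤ, a₂ ≠ k) {v : modN n a₁ a₂} (hv : actX n a₁ a₂ v = 0) :
    v = 0 :=
  eq_zero_of_mem_degFil_zero (hn := hn) (mem_degFil_of_actX h₂ (hv ▸ zero_mem _))

theorem eq_zero_of_actX_mem (h₂ : ∀ k : ℤ, a₂ ≠ k) {v : modN n a₁ a₂}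
    (hv : actX n a₁ a₂ v ∈ degFil hn a₁ a₂ 1) : v = 0 :=
  eq_zero_of_mem_degFil_zero (hn := hn) (mem_degFil_of_actX h₂ hv)

include hn in
theorem actX_pow_injective (h₂ : ∀ k : ℤ, a₂ ≠ k) (m : ℕ) {v : modN n a₁ a₂}
    (hv : (actX n a₁ a₂ ^ m) v = 0) : v = 0 := by
  induction m with
  | zero => simpa using hv
  | succ m ih =>
    rw [pow_succ', Module.End.mul_apply] at hv
    exact ih (actX_injective (hn := hn) h₂ hv)

theorem mem_degFil_of_actX_pow (h₂ : ∀ k : ℤ, a₂ ≠ k) {v : modN n a₁ a₂} {r : ℕ} (m : ℕ)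
    (hv : (actX n a₁ a₂ ^ m) v ∈ degFil hn a₁ a₂ (r + m)) : v ∈ degFil hn a₁ a₂ r := by
  induction m with
  | zero => simpa using hv
  | succ m ih =>
    rw [pow_succ', Module.End.mul_apply] at hv
    exact ih (mem_degFil_of_actX h₂ hv)

theorem exists_add_actX (h₂ : ∀ k : ℤ, a₂ ≠ k) {v : modN n a₁ a₂} {r : ℕ}
    (hv : v ∈ degFil hn a₁ a₂ (r + 1)) :
    ∃ g ∈ degFil hn a₁ a₂ 1, ∃ u ∈ degFil hn a₁ a₂ r, v = g + actX n a₁ a₂ u := by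
  obtain ⟨g, hg, x, ⟨u, hu, rfl⟩, h⟩ := Submodule.mem_sup.1 (supportedOn_degLT_le rfl h₂ r hv)
  refine ⟨⟨g, supportedOn_mono (fun c hc => hc.1) hg⟩, hg,
    ⟨u, supportedOn_mono (fun c hc => hc.1) hu⟩, hu, Subtype.ext ?_⟩
  change _ = g + (actX n a₁ a₂ _ : MonomialSpace (Fin n ⊕ Fin n))
  rw [coe_actX]
  exact h.symm

theorem actH_mem_degFil {v : modN n a₁ a₂} {r : ℕ} (hv : v ∈ degFil hn a₁ a₂ r) :
    actH n a₁ a₂ v ∈ degFil hn a₁ a₂ r :=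
  mem_supportedOn.2 fun c hc => mem_supportedOn.1 hv c
    (right_ne_zero_of_mul (coeff_actH c v ▸ hc))

theorem bD_mem_degFil (i j : Fin n) {v : modN n a₁ a₂} {r : ℕ} (hv : v ∈ degFil hn a₁ a₂ r) :
    ⁅bD i j, v⁆ ∈ degFil hn a₁ a₂ r :=
  mem_supportedOn.2 fun c hc => mem_supportedOn.1 hv c
    (right_ne_zero_of_mul (coeff_bD i j c v ▸ hc))

end DegreeFiltration

/-- The weight of `x(b, 0)` with respect to `H`. -/
noncomputable def wtH (n : ℕ) (a₁ a₂ : ℂ) (b : ℤ) : ℂ := a₁ - a₂ + 2 * b - (n - 1)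

variable (h₁ : ∀ k : ℤ, a₁ ≠ k) (h₂ : ∀ k : ℤ, a₂ ≠ k)

theorem coe_xVec (b : ℤ) (h : 0 < n) :
    (xVec n h a₁ a₂ h₁ h₂ b : MonomialSpace (Fin n ⊕ Fin n)) =
      mono (tuple n (a₁ + b) (a₂ - b)) := rfl

theorem xVec_ne_zero (b : ℤ) (h : 0 < n) : xVec n h a₁ a₂ h₁ h₂ b ≠ 0 := fun h0 =>
  mono_ne_zero (tuple n (a₁ + b) (a₂ - b)) (congrArg Subtype.val h0)

theorem tuple_inl {i : Fin n} (hi : (i : ℕ) + 1 ≠ n) (u v : ℂ) : tuple n u v (.inl i) = -1 := by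
  simp [tuple, hi]

theorem tuple_inr {i : Fin n} (hi : (i : ℕ) ≠ 0) (u v : ℂ) : tuple n u v (.inr i) = 0 := by
  simp [tuple, hi]

theorem tuple_first (hn : 2 < n) (u v : ℂ) :
    tuple n u v (.inl ⟨0, Nat.zero_lt_of_lt hn⟩) = -1 := by
  refine tuple_inl ?_ u v
  change 0 + 1 ≠ n
  omega

theorem xVec_mem_degFil (hn : 2 < n) (b : ℤ) (h : 0 < n) :
    xVec n h a₁ a₂ h₁ h₂ b ∈ degFil hn a₁ a₂ 1 :=
  mono_mem_supportedOn (mem_degLT_one.2 ⟨tuple_mem n h a₁ a₂ h₁ h₂ b, tuple_first hn _ _⟩)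

theorem qp_tuple_eq_zero {i : Fin n} (hi : (i : ℕ) + 1 ≠ n) {j : Fin n ⊕ Fin n}
    (hj : j ≠ .inl i) (u v : ℂ) : qOp (.inl i) (pOp j (mono (tuple n u v))) = 0 := by
  have h : (tuple n u v - Pi.single j 1 : Fin n ⊕ Fin n → ℂ) (.inl i) = -1 - ((0 : ℕ) : ℂ) := by
    simp [hj.symm, tuple_inl hi]
  rw [qp_mono, h, qCoeff_neg]
  simp

theorem pOp_tuple_eq_zero {i : Fin n} (hi : (i : ℕ) ≠ 0) (u v : ℂ) :
    pOp (.inr i) (mono (tuple n u v)) = 0 :=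
  pOp_eq_zero (mono_mem_supportedOn (tuple_inr hi u v))

theorem opE_xVec {i j : Fin n} (hij : i < j) (u v : ℂ) : opE i j (mono (tuple n u v)) = 0 := by
  have h := Fin.lt_def.1 hij
  rw [opE_apply, qp_tuple_eq_zero (by omega) (by simpa using hij.ne'),
    pOp_tuple_eq_zero (by omega), map_zero, add_zero]

theorem bE_xVec {i j : Fin n} (hij : i < j) (b : ℤ) (h : 0 < n) :
    ⁅bE hij.ne, xVec n h a₁ a₂ h₁ h₂ b⁆ = 0 := by
  refine Subtype.ext ?_
  rw [coe_bE, coe_xVec, opE_xVec hij]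
  rfl

theorem actY_xVec (hn : 2 < n) (b : ℤ) (h : 0 < n) :
    actY n a₁ a₂ (xVec n h a₁ a₂ h₁ h₂ b) = 0 := by
  refine Subtype.ext ?_
  rw [coe_actY, coe_xVec, opY_apply]
  refine Finset.sum_eq_zero fun i _ => ?_
  by_cases hi : (i : ℕ) + 1 = n
  · rw [pOp_tuple_eq_zero (by omega), map_zero]
  · exact qp_tuple_eq_zero hi (by simp) _ _

theorem ext_coe {v w : modN n a₁ a₂} (h : ∀ c,
    coeff c (v : MonomialSpace (Fin n ⊕ Fin n)) = coeff c (w : MonomialSpace (Fin n ⊕ Fin n))) :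
    v = w := Subtype.ext (ext_coeff h)

theorem sum_tuple_sub (hn : 2 < n) (b : ℤ) :
    ∑ i, tuple n (a₁ + b) (a₂ - b) (.inl i) - ∑ i, tuple n (a₁ + b) (a₂ - b) (.inr i) =
      wtH n a₁ a₂ b := by
  rw [sum_inl_tuple (last_succ hn), sum_inr_tuple (o := ⟨0, Nat.zero_lt_of_lt hn⟩) rfl, wtH]
  ring

theorem actH_xVec (hn : 2 < n) (b : ℤ) (h : 0 < n) :
    actH n a₁ a₂ (xVec n h a₁ a₂ h₁ h₂ b) = wtH n a₁ a₂ b • xVec n h a₁ a₂ h₁ h₂ b := by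
  refine ext_coe fun c => ?_
  rw [coeff_actH]
  change _ = coeff c (wtH n a₁ a₂ b • mono (tuple n (a₁ + b) (a₂ - b)))
  rw [coe_xVec, map_smul, coeff_mono, smul_eq_mul]
  split_ifs with hc
  · rw [← hc, sum_tuple_sub hn]
  · simp

theorem bD_xVec (i j : Fin n) (b : ℤ) (h : 0 < n) :
    ⁅bD i j, xVec n h a₁ a₂ h₁ h₂ b⁆ =
      (tuple n (a₁ + b) (a₂ - b) (.inl i) + tuple n (a₁ + b) (a₂ - b) (.inr i) -
        tuple n (a₁ + b) (a₂ - b) (.inl j) - tuple n (a₁ + b) (a₂ - b) (.inr j)) •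
      xVec n h a₁ a₂ h₁ h₂ b := by
  refine ext_coe fun c => ?_
  rw [coeff_bD, LieSubmodule.coe_smul, coe_xVec, map_smul, coeff_mono, smul_eq_mul]
  split_ifs with hc
  · rw [← hc]
  · simp

theorem eq_smul_xVec {b : ℤ} {h : 0 < n} {g : modN n a₁ a₂}
    (hg : (g : MonomialSpace (Fin n ⊕ Fin n)) ∈ supportedOn (tuples n a₁ a₂))
    (hsep : ∀ b' : ℤ, b' ≠ b → coeff (tuple n (a₁ + b') (a₂ - b'))
      (g : MonomialSpace (Fin n ⊕ Fin n)) = 0) :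
    ∃ t : ℂ, g = t • xVec n h a₁ a₂ h₁ h₂ b := by
  refine ⟨coeff (tuple n (a₁ + b) (a₂ - b)) (g : MonomialSpace (Fin n ⊕ Fin n)),
    ext_coe fun c => ?_⟩
  rw [LieSubmodule.coe_smul, coe_xVec, map_smul, coeff_mono, smul_eq_mul]
  split_ifs with hc
  · rw [hc, mul_one]
  · rw [mul_zero]
    by_contra h0
    obtain ⟨b', rfl⟩ := mem_supportedOn.1 hg c h0
    refine h0 (hsep b' ?_)
    rintro rfl
    exact hc rfl

theorem wtH_injective {b b' : ℤ} (h : wtH n a₁ a₂ b = wtH n a₁ a₂ b') : b = b' := by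
  unfold wtH at h
  have : (b : ℂ) = b' := by linear_combination h / 2
  exact_mod_cast this

theorem eq_smul_xVec_of_actH (hn : 2 < n) {b : ℤ} {h : 0 < n} {g : modN n a₁ a₂}
    (hg : (g : MonomialSpace (Fin n ⊕ Fin n)) ∈ supportedOn (tuples n a₁ a₂))
    (hH : actH n a₁ a₂ g = wtH n a₁ a₂ b • g) : ∃ t : ℂ, g = t • xVec n h a₁ a₂ h₁ h₂ b := by
  refine eq_smul_xVec h₁ h₂ hg fun b' hb' => ?_
  have h1 := coeff_actH (tuple n (a₁ + b') (a₂ - b')) g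
  rw [hH, LieSubmodule.coe_smul, map_smul, sum_tuple_sub hn, smul_eq_mul, ← sub_eq_zero,
    ← sub_mul] at h1
  exact (mul_eq_zero.1 h1).resolve_left fun h0 => hb' (wtH_injective (sub_eq_zero.1 h0)).symm

/-- The `𝔟`-submodule of the vectors that are killed by `Y` and have the `H`-weight of
`x(b, 0)`. -/
noncomputable def hwSpace (n : ℕ) (a₁ a₂ : ℂ) (b : ℤ) :
    LieSubmodule ℂ (bAlg n) (modN n a₁ a₂) where
  carrier := {v | actY n a₁ a₂ v = 0 ∧ actH n a₁ a₂ v = wtH n a₁ a₂ b • v}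
  add_mem' := by
    rintro v w ⟨hv, hv'⟩ ⟨hw, hw'⟩
    exact ⟨by rw [map_add, hv, hw, add_zero], by rw [map_add, hv', hw', smul_add]⟩
  zero_mem' := ⟨map_zero _, by rw [map_zero, smul_zero]⟩
  smul_mem' := by
    rintro t v ⟨hv, hv'⟩
    exact ⟨by rw [map_smul, hv, smul_zero], by rw [map_smul, hv', smul_comm]⟩
  lie_mem := by
    rintro u v ⟨hv, hv'⟩
    exact ⟨by rw [← lie_actY, hv, lie_zero], by rw [← lie_actH, hv', lie_smul]⟩

theorem mem_hwSpace {b : ℤ} {v : modN n a₁ a₂} : v ∈ hwSpace n a₁ a₂ b ↔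
    actY n a₁ a₂ v = 0 ∧ actH n a₁ a₂ v = wtH n a₁ a₂ b • v := Iff.rfl

theorem restrictTo_qp {ι : Type*} [DecidableEq ι] {k i j : ι} (hi : k ≠ i) (hj : k ≠ j) (z : ℂ)
    (f : MonomialSpace ι) : restrictTo {c | c k = z} (qOp i (pOp j f)) =
      qOp i (pOp j (restrictTo {c | c k = z} f)) := by
  refine eq_of_eq_on_mono (f := restrictTo {c | c k = z} ∘ₗ qOp i ∘ₗ pOp j)
    (g := qOp i ∘ₗ pOp j ∘ₗ restrictTo {c | c k = z}) (fun c _ => ?_) (mem_supportedOn_univ f)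
  simp only [LinearMap.comp_apply, qp_mono, map_smul]
  have h : (c - Pi.single j 1 + Pi.single i 1 : ι → ℂ) k = c k := by
    simp [hi, hj]
  by_cases hc : c k = z
  · rw [restrictTo_mono_of_mem (S := {c | c k = z}) (h.trans hc),
      restrictTo_mono_of_mem (S := {c | c k = z}) hc, qp_mono]
  · rw [restrictTo_mono_of_notMem (S := {c | c k = z}) (fun h' => hc (h.symm.trans h')),
      restrictTo_mono_of_notMem (S := {c | c k = z}) hc, map_zero, map_zero, smul_zero]

/-- Among the terms without the first variable, `E_{j,1}` acts as `q_{n+j} p_{n+1}`: its other part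
creates the first variable. -/
theorem restrictTo_opE {o l j : Fin n} (hl : (l : ℕ) + 1 = n) (hol : o ≠ l) (hj : j ≠ o)
    {f : MonomialSpace (Fin n ⊕ Fin n)} (hf : f ∈ supportedOn (admissible (tuple n a₁ a₂))) :
    restrictTo {c | c (.inl o) = -1} (opE j o f) =
      qOp (.inr j) (pOp (.inr o) (restrictTo {c | c (.inl o) = -1} f)) := by
  rw [opE_apply, map_add,
    restrictTo_qp (k := Sum.inl o) (i := Sum.inr j) (j := Sum.inr o) (by simp) (by simp),
    add_eq_right]
  suffices h : ∀ c ∈ admissible (tuple n a₁ a₂),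
      (restrictTo {c | c (.inl o) = -1} ∘ₗ qOp (.inl j) ∘ₗ pOp (.inl o)) (mono c) ∈
        (⊥ : Submodule ℂ (MonomialSpace (Fin n ⊕ Fin n))) from
    (Submodule.mem_bot ℂ).1 (map_mem_of_mono h hf)
  intro c hc
  obtain ⟨m, hm⟩ := exists_eq_neg hc hl hol
  rw [Submodule.mem_bot, LinearMap.comp_apply, LinearMap.comp_apply, qp_mono, map_smul,
    restrictTo_mono_of_notMem, smul_zero]
  intro h
  have h' : -1 - (m : ℂ) - 1 = -1 := by simpa [hj.symm, hm] using h
  have : ((m + 1 : ℕ) : ℂ) = 0 := by push_cast; linear_combination -h'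
  exact absurd (Nat.cast_eq_zero.1 this) m.succ_ne_zero

/-- The vectors killed by `Y` of the `H`-weight of `x(b, 0)` are those which `x(b, 0)` generates
under `𝔟`: restriction to the terms not involving the first variable is injective on the kernel of
`Y`, and the lowering operators applied to `x(b, 0)` give all the monomials after restriction. -/
theorem bGen_eq (hn : 2 < n) (b : ℤ) (h : 0 < n) :
    bGen n (xVec n h a₁ a₂ h₁ h₂ b) = hwSpace n a₁ a₂ b := by
  have hle : bGen n (xVec n h a₁ a₂ h₁ h₂ b) ≤ hwSpace n a₁ a₂ b := by
    rw [LieSubmodule.lieSpan_le]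
    rintro _ rfl
    exact ⟨actY_xVec h₁ h₂ hn b h, actH_xVec h₁ h₂ hn b h⟩
  refine le_antisymm hle fun v hv => ?_
  set o : Fin n := ⟨0, Nat.zero_lt_of_lt hn⟩ with ho
  set l : Fin n := ⟨n - 1, by omega⟩ with hl
  have hol : o ≠ l := first_ne_last hn
  set ρ := restrictTo {c : Fin n ⊕ Fin n → ℂ | c (.inl o) = -1} with hρ
  set P := (bGen n (xVec n h a₁ a₂ h₁ h₂ b)).toSubmodule with hP
  set R := (P.map (modN n a₁ a₂).toSubmodule.subtype).map ρ with hR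
  have hRmem : ∀ w ∈ P, ρ (w : MonomialSpace (Fin n ⊕ Fin n)) ∈ R := fun w hw =>
    Submodule.mem_map_of_mem (Submodule.mem_map_of_mem hw)
  have hmono : ∀ c ∈ admissible (tuple n a₁ a₂), c (.inl o) = -1 →
      ∑ i, c (.inl i) = -((n : ℂ) - 1) + (a₁ + b) → mono c ∈ R := by
    intro c hc hco hs
    refine mono_mem_of_lowering (o := o) (l := l) rfl (last_succ hn) h₁ h₂ b ?_ ?_ ?_ hc hco hs
    · have := hRmem _ (LieSubmodule.subset_lieSpan (R := ℂ) (L := bAlg n)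
        (Set.mem_singleton (xVec n h a₁ a₂ h₁ h₂ b)))
      rwa [coe_xVec, hρ, restrictTo_mono_of_mem] at this
      exact tuple_first hn _ _
    · rintro _ ⟨_, ⟨w, hw, rfl⟩, rfl⟩ j hj
      have := hRmem _ ((bGen n (xVec n h a₁ a₂ h₁ h₂ b)).lie_mem (x := bE hj) hw)
      rwa [coe_bE, hρ, restrictTo_opE (last_succ hn) hol hj (coe_mem w)] at this
    · rintro _ ⟨_, ⟨w, hw, rfl⟩, rfl⟩ i hi hil
      have := hRmem _ ((bGen n (xVec n h a₁ a₂ h₁ h₂ b)).lie_mem (x := bE hil.symm) hw)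
      rw [coe_bE, opE_apply, map_add, hρ,
        restrictTo_qp (k := Sum.inl o) (i := Sum.inl l) (j := Sum.inl i) (by simpa using hol)
          (by simpa using hi.symm),
        restrictTo_qp (k := Sum.inl o) (i := Sum.inr l) (j := Sum.inr i) (by simp)
          (by simp)] at this
      exact this
  -- the weight for `H` fixes the sum of the entries of each block
  have hvs : (v : MonomialSpace (Fin n ⊕ Fin n)) ∈ supportedOn {c |
      c ∈ admissible (tuple n a₁ a₂) ∧ ∑ i, c (.inl i) = -((n : ℂ) - 1) + (a₁ + b)} := by
    refine mem_supportedOn.2 fun c hc => ⟨mem_supportedOn.1 (coe_mem v) c hc, ?_⟩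
    have h1 := coeff_actH c v
    rw [(mem_hwSpace.1 hv).2, LieSubmodule.coe_smul, map_smul, smul_eq_mul] at h1
    have h2 := mul_right_cancel₀ hc h1
    have h3 := (mem_supportedOn.1 (coe_mem v) c hc).2.2
    rw [Fintype.sum_sum_type, Fintype.sum_sum_type, sum_inl_tuple (last_succ hn),
      sum_inr_tuple (o := o) rfl] at h3
    rw [wtH] at h2
    linear_combination (h3 - h2) / 2
  have hρv : ρ (v : MonomialSpace (Fin n ⊕ Fin n)) ∈ R := by
    have h1 := restrictTo_mem (S := {c : Fin n ⊕ Fin n → ℂ | c (.inl o) = -1}) hvs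
    refine (Submodule.span_le.2 ?_ : supportedOn _ ≤ R) h1
    rintro _ ⟨c, ⟨hco, hc, hs⟩, rfl⟩
    exact hmono c hc hco hs
  obtain ⟨_, ⟨w, hw, rfl⟩, hwv⟩ := hρv
  have hw' : w ∈ hwSpace n a₁ a₂ b := hle hw
  have hzero : v - w = 0 := by
    refine Subtype.ext (eq_zero_of_opY (o := o) rfl (last_succ hn) hol h₂ (coe_mem (v - w)) ?_ ?_)
    · rw [← coe_actY, map_sub, hw'.1, hv.1, sub_zero]
      rfl
    · intro c hc
      have h1 := coeff_restrictTo (S := {c : Fin n ⊕ Fin n → ℂ | c (.inl o) = -1}) hc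
        (w : MonomialSpace (Fin n ⊕ Fin n))
      have h2 := coeff_restrictTo (S := {c : Fin n ⊕ Fin n → ℂ | c (.inl o) = -1}) hc
        (v : MonomialSpace (Fin n ⊕ Fin n))
      rw [LieSubmodule.coe_sub, map_sub, ← h1, ← h2, sub_eq_zero]
      exact congrArg (coeff c) hwv.symm
  rw [sub_eq_zero.1 hzero]
  exact hw

end HighestWeight

/-! ### Submodules of submodules and of quotients -/

section Submodules

variable {𝔤 V : Type*} [LieRing 𝔤] [LieAlgebra ℂ 𝔤] [AddCommGroup V] [Module ℂ V]
  [LieRingModule 𝔤 V] [LieModule ℂ 𝔤 V]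

omit [LieAlgebra ℂ 𝔤] [LieModule ℂ 𝔤 V] in
theorem isIrreducible_of_le {P : LieSubmodule ℂ 𝔤 V} (hP : P ≠ ⊥)
    (h : ∀ T ≤ P, T ≠ ⊥ → T = P) : LieModule.IsIrreducible ℂ 𝔤 P where
  exists_pair_ne := by
    refine ⟨⊥, ⊤, fun h0 => hP ?_⟩
    refine (LieSubmodule.eq_bot_iff P).2 fun x hx => ?_
    have : (⟨x, hx⟩ : P) ∈ (⊥ : LieSubmodule ℂ 𝔤 P) := h0 ▸ LieSubmodule.mem_top _
    exact congrArg Subtype.val ((LieSubmodule.mem_bot _).1 this)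
  eq_bot_or_eq_top T := by
    by_cases hT : T.map P.incl = ⊥
    · left
      refine (LieSubmodule.eq_bot_iff T).2 fun x hx => Subtype.ext ?_
      exact (LieSubmodule.eq_bot_iff _).1 hT _ (LieSubmodule.mem_map_of_mem (f := P.incl) hx)
    · right
      have hle : T.map P.incl ≤ P := by
        rintro _ ⟨x, -, rfl⟩
        exact x.2
      refine eq_top_iff.2 fun x _ => ?_
      have hx : (x : V) ∈ T.map P.incl := (h _ hle hT).symm ▸ x.2
      obtain ⟨y, hy, hyx⟩ := (LieSubmodule.mem_map _).1 hx
      rwa [← Subtype.ext hyx]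

theorem hasLengthTwo_of_le {P S : LieSubmodule ℂ 𝔤 V} (hSP : S ≤ P) (hS : S ≠ ⊥) (hne : S ≠ P)
    (hmin : ∀ T ≤ S, T ≠ ⊥ → T = S) (hmax : ∀ T, S ≤ T → T ≤ P → T ≠ S → T = P) :
    HasLengthTwo 𝔤 P := by
  set S' : LieSubmodule ℂ 𝔤 P := S.comap P.incl with hS'
  have hmem : ∀ x : P, x ∈ S' ↔ (x : V) ∈ S := fun x => Iff.rfl
  refine ⟨S', isIrreducible_of_le ?_ ?_, { toNontrivial := ?_, eq_bot_or_eq_top := ?_ }⟩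
  · intro h0
    refine hS ((LieSubmodule.eq_bot_iff S).2 fun x hx => ?_)
    have := (LieSubmodule.eq_bot_iff S').1 h0 ⟨x, hSP hx⟩ hx
    exact congrArg Subtype.val this
  · intro T hT hT0
    have h1 : T.map P.incl = S := by
      refine hmin _ ?_ fun h0 => hT0 ((LieSubmodule.eq_bot_iff T).2 fun x hx => Subtype.ext ?_)
      · rintro _ ⟨x, hx, rfl⟩
        exact hT hx
      · exact (LieSubmodule.eq_bot_iff _).1 h0 _ (LieSubmodule.mem_map_of_mem (f := P.incl) hx)
    refine le_antisymm hT fun x hx => ?_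
    have hx' : (x : V) ∈ T.map P.incl := h1 ▸ hx
    obtain ⟨y, hy, hyx⟩ := (LieSubmodule.mem_map _).1 hx'
    rwa [← Subtype.ext hyx]
  · refine ⟨⟨⊥, ⊤, fun h0 => hne (le_antisymm hSP fun x hx => ?_)⟩⟩
    have : LieSubmodule.Quotient.mk' S' ⟨x, hx⟩ ∈ (⊥ : LieSubmodule ℂ 𝔤 (P ⧸ S')) :=
      h0 ▸ LieSubmodule.mem_top _
    rw [LieSubmodule.mem_bot, LieSubmodule.Quotient.mk_eq_zero] at this
    exact this
  · intro W
    set T : LieSubmodule ℂ 𝔤 V := (W.comap (LieSubmodule.Quotient.mk' S')).map P.incl with hT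
    have hTP : T ≤ P := by
      rintro _ ⟨x, -, rfl⟩
      exact x.2
    have hTmem : ∀ x : P, (x : V) ∈ T ↔ LieSubmodule.Quotient.mk' S' x ∈ W := by
      intro x
      constructor
      · intro hx
        obtain ⟨y, hy, hyx⟩ := (LieSubmodule.mem_map _).1 hx
        rwa [← Subtype.ext hyx]
      · intro hx
        exact LieSubmodule.mem_map_of_mem (f := P.incl) (N := W.comap _) hx
    have hST : S ≤ T := fun x hx => (hTmem ⟨x, hSP hx⟩).2 (by
      rw [(LieSubmodule.Quotient.mk_eq_zero S').2 hx]
      exact zero_mem W)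
    by_cases h : T = S
    · left
      refine (LieSubmodule.eq_bot_iff W).2 fun w hw => ?_
      obtain ⟨x, rfl⟩ := LieSubmodule.Quotient.surjective_mk' S' w
      rw [LieSubmodule.Quotient.mk_eq_zero]
      have := (hTmem x).2 hw
      rwa [h] at this
    · right
      refine eq_top_iff.2 fun w _ => ?_
      obtain ⟨x, rfl⟩ := LieSubmodule.Quotient.surjective_mk' S' w
      refine (hTmem x).1 ?_
      rw [hmax T hST hTP h]
      exact x.2

omit [LieAlgebra ℂ 𝔤] [LieModule ℂ 𝔤 V] in
theorem lieSpan_generator {v : V} {P : LieSubmodule ℂ 𝔤 V} (hP : LieSubmodule.lieSpan ℂ 𝔤 {v} = P)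
    (hv : v ∈ P) : LieSubmodule.lieSpan ℂ 𝔤 {(⟨v, hv⟩ : P)} = ⊤ := by
  have h : P ≤ (LieSubmodule.lieSpan ℂ 𝔤 {(⟨v, hv⟩ : P)}).map P.incl := by
    refine hP.ge.trans (LieSubmodule.lieSpan_le.2 fun x hx => ?_)
    rw [Set.mem_singleton_iff.1 hx]
    exact LieSubmodule.mem_map_of_mem (f := P.incl)
      (LieSubmodule.subset_lieSpan (Set.mem_singleton (⟨v, hv⟩ : P)))
  refine eq_top_iff.2 fun x _ => ?_
  obtain ⟨y, hy, hyx⟩ := (LieSubmodule.mem_map _).1 (h x.2)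
  rwa [← Subtype.ext hyx]

end Submodules

/-! ### The structure of the `𝔟`-module generated by `x(b, 0)` -/

section Structure

variable {n : ℕ} {a₁ a₂ : ℂ} (hn : 2 < n) (h₁ : ∀ k : ℤ, a₁ ≠ k) (h₂ : ∀ k : ℤ, a₂ ≠ k)

theorem xVec_mem_hwSpace (hn : 2 < n) (b : ℤ) (h : 0 < n) :
    xVec n h a₁ a₂ h₁ h₂ b ∈ hwSpace n a₁ a₂ b :=
  ⟨actY_xVec h₁ h₂ hn b h, actH_xVec h₁ h₂ hn b h⟩

include hn

theorem eq_hwSpace_of_mem {b : ℤ} {h : 0 < n} {T : LieSubmodule ℂ (bAlg n) (modN n a₁ a₂)}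
    (hT : T ≤ hwSpace n a₁ a₂ b) (hx : xVec n h a₁ a₂ h₁ h₂ b ∈ T) : T = hwSpace n a₁ a₂ b := by
  refine le_antisymm hT ?_
  rw [← bGen_eq h₁ h₂ hn b h, LieSubmodule.lieSpan_le]
  rintro _ rfl
  exact hx

/-- A submodule of `U(𝔟) x(b, 0)` not contained in the image of `X` contains `x(b, 0)` up to the
image of `X`: modulo this image, `x(b, 0)` is the only vector killed by the raising operators. -/
theorem exists_xVec_add_actX {b : ℤ} {h : 0 < n} {T : LieSubmodule ℂ (bAlg n) (modN n a₁ a₂)}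
    (hT : T ≤ hwSpace n a₁ a₂ b) {v : modN n a₁ a₂} (hv : v ∈ T)
    (hvX : v ∉ LinearMap.range (actX n a₁ a₂)) :
    ∃ u, xVec n h a₁ a₂ h₁ h₂ b + actX n a₁ a₂ u ∈ T := by
  set Z : Submodule ℂ (modN n a₁ a₂) := T.toSubmodule ⊔ LinearMap.range (actX n a₁ a₂) with hZ
  have hZlie : ∀ (u : bAlg n), ∀ w ∈ Z, ⁅u, w⁆ ∈ Z := by
    intro u w hw
    obtain ⟨t, ht, _, ⟨y, rfl⟩, rfl⟩ := Submodule.mem_sup.1 hw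
    rw [lie_add, lie_actX]
    exact add_mem (Submodule.mem_sup_left (T.lie_mem ht)) (Submodule.mem_sup_right ⟨_, rfl⟩)
  set T' : Submodule ℂ (MonomialSpace (Fin n ⊕ Fin n)) :=
    supportedOn (degLT (⟨0, h⟩ : Fin n) a₁ a₂ 1) ⊓
      Z.map (modN n a₁ a₂).toSubmodule.subtype with hT'
  obtain ⟨r, hr⟩ := exists_mem_degFil (hn := hn) v
  obtain ⟨g, hg, u, -, hgu⟩ := exists_add_actX h₂ (degFil_mono r.le_succ hr)
  have hgZ : g ∈ Z := by
    rw [eq_sub_of_add_eq hgu.symm]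
    exact sub_mem (Submodule.mem_sup_left hv) (Submodule.mem_sup_right ⟨u, rfl⟩)
  have hg0 : (g : MonomialSpace (Fin n ⊕ Fin n)) ≠ 0 := by
    intro h0
    have : g = 0 := Subtype.ext h0
    exact hvX ⟨u, by rw [hgu, this, zero_add]⟩
  obtain ⟨_, ⟨hf1, (f : modN n a₁ a₂), hf2, rfl⟩, hf0, hfG⟩ :=
    exists_mem_tuples (T := T') rfl (last_succ hn) (first_ne_last hn) h₁ h₂ inf_le_left (by
      rintro i j hij _ ⟨hf1, (f : modN n a₁ a₂), hf2, rfl⟩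
      exact ⟨opE_mem_degLT_one rfl hij hf1, _, hZlie (bE hij.ne) f hf2, coe_bE hij.ne f⟩)
    ⟨hg, Submodule.mem_map_of_mem hgZ⟩ hg0
  obtain ⟨t, ht, _, ⟨y, rfl⟩, hty⟩ := Submodule.mem_sup.1 hf2
  -- the weight of `H` singles out the multiples of `x(b, 0)`
  have hH : actH n a₁ a₂ f = wtH n a₁ a₂ b • f := by
    have h1 : actH n a₁ a₂ f - wtH n a₁ a₂ b • f =
        actX n a₁ a₂ (actH n a₁ a₂ y - (2 : ℂ) • y - wtH n a₁ a₂ b • y) := by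
      rw [← hty, map_add, (hT ht).2, actH_actX, map_sub, map_sub, map_smul, map_smul]
      module
    have h2 : actH n a₁ a₂ f - wtH n a₁ a₂ b • f ∈ degFil hn a₁ a₂ 1 :=
      sub_mem (actH_mem_degFil hf1) (Submodule.smul_mem _ _ hf1)
    rw [h1] at h2
    rw [← sub_eq_zero, h1, eq_zero_of_actX_mem h₂ h2, map_zero]
  obtain ⟨s, hs⟩ := eq_smul_xVec_of_actH h₁ h₂ hn (h := h) hfG hH
  have hs0 : s ≠ 0 := by
    rintro rfl
    rw [zero_smul] at hs
    exact hf0 (congrArg Subtype.val hs)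
  refine ⟨-(s⁻¹ • y), ?_⟩
  have h3 : xVec n h a₁ a₂ h₁ h₂ b = s⁻¹ • f := by
    rw [hs, smul_smul, inv_mul_cancel₀ hs0, one_smul]
  rw [h3, ← hty, map_neg, map_smul, smul_add, add_neg_cancel_right]
  exact T.smul_mem _ ht

include h₂ in
/-- A vector of the form `X v` killed by `Y` would be divisible by arbitrarily high powers of `X`,
which increase the degree in the first variable. -/
theorem actX_eq_zero_of_mem {b : ℤ} (hb : ∀ i : ℕ, 0 < i → wtH n a₁ a₂ b + i + 1 ≠ 0)
    {v : modN n a₁ a₂} (hv : actX n a₁ a₂ v ∈ hwSpace n a₁ a₂ b) : actX n a₁ a₂ v = 0 := by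
  obtain ⟨s, hs⟩ := exists_mem_degFil (hn := hn) (actX n a₁ a₂ v)
  obtain ⟨w, hw, -, -⟩ := exists_eq_pow_X (X := actX n a₁ a₂) (Y := actY n a₁ a₂)
    (H := actH n a₁ a₂) actH_actX actH_actY actY_actX
    (fun v hv => actX_injective (hn := hn) h₂ hv) hv.2 hv.1 s (fun i hi _ => hb i hi)
  rw [hw, pow_succ, Module.End.mul_apply] at hs
  have := eq_zero_of_mem_degFil_zero (mem_degFil_of_actX_pow (r := 0) h₂ s (by rwa [zero_add]))
  rw [hw, pow_succ, Module.End.mul_apply, this, map_zero]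

include h₂ in
theorem exists_pow_actX_of_mem {b : ℤ} {m : ℕ} (hb : wtH n a₁ a₂ b = -((m : ℂ) + 2))
    {v : modN n a₁ a₂} (hv : actX n a₁ a₂ v ∈ hwSpace n a₁ a₂ b) :
    ∃ w ∈ hwSpace n a₁ a₂ (b + (m + 1)), actX n a₁ a₂ v = (actX n a₁ a₂ ^ (m + 1)) w := by
  obtain ⟨w, hw, hH, hY⟩ := exists_eq_pow_X (X := actX n a₁ a₂) (Y := actY n a₁ a₂)
    (H := actH n a₁ a₂) actH_actX actH_actY actY_actX
    (fun v hv => actX_injective (hn := hn) h₂ hv) hv.2 hv.1 m (fun i hi him h0 => by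
      rw [hb] at h0
      have : (i : ℂ) = ((m + 1 : ℕ) : ℂ) := by push_cast; linear_combination h0
      have := Nat.cast_injective this
      omega)
  refine ⟨w, ⟨?_, ?_⟩, hw⟩
  · refine actX_injective (hn := hn) h₂ ?_
    rw [actY_actX, hH] at hY
    rw [eq_sub_of_add_eq hY, hb]
    module
  · rw [hH]
    congr 1
    unfold wtH
    push_cast
    ring

end Structure

section StructureTheorems

variable {n : ℕ} {a₁ a₂ : ℂ} (hn : 2 < n) (h₁ : ∀ k : ℤ, a₁ ≠ k) (h₂ : ∀ k : ℤ, a₂ ≠ k)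

include hn

theorem xVec_notMem_range (b : ℤ) (h : 0 < n) :
    xVec n h a₁ a₂ h₁ h₂ b ∉ LinearMap.range (actX n a₁ a₂) := by
  rintro ⟨u, hu⟩
  have h0 : actX n a₁ a₂ u ∈ degFil hn a₁ a₂ 1 := hu ▸ xVec_mem_degFil h₁ h₂ hn b h
  refine xVec_ne_zero h₁ h₂ b h ?_
  rw [← hu, eq_zero_of_actX_mem h₂ h0, map_zero]

include h₁ h₂ in
/-- If the weight of `x(b, 0)` is not an integer below `-1`, then the only highest weight vector of
`𝔞` of this weight in the image of `X` is zero, so `U(𝔟) x(b, 0)` is simple. -/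
theorem eq_hwSpace_of_ne_bot {b : ℤ} (hb : ∀ i : ℕ, 0 < i → wtH n a₁ a₂ b + i + 1 ≠ 0)
    {T : LieSubmodule ℂ (bAlg n) (modN n a₁ a₂)} (hT : T ≤ hwSpace n a₁ a₂ b) (hT0 : T ≠ ⊥) :
    T = hwSpace n a₁ a₂ b := by
  have h : 0 < n := Nat.zero_lt_of_lt hn
  obtain ⟨v, hv, hvX⟩ : ∃ v ∈ T, v ∉ LinearMap.range (actX n a₁ a₂) := by
    by_contra! hall
    refine hT0 ((LieSubmodule.eq_bot_iff T).2 fun v hv => ?_)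
    obtain ⟨u, rfl⟩ := hall v hv
    exact actX_eq_zero_of_mem hn h₂ hb (hT hv)
  obtain ⟨u, hu⟩ := exists_xVec_add_actX hn h₁ h₂ (h := h) hT hv hvX
  have hX : actX n a₁ a₂ u ∈ hwSpace n a₁ a₂ b := by
    simpa using sub_mem (hT hu) (xVec_mem_hwSpace h₁ h₂ hn b h)
  rw [actX_eq_zero_of_mem hn h₂ hb hX, add_zero] at hu
  exact eq_hwSpace_of_mem hn h₁ h₂ hT hu

theorem isIrreducible_bGen {b : ℤ} (hb : ∀ i : ℕ, 0 < i → wtH n a₁ a₂ b + i + 1 ≠ 0)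
    (h : 0 < n) : LieModule.IsIrreducible ℂ (bAlg n) (bGen n (xVec n h a₁ a₂ h₁ h₂ b)) := by
  rw [bGen_eq h₁ h₂ hn b h]
  refine isIrreducible_of_le (fun h0 => xVec_ne_zero h₁ h₂ b h ?_)
    fun T hT hT0 => eq_hwSpace_of_ne_bot hn h₁ h₂ hb hT hT0
  exact (LieSubmodule.eq_bot_iff _).1 h0 _ (xVec_mem_hwSpace h₁ h₂ hn b h)

omit hn in
/-- The factor by which `Y` takes `X ^ (m + 1) w` to a multiple of `X ^ m w` vanishes. -/
theorem pow_actX_mem_hwSpace {b : ℤ} {m : ℕ} (hb : wtH n a₁ a₂ b = -((m : ℂ) + 2))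
    {w : modN n a₁ a₂} (hw : w ∈ hwSpace n a₁ a₂ (b + (m + 1))) :
    (actX n a₁ a₂ ^ (m + 1)) w ∈ hwSpace n a₁ a₂ b := by
  have hwt : wtH n a₁ a₂ (b + (m + 1)) = m := by
    have : wtH n a₁ a₂ (b + (m + 1)) = wtH n a₁ a₂ b + 2 * (m + 1) := by
      unfold wtH
      push_cast
      ring
    rw [this, hb]
    ring
  refine ⟨?_, ?_⟩
  · rw [Y_pow_X actH_actX actY_actX hw.2 hw.1, hwt, sub_self, mul_zero, zero_smul]
  · rw [H_pow_X actH_actX hw.2, hwt, hb]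
    congr 1
    push_cast
    ring

/-- If the weight of `x(b, 0)` is an integer `-(m + 2)` below `-1`, then `U(𝔟) x(b, 0)` has a simple
submodule, the image of `U(𝔟) x(b + m + 1, 0)` under a power of `X`, with simple quotient. -/
theorem hasLengthTwo_bGen {b : ℤ} {m : ℕ} (hb : wtH n a₁ a₂ b = -((m : ℂ) + 2)) (h : 0 < n) :
    HasLengthTwo (bAlg n) (bGen n (xVec n h a₁ a₂ h₁ h₂ b)) := by
  rw [bGen_eq h₁ h₂ hn b h]
  have hb' : ∀ i : ℕ, 0 < i → wtH n a₁ a₂ (b + (m + 1)) + i + 1 ≠ 0 := by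
    intro i _ h0
    have : wtH n a₁ a₂ (b + (m + 1)) = wtH n a₁ a₂ b + 2 * (m + 1) := by
      unfold wtH
      push_cast
      ring
    rw [this, hb] at h0
    have : ((m + i + 1 : ℕ) : ℂ) = 0 := by push_cast; linear_combination h0
    exact absurd (Nat.cast_eq_zero.1 this) (by omega)
  -- the intersection of `U(𝔟) x(b, 0)` with the image of `X`
  let S : LieSubmodule ℂ (bAlg n) (modN n a₁ a₂) :=
    { (hwSpace n a₁ a₂ b).toSubmodule ⊓ LinearMap.range (actX n a₁ a₂) with
      lie_mem := by
        rintro u _ ⟨hv, ⟨w, rfl⟩⟩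
        refine ⟨(hwSpace n a₁ a₂ b).lie_mem hv, ⟨⁅u, w⁆, ?_⟩⟩
        rw [lie_actX] }
  have hS : ∀ v, v ∈ S ↔ ∃ w ∈ hwSpace n a₁ a₂ (b + (m + 1)), v = (actX n a₁ a₂ ^ (m + 1)) w := by
    intro v
    constructor
    · rintro ⟨hv, ⟨w, rfl⟩⟩
      exact exists_pow_actX_of_mem hn h₂ hb hv
    · rintro ⟨w, hw, rfl⟩
      refine ⟨pow_actX_mem_hwSpace hb hw, ⟨(actX n a₁ a₂ ^ m) w, ?_⟩⟩
      rw [pow_succ', Module.End.mul_apply]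
  have hSP : S ≤ hwSpace n a₁ a₂ b := fun v hv => hv.1
  refine hasLengthTwo_of_le hSP ?_ ?_ ?_ ?_
  · intro h0
    have h1 := (LieSubmodule.eq_bot_iff S).1 h0 _ ((hS _).2
      ⟨_, xVec_mem_hwSpace h₁ h₂ hn (b + (m + 1)) h, rfl⟩)
    exact xVec_ne_zero h₁ h₂ _ h (actX_pow_injective (hn := hn) h₂ _ h1)
  · intro h0
    exact xVec_notMem_range hn h₁ h₂ b h (h0.symm ▸ xVec_mem_hwSpace h₁ h₂ hn b h :
      xVec n h a₁ a₂ h₁ h₂ b ∈ S).2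
  · intro T hT hT0
    let T' : LieSubmodule ℂ (bAlg n) (modN n a₁ a₂) :=
      { (hwSpace n a₁ a₂ (b + (m + 1))).toSubmodule ⊓
          T.toSubmodule.comap (actX n a₁ a₂ ^ (m + 1)) with
        lie_mem := by
          rintro u w ⟨hw, hw'⟩
          refine ⟨(hwSpace n a₁ a₂ (b + (m + 1))).lie_mem hw, ?_⟩
          change (actX n a₁ a₂ ^ (m + 1)) ⁅u, w⁆ ∈ T
          rw [← lie_actX_pow]
          exact T.lie_mem hw' }
    have hT' : T' = hwSpace n a₁ a₂ (b + (m + 1)) := by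
      refine eq_hwSpace_of_ne_bot hn h₁ h₂ hb' (fun w hw => hw.1) fun h0 => hT0 ?_
      refine (LieSubmodule.eq_bot_iff T).2 fun v hv => ?_
      obtain ⟨w, hw, rfl⟩ := (hS v).1 (hT hv)
      rw [(LieSubmodule.eq_bot_iff T').1 h0 w ⟨hw, hv⟩, map_zero]
    refine le_antisymm hT fun v hv => ?_
    obtain ⟨w, hw, rfl⟩ := (hS v).1 hv
    rw [← hT'] at hw
    exact hw.2
  · intro T hST hT hne
    obtain ⟨v, hv, hvX⟩ : ∃ v ∈ T, v ∉ LinearMap.range (actX n a₁ a₂) := by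
      by_contra! hall
      exact hne (le_antisymm (fun v hv => ⟨hT hv, hall v hv⟩) hST)
    obtain ⟨u, hu⟩ := exists_xVec_add_actX hn h₁ h₂ (h := h) hT hv hvX
    have hX : actX n a₁ a₂ u ∈ hwSpace n a₁ a₂ b := by
      simpa using sub_mem (hT hu) (xVec_mem_hwSpace h₁ h₂ hn b h)
    have hXT : actX n a₁ a₂ u ∈ T := hST ⟨hX, ⟨u, rfl⟩⟩
    exact eq_hwSpace_of_mem hn h₁ h₂ (h := h) hT (by simpa using sub_mem hu hXT)

omit hn in
theorem bRaise_xVec (b : ℤ) (h : 0 < n) (i : Fin (n - 1)) :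
    ⁅bRaise n i, xVec n h a₁ a₂ h₁ h₂ b⁆ = 0 := by
  have hi := i.2
  exact bE_xVec h₁ h₂ (i := (⟨i, by omega⟩ : Fin n)) (j := (⟨i + 1, by omega⟩ : Fin n))
    (Fin.lt_def.2 (Nat.lt_succ_self _)) b h

theorem bCoroot_xVec (b : ℤ) (h : 0 < n) (i : Fin (n - 1)) :
    ⁅bCoroot n i, xVec n h a₁ a₂ h₁ h₂ b⁆ =
      bWeight n (a₂ - b) (-1 - a₁ - b) i • xVec n h a₁ a₂ h₁ h₂ b := by
  have hi := i.2
  have h1 := bD_xVec h₁ h₂ (⟨i, by omega⟩ : Fin n) ⟨i + 1, by omega⟩ b h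
  refine h1.trans ?_
  congr 1
  by_cases h0 : (i : ℕ) = 0
  · have e1 : ¬ (0 + 1 = n) := by omega
    have e2 : ¬ (0 + 1 + 1 = n) := by omega
    simp [tuple, bWeight, h0, e1, e2]
  · by_cases h2 : (i : ℕ) = n - 2
    · have e1 : ¬ ((i : ℕ) + 1 = n) := by omega
      have e2 : (i : ℕ) + 1 + 1 = n := by omega
      have e3 : ¬ (n - 2 = 0) := by omega
      simp only [tuple, bWeight, Sum.elim_inl, Sum.elim_inr, h0, e1, e2, if_true, if_false]
      simp [h2]
      ring
    · have e1 : ¬ ((i : ℕ) + 1 = n) := by omega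
      have e2 : ¬ ((i : ℕ) + 1 + 1 = n) := by omega
      simp [tuple, bWeight, h0, e1, e2, h2]

theorem isIndecomposable_bGen (b : ℤ) (h : 0 < n) :
    IsIndecomposable (bAlg n) (bGen n (xVec n h a₁ a₂ h₁ h₂ b)) := by
  obtain ⟨h₀, hg⟩ := isGradedBy_bAlg h
  refine isIndecomposable_of_isGradedBy (μ := bWeight n (a₂ - b) (-1 - a₁ - b)) hg
    (m := ⟨xVec n h a₁ a₂ h₁ h₂ b, LieSubmodule.subset_lieSpan (Set.mem_singleton _)⟩)
    (fun h0 => xVec_ne_zero h₁ h₂ b h (congrArg Subtype.val h0)) (lieSpan_generator rfl _)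
    (fun i => Subtype.ext (bRaise_xVec h₁ h₂ b h i))
    (fun i => Subtype.ext (bCoroot_xVec hn h₁ h₂ b h i))

theorem nonempty_bGen_equiv {b : ℤ} (hb : ∀ i : ℕ, 0 < i → wtH n a₁ a₂ b + i + 1 ≠ 0)
    (h : 0 < n) : Nonempty (bGen n (xVec n h a₁ a₂ h₁ h₂ b) ≃ₗ⁅ℂ, bAlg n⁆
      bSimple n (bWeight n (a₂ - b) (-1 - a₁ - b))) := by
  obtain ⟨h₀, hg⟩ := isGradedBy_bAlg h
  exact nonempty_equiv_simpleHighestWeightModule hg (isIrreducible_bGen hn h₁ h₂ hb h)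
    (m := ⟨xVec n h a₁ a₂ h₁ h₂ b, LieSubmodule.subset_lieSpan (Set.mem_singleton _)⟩)
    (fun h0 => xVec_ne_zero h₁ h₂ b h (congrArg Subtype.val h0))
    (fun i => Subtype.ext (bRaise_xVec h₁ h₂ b h i))
    (fun i => Subtype.ext (bCoroot_xVec hn h₁ h₂ b h i))

end StructureTheorems

/-! ### Highest weight modules of `𝔞` -/

section SlTwoModules

variable {n : ℕ}

variable (n) in
/-- The lowering element of `𝔞`, which is `X`. -/
def aLower : aAlg n := ⟨elemX n, LieSubalgebra.subset_lieSpan (by simp)⟩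

theorem lie_aRaise_aLower : ⁅aRaise n, aLower n⁆ = aCoroot n := Subtype.ext lie_Y_X

theorem lie_aCoroot_aLower : ⁅aCoroot n, aLower n⁆ = (-2 : ℂ) • aLower n := Subtype.ext lie_H_X

variable {M : Type*} [AddCommGroup M] [Module ℂ M] [LieRingModule (aAlg n) M]
  [LieModule ℂ (aAlg n) M]

theorem lie_aCoroot_lie_aLower (v : M) : ⁅aCoroot n, ⁅aLower n, v⁆⁆ =
    ⁅aLower n, ⁅aCoroot n, v⁆⁆ - (2 : ℂ) • ⁅aLower n, v⁆ := by
  rw [leibniz_lie (aCoroot n), lie_aCoroot_aLower, smul_lie, neg_smul]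
  abel

omit [Module ℂ M] [LieModule ℂ (aAlg n) M] in
theorem lie_aRaise_lie_aLower (v : M) : ⁅aRaise n, ⁅aLower n, v⁆⁆ =
    ⁅aLower n, ⁅aRaise n, v⁆⁆ + ⁅aCoroot n, v⁆ := by
  rw [leibniz_lie (aRaise n), lie_aRaise_aLower, add_comm]

/-- The powers of the lowering operator span a highest weight module of `𝔞`. -/
theorem lieSpan_eq_span_pow {m : M} {k : ℂ} (hY : ⁅aRaise n, m⁆ = 0)
    (hH : ⁅aCoroot n, m⁆ = k • m) :
    (LieSubmodule.lieSpan ℂ (aAlg n) {m}).toSubmodule =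
      Submodule.span ℂ
        (Set.range fun i : ℕ => (LieModule.toEnd ℂ (aAlg n) M (aLower n) ^ i) m) := by
  set X := LieModule.toEnd ℂ (aAlg n) M (aLower n) with hX
  set Y := LieModule.toEnd ℂ (aAlg n) M (aRaise n) with hY'
  set H := LieModule.toEnd ℂ (aAlg n) M (aCoroot n) with hH'
  have hHX : ∀ v, H (X v) = X (H v) - (2 : ℂ) • X v := lie_aCoroot_lie_aLower
  have hYX : ∀ v, Y (X v) = X (Y v) + H v := lie_aRaise_lie_aLower
  set W := Submodule.span ℂ (Set.range fun i : ℕ => (X ^ i) m) with hW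
  have hpow : ∀ i : ℕ, (X ^ i) m ∈ W := fun i => Submodule.subset_span ⟨i, rfl⟩
  have hstab : ∀ T : Module.End ℂ M, (∀ i : ℕ, T ((X ^ i) m) ∈ W) → ∀ w ∈ W, T w ∈ W := by
    intro T hT w hw
    have : W ≤ W.comap T := by
      refine Submodule.span_le.2 ?_
      rintro _ ⟨i, rfl⟩
      exact hT i
    exact this hw
  have hXW := hstab X fun i => by
    have := hpow (i + 1)
    rwa [pow_succ', Module.End.mul_apply] at this
  have hHW := hstab H fun i => by
    rw [H_pow_X hHX hH]
    exact W.smul_mem _ (hpow i)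
  have hYW := hstab Y fun i => by
    rcases i with _ | i
    · rw [pow_zero, Module.End.one_apply]
      have h0 : Y m = 0 := hY
      rw [h0]
      exact zero_mem W
    · rw [Y_pow_X hHX hYX hH hY]
      exact W.smul_mem _ (hpow i)
  let S : LieSubmodule ℂ (aAlg n) M :=
    { W with
      lie_mem := by
        intro u w hw
        obtain ⟨α, β, γ, hu⟩ := exists_eq_of_mem_aAlg u.2
        have hu' : u = α • aLower n + β • aCoroot n + γ • aRaise n := Subtype.ext hu
        change ⁅u, w⁆ ∈ W
        rw [hu', add_lie, add_lie, smul_lie, smul_lie, smul_lie]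
        exact add_mem (add_mem (W.smul_mem _ (hXW w hw)) (W.smul_mem _ (hHW w hw)))
          (W.smul_mem _ (hYW w hw)) }
  refine le_antisymm ?_ (Submodule.span_le.2 ?_)
  · have : LieSubmodule.lieSpan ℂ (aAlg n) {m} ≤ S := by
      rw [LieSubmodule.lieSpan_le]
      rintro _ rfl
      exact hpow 0
    exact this
  · rintro _ ⟨i, rfl⟩
    change (X ^ i) m ∈ LieSubmodule.lieSpan ℂ (aAlg n) {m}
    induction i with
    | zero => exact LieSubmodule.subset_lieSpan rfl
    | succ i ih =>
      rw [pow_succ', Module.End.mul_apply]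
      exact (LieSubmodule.lieSpan ℂ (aAlg n) {m}).lie_mem ih

end SlTwoModules

section SlTwoHighestWeight

variable {n : ℕ} {M : Type*} [AddCommGroup M] [Module ℂ M] [LieRingModule (aAlg n) M]
  [LieModule ℂ (aAlg n) M]

variable (n M) in
/-- The action of the lowering element of `𝔞` on an `𝔞`-module. -/
noncomputable def lowerEnd : Module.End ℂ M := LieModule.toEnd ℂ (aAlg n) M (aLower n)

theorem aCoroot_lowerEnd_pow {m : M} {k : ℂ} (hH : ⁅aCoroot n, m⁆ = k • m) (i : ℕ) :
    ⁅aCoroot n, (lowerEnd n M ^ i) m⁆ = (k - 2 * i) • (lowerEnd n M ^ i) m :=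
  H_pow_X (X := lowerEnd n M) (H := LieModule.toEnd ℂ (aAlg n) M (aCoroot n))
    lie_aCoroot_lie_aLower hH i

theorem aRaise_lowerEnd_pow {m : M} {k : ℂ} (hY : ⁅aRaise n, m⁆ = 0)
    (hH : ⁅aCoroot n, m⁆ = k • m) (i : ℕ) :
    ⁅aRaise n, (lowerEnd n M ^ (i + 1)) m⁆ = ((i + 1) * (k - i)) • (lowerEnd n M ^ i) m :=
  Y_pow_X (X := lowerEnd n M) (Y := LieModule.toEnd ℂ (aAlg n) M (aRaise n))
    (H := LieModule.toEnd ℂ (aAlg n) M (aCoroot n))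
    lie_aCoroot_lie_aLower lie_aRaise_lie_aLower hH hY i

theorem exists_eq_sum_lowerEnd_pow {m : M} {k : ℂ} (hY : ⁅aRaise n, m⁆ = 0)
    (hH : ⁅aCoroot n, m⁆ = k • m) (hm : LieSubmodule.lieSpan ℂ (aAlg n) {m} = ⊤) (v : M) :
    ∃ c : ℕ →₀ ℂ, (c.sum fun i a => a • (lowerEnd n M ^ i) m) = v := by
  have hv : v ∈ (LieSubmodule.lieSpan ℂ (aAlg n) {m}).toSubmodule := hm ▸ LieSubmodule.mem_top v
  rw [lieSpan_eq_span_pow hY hH] at hv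
  exact Finsupp.mem_span_range_iff_exists_finsupp.1 hv

/-- Applying `Y` repeatedly to a nonzero vector of a highest weight module leads to the highest
weight vector if the factors `(i + 1) (k - i)` do not vanish. -/
theorem mem_of_sum_lowerEnd_pow_mem {m : M} {k : ℂ} (hY : ⁅aRaise n, m⁆ = 0)
    (hH : ⁅aCoroot n, m⁆ = k • m) (hk : ∀ i : ℕ, k ≠ i) {T : LieSubmodule ℂ (aAlg n) M} (N : ℕ) :
    ∀ c : ℕ → ℂ, (∃ i < N, c i ≠ 0) →
      ∑ i ∈ Finset.range N, c i • (lowerEnd n M ^ i) m ∈ T → m ∈ T := by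
  induction N with
  | zero =>
    rintro c ⟨i, hi, -⟩
    omega
  | succ N ih =>
    rintro c ⟨i, hi, hci⟩ hT
    by_cases h0 : ∃ i < N, c (i + 1) ≠ 0
    · obtain ⟨j, hj, hcj⟩ := h0
      refine ih (fun i => c (i + 1) * ((i + 1) * (k - i))) ⟨j, hj, mul_ne_zero hcj (mul_ne_zero
        (Nat.cast_add_one_ne_zero j) (sub_ne_zero.2 (hk j)))⟩ ?_
      have h1 := T.lie_mem (x := aRaise n) hT
      rw [Finset.sum_range_succ', lie_add, lie_sum, pow_zero, Module.End.one_apply, lie_smul, hY,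
        smul_zero, add_zero] at h1
      simp only [lie_smul, aRaise_lowerEnd_pow hY hH, smul_smul] at h1
      exact h1
    · push Not at h0
      have hc0 : c 0 ≠ 0 := by
        rcases i with _ | i
        · exact hci
        · exact absurd (h0 i (by omega)) hci
      rw [Finset.sum_range_succ', Finset.sum_eq_zero fun i hi => by
        rw [h0 i (Finset.mem_range.1 hi), zero_smul], zero_add, pow_zero,
        Module.End.one_apply] at hT
      simpa [smul_smul, inv_mul_cancel₀ hc0] using T.smul_mem (c 0)⁻¹ hT

theorem isIrreducible_of_lieSpan {m : M} {k : ℂ} (hm0 : m ≠ 0) (hY : ⁅aRaise n, m⁆ = 0)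
    (hH : ⁅aCoroot n, m⁆ = k • m) (hm : LieSubmodule.lieSpan ℂ (aAlg n) {m} = ⊤)
    (hk : ∀ i : ℕ, k ≠ i) : LieModule.IsIrreducible ℂ (aAlg n) M where
  exists_pair_ne := ⟨⊥, ⊤, fun h0 => hm0
    ((LieSubmodule.mem_bot m).1 (h0.symm ▸ LieSubmodule.mem_top m))⟩
  eq_bot_or_eq_top T := by
    refine or_iff_not_imp_left.2 fun hT => ?_
    obtain ⟨v, hv, hv0⟩ : ∃ v ∈ T, v ≠ 0 := by
      by_contra! h0
      exact hT ((LieSubmodule.eq_bot_iff T).2 h0)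
    obtain ⟨c, rfl⟩ := exists_eq_sum_lowerEnd_pow hY hH hm v
    obtain ⟨N, hN⟩ := Finset.exists_nat_subset_range c.support
    rw [Finsupp.sum_of_support_subset c hN _ (by simp)] at hv
    have hc : ∃ i < N, c i ≠ 0 := by
      by_contra! h0
      refine hv0 ?_
      rw [Finsupp.sum_of_support_subset c hN _ (by simp)]
      exact Finset.sum_eq_zero fun i hi => by rw [h0 i (Finset.mem_range.1 hi), zero_smul]
    have := mem_of_sum_lowerEnd_pow_mem hY hH hk N c hc hv
    rw [eq_top_iff, ← hm, LieSubmodule.lieSpan_le]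
    rintro _ rfl
    exact this

theorem linearIndependent_lowerEnd_pow {m : M} {k : ℂ} (hH : ⁅aCoroot n, m⁆ = k • m)
    (hX : ∀ i, (lowerEnd n M ^ i) m ≠ 0) :
    LinearIndependent ℂ fun i : ℕ => (lowerEnd n M ^ i) m := by
  refine Module.End.eigenvectors_linearIndependent' (LieModule.toEnd ℂ (aAlg n) M (aCoroot n))
    (fun i : ℕ => k - 2 * i) (fun i j hij => ?_) _ fun i =>
      Module.End.hasEigenvector_iff.2 ⟨Module.End.mem_eigenspace_iff.2 ?_, hX i⟩
  · have : (i : ℂ) = j := by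
      have h : k - 2 * (i : ℂ) = k - 2 * j := hij
      linear_combination -h / 2
    exact_mod_cast this
  · exact aCoroot_lowerEnd_pow hH i

/-- A highest weight module on which the lowering operator is injective is a Verma module. -/
theorem nonempty_equiv_aVerma {m : M} {k : ℂ} (hY : ⁅aRaise n, m⁆ = 0)
    (hH : ⁅aCoroot n, m⁆ = k • m) (hm : LieSubmodule.lieSpan ℂ (aAlg n) {m} = ⊤)
    (hX : ∀ i, (lowerEnd n M ^ i) m ≠ 0) : Nonempty (M ≃ₗ⁅ℂ, aAlg n⁆ aVerma n k) := by
  obtain ⟨f, hf⟩ := exists_vermaLift (e := fun _ : Unit => aRaise n)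
    (h := fun _ : Unit => aCoroot n) (μ := fun _ => k) (m := m) (fun _ => hY) (fun _ => hH)
  refine ⟨(LieModuleEquiv.ofBijective' f
    ⟨(injective_iff_map_eq_zero f).2 fun v hv => ?_, range_eq_top_of_lieSpan f hm ⟨_, hf⟩⟩).symm⟩
  have hpow : ∀ i : ℕ, f ((lowerEnd n _ ^ i) (vermaVec _ _ _)) = (lowerEnd n M ^ i) m := by
    intro i
    induction i with
    | zero => exact hf
    | succ i ih =>
      rw [pow_succ', pow_succ', Module.End.mul_apply, Module.End.mul_apply, ← ih]
      exact f.map_lie _ _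
  obtain ⟨c, rfl⟩ := exists_eq_sum_lowerEnd_pow (raise_vermaVec ()) (coroot_vermaVec ())
    lieSpan_vermaVec v
  have h0 : c = 0 := by
    refine linearIndependent_iff.1 (linearIndependent_lowerEnd_pow hH hX) c ?_
    rw [Finsupp.linearCombination_apply, ← hv, Finsupp.sum, Finsupp.sum, map_sum]
    exact Finset.sum_congr rfl fun i _ => by rw [map_smul, hpow]
  rw [h0, Finsupp.sum_zero_index]

end SlTwoHighestWeight

/-! ### The `𝔞`-module generated by `x(b, 0)` -/

section SlTwoGenerated

variable {n : ℕ} {a₁ a₂ : ℂ} (hn : 2 < n) (h₁ : ∀ k : ℤ, a₁ ≠ k) (h₂ : ∀ k : ℤ, a₂ ≠ k)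

theorem coe_lowerEnd_pow {v : modN n a₁ a₂} (i : ℕ) (q : aGen n v) :
    (((lowerEnd n (aGen n v) ^ i) q : aGen n v) : modN n a₁ a₂) = (actX n a₁ a₂ ^ i) q := by
  induction i with
  | zero => rfl
  | succ i ih =>
    rw [pow_succ', pow_succ', Module.End.mul_apply, Module.End.mul_apply, ← ih]
    rfl

/-- The generator `x(b, 0)` of `U(𝔞) x(b, 0)`. -/
noncomputable def aGenVec (b : ℤ) (h : 0 < n) : aGen n (xVec n h a₁ a₂ h₁ h₂ b) :=
  ⟨xVec n h a₁ a₂ h₁ h₂ b, LieSubmodule.subset_lieSpan (Set.mem_singleton _)⟩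

theorem lieSpan_aGenVec (b : ℤ) (h : 0 < n) :
    LieSubmodule.lieSpan ℂ (aAlg n) {aGenVec h₁ h₂ b h} = ⊤ := lieSpan_generator rfl _

include hn

theorem aRaise_aGenVec (b : ℤ) (h : 0 < n) : ⁅aRaise n, aGenVec h₁ h₂ b h⁆ = 0 :=
  Subtype.ext (actY_xVec h₁ h₂ hn b h)

theorem aCoroot_aGenVec (b : ℤ) (h : 0 < n) :
    ⁅aCoroot n, aGenVec h₁ h₂ b h⁆ = wtH n a₁ a₂ b • aGenVec h₁ h₂ b h :=
  Subtype.ext (actH_xVec h₁ h₂ hn b h)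

theorem lowerEnd_pow_aGenVec_ne_zero (b : ℤ) (h : 0 < n) (i : ℕ) :
    (lowerEnd n _ ^ i) (aGenVec h₁ h₂ b h) ≠ 0 := fun h0 =>
  xVec_ne_zero h₁ h₂ b h (actX_pow_injective (hn := hn) h₂ i (by
    have h1 := coe_lowerEnd_pow i (aGenVec h₁ h₂ b h)
    rw [h0] at h1
    exact h1.symm))

theorem nonempty_aGen_equiv_aVerma (b : ℤ) (h : 0 < n) :
    Nonempty (aGen n (xVec n h a₁ a₂ h₁ h₂ b) ≃ₗ⁅ℂ, aAlg n⁆ aVerma n (wtH n a₁ a₂ b)) :=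
  nonempty_equiv_aVerma (aRaise_aGenVec hn h₁ h₂ b h) (aCoroot_aGenVec hn h₁ h₂ b h)
    (lieSpan_aGenVec h₁ h₂ b h) (lowerEnd_pow_aGenVec_ne_zero hn h₁ h₂ b h)

theorem nonempty_aGen_equiv_aSimple {b : ℤ} (hb : ∀ i : ℕ, wtH n a₁ a₂ b ≠ i) (h : 0 < n) :
    Nonempty (aGen n (xVec n h a₁ a₂ h₁ h₂ b) ≃ₗ⁅ℂ, aAlg n⁆ aSimple n (wtH n a₁ a₂ b)) := by
  have h0 : aGenVec h₁ h₂ b h ≠ 0 := lowerEnd_pow_aGenVec_ne_zero hn h₁ h₂ b h 0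
  exact nonempty_equiv_simpleHighestWeightModule isGradedBy_aAlg
    (isIrreducible_of_lieSpan h0 (aRaise_aGenVec hn h₁ h₂ b h) (aCoroot_aGenVec hn h₁ h₂ b h)
      (lieSpan_aGenVec h₁ h₂ b h) hb) h0
    (fun _ => aRaise_aGenVec hn h₁ h₂ b h) (fun _ => aCoroot_aGenVec hn h₁ h₂ b h)

/-- The basis of `U(𝔞) x(b, 0)` consisting of the vectors `X ^ i x(b, 0)`. -/
noncomputable def aGenBasis (b : ℤ) (h : 0 < n) :
    Module.Basis ℕ ℂ (aGen n (xVec n h a₁ a₂ h₁ h₂ b)) :=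
  Module.Basis.mk (linearIndependent_lowerEnd_pow (aCoroot_aGenVec hn h₁ h₂ b h)
    (lowerEnd_pow_aGenVec_ne_zero hn h₁ h₂ b h)) fun v _ =>
      Finsupp.mem_span_range_iff_exists_finsupp.2 (exists_eq_sum_lowerEnd_pow
        (aRaise_aGenVec hn h₁ h₂ b h) (aCoroot_aGenVec hn h₁ h₂ b h) (lieSpan_aGenVec h₁ h₂ b h) v)

theorem coe_aGenBasis (b : ℤ) (h : 0 < n) (i : ℕ) :
    (aGenBasis hn h₁ h₂ b h i : modN n a₁ a₂) =
      (actX n a₁ a₂ ^ i) (xVec n h a₁ a₂ h₁ h₂ b) := by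
  rw [aGenBasis, Module.Basis.mk_apply, coe_lowerEnd_pow]
  rfl

end SlTwoGenerated

/-! ### Homomorphisms and tensor products -/

section Pairings

variable {𝔤 P Q V : Type*} [LieRing 𝔤] [LieAlgebra ℂ 𝔤] [AddCommGroup P] [Module ℂ P]
  [LieRingModule 𝔤 P] [LieModule ℂ 𝔤 P] [AddCommGroup Q] [Module ℂ Q] [AddCommGroup V]
  [Module ℂ V] [LieRingModule 𝔤 V] [LieModule ℂ 𝔤 V]

omit [LieAlgebra ℂ 𝔤] [LieModule ℂ 𝔤 P] [LieModule ℂ 𝔤 V] in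
theorem eq_of_eq_generator {x : P} (hx : LieSubmodule.lieSpan ℂ 𝔤 {x} = ⊤) {f g : P →ₗ[ℂ] V}
    (hf : ∀ (u : 𝔤) p, f ⁅u, p⁆ = ⁅u, f p⁆) (hg : ∀ (u : 𝔤) p, g ⁅u, p⁆ = ⁅u, g p⁆)
    (hfg : f x = g x) (p : P) : f p = g p := by
  let E : LieSubmodule ℂ 𝔤 P :=
    { LinearMap.eqLocus f g with
      lie_mem := by
        intro u p (hp : f p = g p)
        change f ⁅u, p⁆ = g ⁅u, p⁆
        rw [hf, hg, hp] }
  have hE : (⊤ : LieSubmodule ℂ 𝔤 P) ≤ E := by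
    rw [← hx, LieSubmodule.lieSpan_le]
    rintro _ rfl
    exact hfg
  exact hE (LieSubmodule.mem_top p)

/-- A bilinear map is injective on the tensor product if, for the vectors of a basis of the second
factor, it is injective in the first factor with values in different eigenspaces of an operator. -/
theorem lift_injective_of_basis {κ : Type*} (ℬ : Module.Basis κ ℂ Q) (Φ : P →ₗ[ℂ] Q →ₗ[ℂ] V)
    {H : Module.End ℂ V} {μ : κ → ℂ} (hμ : Function.Injective μ)
    (hH : ∀ p i, H (Φ p (ℬ i)) = μ i • Φ p (ℬ i)) (h0 : ∀ p i, Φ p (ℬ i) = 0 → p = 0) :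
    Function.Injective (TensorProduct.lift Φ) := by
  classical
  rw [injective_iff_map_eq_zero]
  intro t ht
  obtain ⟨f, rfl⟩ := (TensorProduct.equivFinsuppOfBasisRight (M := P) ℬ).symm.surjective t
  rw [TensorProduct.equivFinsuppOfBasisRight_symm_apply, Finsupp.sum, map_sum] at ht
  simp only [TensorProduct.lift.tmul] at ht
  have h1 := (iSupIndep_iff_finsetSum_eq_zero_imp_eq_zero _).1
    (H.eigenspaces_iSupIndep.comp hμ) f.support (fun i => Φ (f i) (ℬ i))
    (fun i _ => Module.End.mem_eigenspace_iff.2 (hH (f i) i)) ht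
  have hf : f = 0 := by
    ext1 i
    by_contra hi
    exact hi (h0 _ _ (h1 i (Finsupp.mem_support_iff.2 hi)))
  rw [hf, map_zero]

end Pairings

/-! ### The homomorphisms from `U(𝔟) x(b, 0)` to `N_{a₁,a₂}` -/

section Correspondence

variable {n : ℕ} {a₁ a₂ : ℂ}

theorem tuple_weight (hn : 2 < n) (u v : ℂ) :
    tuple n u v (.inl (⟨0, Nat.zero_lt_of_lt hn⟩ : Fin n)) +
      tuple n u v (.inr (⟨0, Nat.zero_lt_of_lt hn⟩ : Fin n)) -
      tuple n u v (.inl (⟨1, by omega⟩ : Fin n)) - tuple n u v (.inr (⟨1, by omega⟩ : Fin n)) =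
        v := by
  have e1 : ¬ (0 + 1 = n) := by omega
  have e2 : ¬ (1 + 1 = n) := by omega
  simp [tuple, e1, e2]

variable (hn : 2 < n) (h₁ : ∀ k : ℤ, a₁ ≠ k) (h₂ : ∀ k : ℤ, a₂ ≠ k)

/-- The vectors killed by the raising operators of `𝔟` of the weight of `x(b, 0)` lie in
`U(𝔞) x(b, 0)`: up to the image of `X`, such a vector is a multiple of `x(b, 0)`, and the remainder
is `X` applied to a vector of the same kind of smaller degree. -/
theorem mem_aGen_of_raising {b : ℤ} {h : 0 < n} {v : modN n a₁ a₂}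
    (hE : ∀ (i j : Fin n) (hij : i < j), ⁅bE hij.ne, v⁆ = 0)
    (hD : ⁅bD (⟨0, Nat.zero_lt_of_lt hn⟩ : Fin n) ⟨1, by omega⟩, v⁆ = (a₂ - b) • v) :
    v ∈ aGen n (xVec n h a₁ a₂ h₁ h₂ b) := by
  obtain ⟨r, hr⟩ := exists_mem_degFil (hn := hn) v
  induction r generalizing v with
  | zero =>
    rw [eq_zero_of_mem_degFil_zero hr]
    exact zero_mem _
  | succ r ih =>
    obtain ⟨g, hg, u, hu, rfl⟩ := exists_add_actX h₂ hr
    have hEu : ∀ (i j : Fin n) (hij : i < j), ⁅bE hij.ne, u⁆ = 0 := by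
      intro i j hij
      have h1 := hE i j hij
      rw [lie_add, lie_actX] at h1
      have h2 : ⁅bE hij.ne, g⁆ ∈ degFil hn a₁ a₂ 1 := by
        rw [mem_degFil, coe_bE]
        exact opE_mem_degLT_one rfl hij hg
      refine eq_zero_of_actX_mem (hn := hn) h₂ ?_
      rw [eq_neg_of_add_eq_zero_right h1]
      exact neg_mem h2
    have hEg : ∀ (i j : Fin n), i < j → opE i j (g : MonomialSpace (Fin n ⊕ Fin n)) = 0 := by
      intro i j hij
      have h1 := hE i j hij
      rw [lie_add, lie_actX, hEu i j hij, map_zero, add_zero] at h1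
      rw [← coe_bE hij.ne, h1]
      rfl
    have h3 : ⁅bD (⟨0, Nat.zero_lt_of_lt hn⟩ : Fin n) ⟨1, by omega⟩, g⁆ - (a₂ - b) • g =
        actX n a₁ a₂ ((a₂ - b) • u -
          ⁅bD (⟨0, Nat.zero_lt_of_lt hn⟩ : Fin n) ⟨1, by omega⟩, u⁆) := by
      rw [lie_add, lie_actX, smul_add] at hD
      rw [map_sub, map_smul, sub_eq_sub_iff_add_eq_add, hD, add_comm]
    have h4 := eq_zero_of_actX_mem (hn := hn) h₂
      (h3 ▸ sub_mem (bD_mem_degFil _ _ hg) (Submodule.smul_mem _ _ hg))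
    have hDu := (sub_eq_zero.1 h4).symm
    rw [h4, map_zero, sub_eq_zero] at h3
    obtain ⟨t, ht⟩ := eq_smul_xVec h₁ h₂ (b := b) (h := h) (mem_tuples_of_raising rfl
      (last_succ hn) (first_ne_last hn) h₁ h₂ hg hEg) fun b' hb' => by
        have h5 := coeff_bD (⟨0, Nat.zero_lt_of_lt hn⟩ : Fin n) ⟨1, by omega⟩
          (tuple n (a₁ + b') (a₂ - b')) g
        rw [h3, LieSubmodule.coe_smul, map_smul, tuple_weight hn, smul_eq_mul, ← sub_eq_zero,
          ← sub_mul] at h5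
        refine (mul_eq_zero.1 h5).resolve_left fun h0 => hb' ?_
        have : (b' : ℂ) = b := by linear_combination h0
        exact_mod_cast this
    rw [ht]
    exact add_mem ((aGen n (xVec n h a₁ a₂ h₁ h₂ b)).smul_mem t (LieSubmodule.subset_lieSpan rfl))
      ((aGen n (xVec n h a₁ a₂ h₁ h₂ b)).lie_mem (x := aLower n) (ih hEu hDu hu))

/-- The generator `x(b, 0)` of `U(𝔟) x(b, 0)`. -/
noncomputable def bGenVec (b : ℤ) (h : 0 < n) : bGen n (xVec n h a₁ a₂ h₁ h₂ b) :=
  ⟨xVec n h a₁ a₂ h₁ h₂ b, LieSubmodule.subset_lieSpan (Set.mem_singleton _)⟩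

theorem lieSpan_bGenVec (b : ℤ) (h : 0 < n) :
    LieSubmodule.lieSpan ℂ (bAlg n) {bGenVec h₁ h₂ b h} = ⊤ := lieSpan_generator rfl _

/-- The map `p ⊗ X ^ i x(b, 0) ↦ X ^ i p` which realizes the correspondence. -/
noncomputable def pairing (b : ℤ) (h : 0 < n) :
    bGen n (xVec n h a₁ a₂ h₁ h₂ b) →ₗ[ℂ] aGen n (xVec n h a₁ a₂ h₁ h₂ b) →ₗ[ℂ]
      modN n a₁ a₂ :=
  ((aGenBasis hn h₁ h₂ b h).constr ℂ).toLinearMap ∘ₗ LinearMap.pi fun i =>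
    (actX n a₁ a₂ ^ i) ∘ₗ (bGen n (xVec n h a₁ a₂ h₁ h₂ b)).toSubmodule.subtype

theorem pairing_aGenBasis (b : ℤ) (h : 0 < n) (p : bGen n (xVec n h a₁ a₂ h₁ h₂ b)) (i : ℕ) :
    pairing hn h₁ h₂ b h p (aGenBasis hn h₁ h₂ b h i) = (actX n a₁ a₂ ^ i) p :=
  (aGenBasis hn h₁ h₂ b h).constr_basis ℂ _ i

theorem pairing_lie (b : ℤ) (h : 0 < n) (u : bAlg n) (p : bGen n (xVec n h a₁ a₂ h₁ h₂ b))
    (q : aGen n (xVec n h a₁ a₂ h₁ h₂ b)) :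
    pairing hn h₁ h₂ b h ⁅u, p⁆ q = ⁅u, pairing hn h₁ h₂ b h p q⁆ := by
  have : pairing hn h₁ h₂ b h ⁅u, p⁆ =
      LieModule.toEnd ℂ (bAlg n) (modN n a₁ a₂) u ∘ₗ pairing hn h₁ h₂ b h p := by
    refine (aGenBasis hn h₁ h₂ b h).ext fun i => ?_
    rw [LinearMap.comp_apply, pairing_aGenBasis, pairing_aGenBasis, LieModule.toEnd_apply_apply,
      lie_actX_pow]
    rfl
  rw [this]
  rfl

theorem pairing_generator (b : ℤ) (h : 0 < n) (q : aGen n (xVec n h a₁ a₂ h₁ h₂ b)) :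
    pairing hn h₁ h₂ b h (bGenVec h₁ h₂ b h) q = q := by
  have : pairing hn h₁ h₂ b h (bGenVec h₁ h₂ b h) =
      (aGen n (xVec n h a₁ a₂ h₁ h₂ b)).toSubmodule.subtype := by
    refine (aGenBasis hn h₁ h₂ b h).ext fun i => ?_
    rw [pairing_aGenBasis]
    exact (coe_aGenBasis hn h₁ h₂ b h i).symm
  rw [this]
  rfl

/-- Both sides commute with `𝔟` in `p`, and they agree for `p = x(b, 0)`. -/
theorem lie_pairing (b : ℤ) (h : 0 < n) (w : aAlg n) (p : bGen n (xVec n h a₁ a₂ h₁ h₂ b))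
    (q : aGen n (xVec n h a₁ a₂ h₁ h₂ b)) :
    pairing hn h₁ h₂ b h p ⁅w, q⁆ = ⁅w, pairing hn h₁ h₂ b h p q⁆ := by
  refine eq_of_eq_generator (lieSpan_bGenVec h₁ h₂ b h)
    (f := (pairing hn h₁ h₂ b h).flip ⁅w, q⁆)
    (g := LieModule.toEnd ℂ (aAlg n) (modN n a₁ a₂) w ∘ₗ (pairing hn h₁ h₂ b h).flip q)
    (fun u p => ?_) (fun u p => ?_) ?_ p
  · exact pairing_lie hn h₁ h₂ b h u p _
  · change ⁅w, pairing hn h₁ h₂ b h ⁅u, p⁆ q⁆ = ⁅u, ⁅w, pairing hn h₁ h₂ b h p q⁆⁆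
    rw [pairing_lie, lie_bAlg_lie_aAlg]
  · change pairing hn h₁ h₂ b h (bGenVec h₁ h₂ b h) ⁅w, q⁆ =
      ⁅w, pairing hn h₁ h₂ b h (bGenVec h₁ h₂ b h) q⁆
    rw [pairing_generator, pairing_generator]
    rfl

/-- The vectors `X ^ i p` with `p` in `U(𝔟) x(b, 0)` are in different eigenspaces of `H` for
different `i`, and `X` is injective. -/
theorem lift_pairing_injective (b : ℤ) (h : 0 < n) :
    Function.Injective (TensorProduct.lift (pairing hn h₁ h₂ b h)) := by
  refine lift_injective_of_basis (aGenBasis hn h₁ h₂ b h) _ (H := actH n a₁ a₂)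
    (μ := fun i : ℕ => wtH n a₁ a₂ b - 2 * i) (fun i j hij => ?_) (fun p i => ?_) fun p i hp => ?_
  · have hij' : wtH n a₁ a₂ b - 2 * (i : ℂ) = wtH n a₁ a₂ b - 2 * j := hij
    have : (i : ℂ) = j := by linear_combination -hij' / 2
    exact_mod_cast this
  · rw [pairing_aGenBasis]
    have hp : (p : modN n a₁ a₂) ∈ hwSpace n a₁ a₂ b := by
      rw [← bGen_eq h₁ h₂ hn b h]
      exact p.2
    exact H_pow_X actH_actX hp.2 i
  · rw [pairing_aGenBasis] at hp
    exact Subtype.ext (actX_pow_injective (hn := hn) h₂ i hp)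

include hn in
/-- A homomorphism from `U(𝔟) x(b, 0)` to `N_{a₁,a₂}` is determined by the image of `x(b, 0)`,
which is a vector of `U(𝔞) x(b, 0)`. -/
theorem corresponds_bGen_aGen (b : ℤ) (h : 0 < n) :
    Corresponds n a₁ a₂ (bGen n (xVec n h a₁ a₂ h₁ h₂ b))
      (aGen n (xVec n h a₁ a₂ h₁ h₂ b)) := by
  refine ⟨pairing hn h₁ h₂ b h, pairing_lie hn h₁ h₂ b h, lie_pairing hn h₁ h₂ b h,
    lift_pairing_injective hn h₁ h₂ b h, fun f => ?_⟩
  have hfx : f (bGenVec h₁ h₂ b h) ∈ aGen n (xVec n h a₁ a₂ h₁ h₂ b) := by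
    refine mem_aGen_of_raising hn h₁ h₂ (fun i j hij => ?_) ?_
    · have : ⁅bE hij.ne, bGenVec h₁ h₂ b h⁆ = 0 := Subtype.ext (bE_xVec h₁ h₂ hij b h)
      rw [← LieModuleHom.map_lie, this, map_zero]
    · have : ⁅bD (⟨0, Nat.zero_lt_of_lt hn⟩ : Fin n) ⟨1, by omega⟩, bGenVec h₁ h₂ b h⁆ =
          (a₂ - b) • bGenVec h₁ h₂ b h :=
        Subtype.ext ((bD_xVec h₁ h₂ _ _ b h).trans (by rw [tuple_weight hn]; rfl))
      rw [← LieModuleHom.map_lie, this, map_smul]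
  refine ⟨⟨f (bGenVec h₁ h₂ b h), hfx⟩, fun p => ?_⟩
  refine eq_of_eq_generator (lieSpan_bGenVec h₁ h₂ b h)
    (f := f.toLinearMap) (g := (pairing hn h₁ h₂ b h).flip ⟨f (bGenVec h₁ h₂ b h), hfx⟩)
    (fun u p => ?_) (fun u p => ?_) ?_ p
  · exact f.map_lie u p
  · exact pairing_lie hn h₁ h₂ b h u p _
  · exact (pairing_generator hn h₁ h₂ b h ⟨f (bGenVec h₁ h₂ b h), hfx⟩).symm

theorem Corresponds.congr {P P' Q Q' : Type*} [AddCommGroup P] [Module ℂ P]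
    [LieRingModule (bAlg n) P] [LieModule ℂ (bAlg n) P] [AddCommGroup P'] [Module ℂ P']
    [LieRingModule (bAlg n) P'] [LieModule ℂ (bAlg n) P'] [AddCommGroup Q] [Module ℂ Q]
    [LieRingModule (aAlg n) Q] [LieModule ℂ (aAlg n) Q] [AddCommGroup Q'] [Module ℂ Q']
    [LieRingModule (aAlg n) Q'] [LieModule ℂ (aAlg n) Q'] (hPQ : Corresponds n a₁ a₂ P Q)
    (e : P ≃ₗ⁅ℂ, bAlg n⁆ P') (e' : Q ≃ₗ⁅ℂ, aAlg n⁆ Q') : Corresponds n a₁ a₂ P' Q' := by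
  obtain ⟨Φ, hb, ha, hinj, hf⟩ := hPQ
  refine ⟨Φ.compl₁₂ e.symm.toLinearEquiv.toLinearMap e'.symm.toLinearEquiv.toLinearMap,
    fun u p q => ?_, fun u p q => ?_, ?_, fun f => ?_⟩
  · change Φ (e.symm ⁅u, p⁆) (e'.symm q) = ⁅u, Φ (e.symm p) (e'.symm q)⁆
    rw [← hb]
    exact congrArg (fun t => Φ t (e'.symm q)) (e.symm.toLieModuleHom.map_lie u p)
  · change Φ (e.symm p) (e'.symm ⁅u, q⁆) = ⁅u, Φ (e.symm p) (e'.symm q)⁆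
    rw [← ha]
    exact congrArg (Φ (e.symm p)) (e'.symm.toLieModuleHom.map_lie u q)
  · have : TensorProduct.lift (Φ.compl₁₂ e.symm.toLinearEquiv.toLinearMap
        e'.symm.toLinearEquiv.toLinearMap) = TensorProduct.lift Φ ∘ₗ
          (TensorProduct.congr e.symm.toLinearEquiv e'.symm.toLinearEquiv).toLinearMap :=
      TensorProduct.ext' fun _ _ => rfl
    rw [this]
    exact hinj.comp (LinearEquiv.injective _)
  · obtain ⟨q, hq⟩ := hf (f.comp e.toLieModuleHom)
    refine ⟨e' q, fun p => ?_⟩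
    change f p = Φ (e.symm p) (e'.symm (e' q))
    rw [LieModuleEquiv.symm_apply_apply, ← hq]
    exact (congrArg f (e.apply_symm_apply p)).symm

theorem wtH_eq_intCast {d : ℤ} (hd : a₁ - a₂ = d) (b : ℤ) :
    wtH n a₁ a₂ b = ((d + 2 * b - ((n : ℤ) - 1) : ℤ) : ℂ) := by
  rw [wtH, hd]
  push_cast
  ring

end Correspondence

section SimpleCorrespondence

variable {n : ℕ} {a₁ a₂ : ℂ} (hn : 2 < n) (h₁ : ∀ k : ℤ, a₁ ≠ k) (h₂ : ∀ k : ℤ, a₂ ≠ k)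

include hn h₁ h₂

theorem corresponds_bSimple_aSimple {b : ℤ} (hb : ∀ i : ℕ, 0 < i → wtH n a₁ a₂ b + i + 1 ≠ 0)
    (hb' : ∀ i : ℕ, wtH n a₁ a₂ b ≠ i) :
    Corresponds n a₁ a₂ (bSimple n (bWeight n (a₂ - b) (-1 - a₁ - b)))
      (aSimple n (wtH n a₁ a₂ b)) := by
  have h : 0 < n := Nat.zero_lt_of_lt hn
  obtain ⟨e⟩ := nonempty_bGen_equiv hn h₁ h₂ hb h
  obtain ⟨e'⟩ := nonempty_aGen_equiv_aSimple hn h₁ h₂ hb' h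
  exact (corresponds_bGen_aGen hn h₁ h₂ b h).congr e e'

theorem corresponds_bSimple_aVerma {b : ℤ} (hb : ∀ i : ℕ, 0 < i → wtH n a₁ a₂ b + i + 1 ≠ 0) :
    Corresponds n a₁ a₂ (bSimple n (bWeight n (a₂ - b) (-1 - a₁ - b)))
      (aVerma n (wtH n a₁ a₂ b)) := by
  have h : 0 < n := Nat.zero_lt_of_lt hn
  obtain ⟨e⟩ := nonempty_bGen_equiv hn h₁ h₂ hb h
  obtain ⟨e'⟩ := nonempty_aGen_equiv_aVerma hn h₁ h₂ b h
  exact (corresponds_bGen_aGen hn h₁ h₂ b h).congr e e'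

theorem corresponds_bGen_aSimple {b : ℤ} (hb : ∀ i : ℕ, wtH n a₁ a₂ b ≠ i) (h : 0 < n) :
    Corresponds n a₁ a₂ (bGen n (xVec n h a₁ a₂ h₁ h₂ b)) (aSimple n (wtH n a₁ a₂ b)) := by
  obtain ⟨e'⟩ := nonempty_aGen_equiv_aSimple hn h₁ h₂ hb h
  exact (corresponds_bGen_aGen hn h₁ h₂ b h).congr LieModuleEquiv.refl e'

end SimpleCorrespondence

end HoweDual

theorem mainTheorem2 (n : ℕ) (hn : 2 < n) (a₁ a₂ : ℂ)
    (h₁ : ∀ k : ℤ, a₁ ≠ k) (h₂ : ∀ k : ℤ, a₂ ≠ k)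
    (d : ℤ) (hd : a₁ - a₂ = d) (b : ℤ) :
    (d + 2 * b - ((n : ℤ) - 2) = 0 →
      LieModule.IsIrreducible ℂ (HoweDual.bAlg n)
        (HoweDual.bGen n (HoweDual.xVec n (by omega) a₁ a₂ h₁ h₂ b)) ∧
      Nonempty (HoweDual.bGen n (HoweDual.xVec n (by omega) a₁ a₂ h₁ h₂ b)
        ≃ₗ⁅ℂ, HoweDual.bAlg n⁆
          HoweDual.bSimple n (HoweDual.bWeight n (a₂ - b) (-1 - a₁ - b))) ∧
      Nonempty (HoweDual.aGen n (HoweDual.xVec n (by omega) a₁ a₂ h₁ h₂ b)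
        ≃ₗ⁅ℂ, HoweDual.aAlg n⁆ HoweDual.aSimple n (-1)) ∧
      HoweDual.Corresponds n a₁ a₂
        (HoweDual.bSimple n (HoweDual.bWeight n (a₂ - b) (-1 - a₁ - b)))
        (HoweDual.aSimple n (-1))) ∧
    (0 < d + 2 * b - ((n : ℤ) - 2) →
      LieModule.IsIrreducible ℂ (HoweDual.bAlg n)
        (HoweDual.bGen n (HoweDual.xVec n (by omega) a₁ a₂ h₁ h₂ b)) ∧
      Nonempty (HoweDual.bGen n (HoweDual.xVec n (by omega) a₁ a₂ h₁ h₂ b)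
        ≃ₗ⁅ℂ, HoweDual.bAlg n⁆
          HoweDual.bSimple n (HoweDual.bWeight n (a₂ - b) (-1 - a₁ - b))) ∧
      Nonempty (HoweDual.aGen n (HoweDual.xVec n (by omega) a₁ a₂ h₁ h₂ b)
        ≃ₗ⁅ℂ, HoweDual.aAlg n⁆ HoweDual.aVerma n (a₁ - a₂ + 2 * b - (n - 1))) ∧
      HoweDual.Corresponds n a₁ a₂
        (HoweDual.bSimple n (HoweDual.bWeight n (a₂ - b) (-1 - a₁ - b)))
        (HoweDual.aVerma n (a₁ - a₂ + 2 * b - (n - 1)))) ∧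
    (d + 2 * b - ((n : ℤ) - 2) < 0 →
      HoweDual.IsIndecomposable (HoweDual.bAlg n)
        (HoweDual.bGen n (HoweDual.xVec n (by omega) a₁ a₂ h₁ h₂ b)) ∧
      HoweDual.HasLengthTwo (HoweDual.bAlg n)
        (HoweDual.bGen n (HoweDual.xVec n (by omega) a₁ a₂ h₁ h₂ b)) ∧
      Nonempty (HoweDual.aGen n (HoweDual.xVec n (by omega) a₁ a₂ h₁ h₂ b)
        ≃ₗ⁅ℂ, HoweDual.aAlg n⁆ HoweDual.aSimple n (a₁ - a₂ + 2 * b - (n - 1))) ∧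
      HoweDual.Corresponds n a₁ a₂
        (HoweDual.bGen n (HoweDual.xVec n (by omega) a₁ a₂ h₁ h₂ b))
        (HoweDual.aSimple n (a₁ - a₂ + 2 * b - (n - 1)))) := by
  have h : 0 < n := Nat.zero_lt_of_lt hn
  have hwt := HoweDual.wtH_eq_intCast (n := n) hd b
  -- the weight of `x(b, 0)` is one less than the number on which the cases depend, and `-1`, in the
  -- first case, is the only weight that is both negative and large enough for simplicity under `𝔟`
  have hsimple : -1 ≤ d + 2 * b - ((n : ℤ) - 1) →
      ∀ i : ℕ, 0 < i → HoweDual.wtH n a₁ a₂ b + i + 1 ≠ 0 := by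
    intro hz i hi h0
    rw [hwt] at h0
    have : d + 2 * b - ((n : ℤ) - 1) + i + 1 = 0 := by exact_mod_cast h0
    omega
  have hneg : d + 2 * b - ((n : ℤ) - 1) < 0 → ∀ i : ℕ, HoweDual.wtH n a₁ a₂ b ≠ i := by
    intro hz i h0
    rw [hwt] at h0
    have : d + 2 * b - ((n : ℤ) - 1) = i := by exact_mod_cast h0
    omega
  refine ⟨fun hz => ?_, fun hz => ?_, fun hz => ?_⟩
  · have hb := hsimple (by omega)
    have hb' := hneg (by omega)
    have hw : HoweDual.wtH n a₁ a₂ b = -1 := by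
      rw [hwt, show d + 2 * b - ((n : ℤ) - 1) = -1 by omega]
      norm_num
    have he := HoweDual.nonempty_aGen_equiv_aSimple hn h₁ h₂ hb' h
    have hc := HoweDual.corresponds_bSimple_aSimple hn h₁ h₂ hb hb'
    rw [hw] at he hc
    exact ⟨HoweDual.isIrreducible_bGen hn h₁ h₂ hb h, HoweDual.nonempty_bGen_equiv hn h₁ h₂ hb h,
      he, hc⟩
  · have hb := hsimple (by omega)
    exact ⟨HoweDual.isIrreducible_bGen hn h₁ h₂ hb h, HoweDual.nonempty_bGen_equiv hn h₁ h₂ hb h,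
      HoweDual.nonempty_aGen_equiv_aVerma hn h₁ h₂ b h,
      HoweDual.corresponds_bSimple_aVerma hn h₁ h₂ hb⟩
  · have hb := hneg (by omega)
    obtain ⟨m, hm⟩ : ∃ m : ℕ, d + 2 * b - ((n : ℤ) - 1) = -((m : ℤ) + 2) :=
      ⟨(-(d + 2 * b - ((n : ℤ) - 1)) - 2).toNat, by omega⟩
    have hw : HoweDual.wtH n a₁ a₂ b = -((m : ℂ) + 2) := by
      rw [hwt, hm]
      push_cast
      ring
    exact ⟨HoweDual.isIndecomposable_bGen hn h₁ h₂ b h,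
      HoweDual.hasLengthTwo_bGen hn h₁ h₂ hw h,
      HoweDual.nonempty_aGen_equiv_aSimple hn h₁ h₂ hb h,
      HoweDual.corresponds_bGen_aSimple hn h₁ h₂ hb h⟩
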